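/- Let $H$ be a finite-dimensional Hopf algebra over a field $k$, with comultiplication $\Delta(h)=\sum h_{(1)}\otimes h_{(2)}$ and counit $\epsilon$, and let $B$ be a right $H$-module algebra, i.e. a $k$-algebra with a right $H$-module structure such that $1\cdot h=\epsilon(h)1$ and $(bc)\cdot h=\sum (b\cdot h_{(1)})(c\cdot h_{(2)})$. Let $A=H\# B$ be the smash product: the vector space $H\otimes B$ with multiplication $(h\otimes b)(l\otimes c)=\sum hl_{(1)}\otimes (b\cdot l_{(2)})c$; it contains $H=H\otimes 1$ and is a left $H$-comodule algebra by $\Delta_A(h\otimes b)=\Delta(h)\otimes b$. For a left $H$-module $V$ and a left $A$-module $M$ the tensor product $V\otimes M$ over $k$ is an $A$-module via $\Delta_A$; likewise, $V\otimes W$ is an $H$-module via $\Delta$ for $H$-modules $V,W$. All modules are left modules. Let $\mathcal C$ be a class of $A$-modules closed under finite direct sums, subquotients and $M\mapsto H\otimes M$ (for instance all $A$-modules, or all finite-dimensional ones). Let $A_H\text{-}\underline{\mathrm{mod}}$ be the category of modules in $\mathcal C$ modulo the morphisms that factor through $H\otimes N$ for some $N\in\mathcal C$. Let $H\text{-}\underline{\mathrm{mod}}$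 be the stable category of $H$-modules, i.e. $H$-modules modulo the morphisms that factor through an injective module. A morphism of $A_H\text{-}\underline{\mathrm{mod}}$ is a quasi-isomorphism if it restricts to an isomorphism in $H\text{-}\underline{\mathrm{mod}}$, and $D(B,H)$ is the localization of $A_H\text{-}\underline{\mathrm{mod}}$ at the quasi-isomorphisms. A left integral is an element $\Lambda\neq 0$ of $H$ with $h\Lambda=\epsilon(h)\Lambda$ for all $h\in H$. Given one, put $T(M)=(H/k\Lambda)\otimes M$. For a morphism $u:X\to Y$ of modules let $C_u$ be the pushout of $u$ and $X\to H\otimes X$, $x\mapsto\Lambda\otimes x$, and let $w:C_u\to TX$ be the morphism that is zero on $Y$ and is the projection $H\otimes X\to TX$ on $H\otimes X$; the sequence $X\xrightarrow{u}Y\to C_u\xrightarrow{w}TX$ is the standard triangle of $u$. The Grothendieck group $K(\mathcal T)$ of a triangulated category $\mathcal T$ is generated by symbols $[X]$ for the objects $X$ of $\mathcal T$, with relations $[Y]=[X]+[Z]$ for all distinguished triangles $X\to Y\to Z\to X[1]$. Then a left integral exists, and for every left integral $\Lambda$ and every class $\mathcal C$ as above: 1. $D(B,H)$ is a triangulated category,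 with shift functor induced by $T$ and with distinguished triangles those isomorphic to images of standard triangles of modules in $\mathcal C$. 2. For every $H$-module $V$ such that $V\otimes M\in\mathcal C$ for all $M\in\mathcal C$ (every $V$, if $\mathcal C$ consists of all modules; every finite-dimensional $V$, for any $\mathcal C$), the functor $M\mapsto V\otimes M$ induces an exact functor $D(B,H)\to D(B,H)$, i.e. an additive functor that commutes with the shift and preserves distinguished triangles. 3. The stable category $H\text{-}\underline{\mathrm{mod}}$ of finite-dimensional $H$-modules is triangulated in the same way, with shift functor induced by $V\mapsto (H/k\Lambda)\otimes V$ and with distinguished triangles those isomorphic to images of standard triangles of finite-dimensional $H$-modules; its Grothendieck group $K(H\text{-}\underline{\mathrm{mod}})$ is a ring with $[V][W]=[V\otimes W]$ and $1=[k]$, where $H$ acts on $k$ by $\epsilon$; and $K(D(B,H))$ is a left module over this ring with $[V]\cdot[M]=[V\otimes M]$ for $V$ finite-dimensional and $M\in\mathcal C$. -/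

import Mathlib

open CategoryTheory CategoryTheory.Limits CategoryTheory.Pretriangulated TensorProduct
open scoped ModuleCat

universe u

noncomputable section

namespace Hopfological

/-! ### Comodule algebras, module algebras and the smash product -/

/-- A left `H`-comodule algebra: a `k`-algebra `A` with a coassociative and counital coaction
`A → H ⊗ A` that is a homomorphism of algebras. -/
class LeftComoduleAlgebra (k H A : Type u) [Field k] [Ring H] [Bialgebra k H]
    [Ring A] [Algebra k A] where
  coact : A →ₐ[k] H ⊗[k] A
  counit_coact : ∀ a : A,
    TensorProduct.lid k A ((Coalgebra.counit (R := k) (A := H)).rTensor A (coact a)) = a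
  coassoc_coact : ∀ a : A,
    TensorProduct.assoc k H H A ((Coalgebra.comul (R := k) (A := H)).rTensor A (coact a)) =
      coact.toLinearMap.lTensor H (coact a)

/-- `H` is a comodule algebra over itself through its comultiplication. -/
instance LeftComoduleAlgebra.self (k H : Type u) [Field k] [Ring H] [Bialgebra k H] :
    LeftComoduleAlgebra k H H where
  coact := Bialgebra.comulAlgHom k H
  counit_coact a := by simp
  coassoc_coact a := by
    simp

/-- A right `H`-module algebra: a `k`-algebra `B` with a right action `act b h = b · h` of `H`
for which the unit and the multiplication of `B` are maps of `H`-modules: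
`1 · h = ε(h) 1` and `(b c) · h = ∑ (b · h₍₁₎) (c · h₍₂₎)`. -/
class RightModuleAlgebra (k H B : Type u) [Field k] [Ring H] [Bialgebra k H]
    [Ring B] [Algebra k B] where
  act (k) : B →ₗ[k] H →ₗ[k] B
  act_one : ∀ b : B, act b 1 = b
  act_mul : ∀ (b : B) (h l : H), act b (h * l) = act (act b h) l
  one_act : ∀ h : H, act 1 h = algebraMap k B (Coalgebra.counit (R := k) h)
  mul_act : ∀ (b c : B) (h : H),
    act (b * c) h =
      LinearMap.mul' k B (TensorProduct.map (act b) (act c) (Coalgebra.comul (R := k) h))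

section Smash

variable (k H B : Type u) [Field k] [Ring H] [Bialgebra k H] [Ring B] [Algebra k B]
  [RightModuleAlgebra k H B]

open RightModuleAlgebra

/-- The underlying `k`-vector space `H ⊗ B` of the smash product `H # B`. -/
@[nolint unusedArguments]
def SmashProduct : Type u := H ⊗[k] B

namespace SmashProduct

instance : AddCommGroup (SmashProduct k H B) := inferInstanceAs (AddCommGroup (H ⊗[k] B))

instance : Module k (SmashProduct k H B) := inferInstanceAs (Module k (H ⊗[k] B))

/-- The element `h ⊗ b`. -/
def mk : H →ₗ[k] B →ₗ[k] SmashProduct k H B := TensorProduct.mk k H B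

variable {k H B} in
theorem induction_mk {p : SmashProduct k H B → Prop} (x : SmashProduct k H B) (h0 : p 0)
    (hm : ∀ h b, p (mk k H B h b)) (ha : ∀ x y, p x → p y → p (x + y)) : p x :=
  TensorProduct.induction_on (motive := p) x h0 hm ha

/-- For fixed `h`, `b`, `c`, the map `H ⊗ H → H ⊗ B`, `l ⊗ l' ↦ h l ⊗ (b · l') c`. -/
def twist (h : H) (b c : B) : H ⊗[k] H →ₗ[k] SmashProduct k H B :=
  TensorProduct.map (LinearMap.mulLeft k h) ((LinearMap.mulRight k c) ∘ₗ act k b)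

variable {k H B} in
theorem twist_tmul (h : H) (b c : B) (l l' : H) :
    twist k H B h b c (l ⊗ₜ l') = mk k H B (h * l) (act k b l' * c) := rfl

/-- The multiplication of the smash product on elementary tensors,
`(h ⊗ b) (l ⊗ c) = ∑ h l₍₁₎ ⊗ (b · l₍₂₎) c`. -/
def mulAux (h : H) (b : B) : SmashProduct k H B →ₗ[k] SmashProduct k H B :=
  TensorProduct.lift (LinearMap.mk₂ k
    (fun (l : H) (c : B) => twist k H B h b c (Coalgebra.comul (R := k) l))
    (fun l l' c => by simp) (fun r l c => by simp)
    (fun l c c' => by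
      generalize Coalgebra.comul (R := k) l = t
      induction t with
      | zero => simp
      | tmul x y => simp [twist_tmul, mul_add]
      | add x y hx hy => simp only [map_add, hx, hy]; abel)
    (fun r l c => by
      generalize Coalgebra.comul (R := k) l = t
      induction t with
      | zero => simp
      | tmul x y => simp [twist_tmul]
      | add x y hx hy => simp only [map_add, hx, hy, smul_add]))

variable {k H B} in
theorem mulAux_mk (h : H) (b : B) (l : H) (c : B) :
    mulAux k H B h b (mk k H B l c) = twist k H B h b c (Coalgebra.comul (R := k) l) :=
  rfl

/-- The multiplication of the smash product as a bilinear map. -/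
def mulHom : SmashProduct k H B →ₗ[k] SmashProduct k H B →ₗ[k] SmashProduct k H B :=
  TensorProduct.lift (LinearMap.mk₂ k (fun (h : H) (b : B) => mulAux k H B h b)
    (fun h h' b => by
      ext x
      induction x using induction_mk with
      | h0 => simp
      | hm l c =>
        simp only [mulAux_mk, LinearMap.add_apply]
        generalize Coalgebra.comul (R := k) l = t
        induction t with
        | zero => simp
        | tmul x y => simp [twist_tmul, add_mul]
        | add x y hx hy => simp only [map_add, hx, hy]; abel
      | ha x y hx hy => simp only [map_add, hx, hy])
    (fun r h b => by
      ext x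
      induction x using induction_mk with
      | h0 => simp
      | hm l c =>
        simp only [mulAux_mk, LinearMap.smul_apply]
        generalize Coalgebra.comul (R := k) l = t
        induction t with
        | zero => simp
        | tmul x y => simp [twist_tmul]
        | add x y hx hy => simp only [map_add, hx, hy, smul_add]
      | ha x y hx hy => simp only [map_add, hx, hy])
    (fun h b b' => by
      ext x
      induction x using induction_mk with
      | h0 => simp
      | hm l c =>
        simp only [mulAux_mk, LinearMap.add_apply]
        generalize Coalgebra.comul (R := k) l = t
        induction t with
        | zero => simp
        | tmul x y => simp [twist_tmul, add_mul]
        | add x y hx hy => simp only [map_add, hx, hy]; abel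
      | ha x y hx hy => simp only [map_add, hx, hy])
    (fun r h b => by
      ext x
      induction x using induction_mk with
      | h0 => simp
      | hm l c =>
        simp only [mulAux_mk, LinearMap.smul_apply]
        generalize Coalgebra.comul (R := k) l = t
        induction t with
        | zero => simp
        | tmul x y => simp [twist_tmul]
        | add x y hx hy => simp only [map_add, hx, hy, smul_add]
      | ha x y hx hy => simp only [map_add, hx, hy]))

instance : Mul (SmashProduct k H B) := ⟨fun x y => mulHom k H B x y⟩

instance : One (SmashProduct k H B) := ⟨mk k H B 1 1⟩

variable {k H B}

theorem mul_def (x y : SmashProduct k H B) : x * y = mulHom k H B x y := rfl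

theorem one_def : (1 : SmashProduct k H B) = mk k H B 1 1 := rfl

theorem mk_mul_mk (h l : H) (b c : B) :
    mk k H B h b * mk k H B l c = twist k H B h b c (Coalgebra.comul (R := k) l) := rfl

protected theorem add_mul (x y z : SmashProduct k H B) : (x + y) * z = x * z + y * z := by
  simp [mul_def]

protected theorem mul_add (x y z : SmashProduct k H B) : x * (y + z) = x * y + x * z := by
  simp [mul_def]

protected theorem zero_mul (x : SmashProduct k H B) : 0 * x = 0 := by simp [mul_def]

protected theorem mul_zero (x : SmashProduct k H B) : x * 0 = 0 := by simp [mul_def]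

protected theorem one_mul (x : SmashProduct k H B) : 1 * x = x := by
  induction x using induction_mk with
  | h0 => exact SmashProduct.mul_zero _
  | hm l c =>
    rw [one_def, mk_mul_mk]
    have : ∀ t : H ⊗[k] H, twist k H B 1 1 c t =
        mk k H B (TensorProduct.rid k H ((Coalgebra.counit (R := k) (A := H)).lTensor H t)) c := by
      intro t
      induction t with
      | zero => simp
      | tmul x y => simp [twist_tmul, one_act, Algebra.algebraMap_eq_smul_one]
      | add x y hx hy => simp only [map_add, hx, hy, LinearMap.add_apply]
    rw [this]
    simp
  | ha x y hx hy => rw [SmashProduct.mul_add, hx, hy]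

protected theorem mul_one (x : SmashProduct k H B) : x * 1 = x := by
  induction x using induction_mk with
  | h0 => exact SmashProduct.zero_mul _
  | hm l c =>
    rw [one_def, mk_mul_mk, Bialgebra.comul_one, Algebra.TensorProduct.one_def, twist_tmul,
      act_one, mul_one, mul_one]
  | ha x y hx hy => rw [SmashProduct.add_mul, hx, hy]

/-- Auxiliary: the map `x ⊗ (y ⊗ z) ↦ h l x ⊗ (b · (l' y)) (c · z) d`. -/
def assocAux (h l l' : H) (b c d : B) : H ⊗[k] (H ⊗[k] H) →ₗ[k] SmashProduct k H B :=
  TensorProduct.map (LinearMap.mulLeft k (h * l))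
    (LinearMap.mulRight k d ∘ₗ LinearMap.mul' k B ∘ₗ
      TensorProduct.map (act k (act k b l')) (act k c))

theorem assocAux_tmul (h l l' : H) (b c d : B) (x y z : H) :
    assocAux h l l' b c d (x ⊗ₜ (y ⊗ₜ z)) =
      mk k H B (h * l * x) (act k (act k b l') y * act k c z * d) := rfl

theorem mul_assoc_left (h l l' m : H) (b c d : B) :
    mk k H B (h * l) (act k b l' * c) * mk k H B m d =
      assocAux h l l' b c d
        ((Coalgebra.comul (R := k) (A := H)).lTensor H (Coalgebra.comul (R := k) m)) := by
  rw [mk_mul_mk]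
  generalize Coalgebra.comul (R := k) m = t
  induction t with
  | zero => simp
  | tmul x y =>
    rw [twist_tmul, mul_act, LinearMap.lTensor_tmul]
    rfl
  | add x y hx hy => simp only [map_add, hx, hy]

theorem twist_mul (h l l' : H) (b c d : B) (y : H) (s : H ⊗[k] H) :
    twist k H B h b (act k c y * d) ((l ⊗ₜ[k] l') * s) =
      assocAux h l l' b c d (TensorProduct.assoc k H H H (s ⊗ₜ y)) := by
  induction s with
  | zero => simp
  | tmul u v =>
    simp only [Algebra.TensorProduct.tmul_mul_tmul, twist_tmul, TensorProduct.assoc_tmul,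
      assocAux_tmul, act_mul, mul_assoc]
  | add u v hu hv => simp only [mul_add, map_add, hu, hv, TensorProduct.add_tmul]

protected theorem mul_assoc (x y z : SmashProduct k H B) : x * y * z = x * (y * z) := by
  induction x using induction_mk with
  | h0 => simp only [SmashProduct.zero_mul]
  | ha x x' hx hx' => simp only [SmashProduct.add_mul, hx, hx']
  | hm h b =>
  induction y using induction_mk with
  | h0 => simp only [SmashProduct.zero_mul, SmashProduct.mul_zero]
  | ha y y' hy hy' => simp only [SmashProduct.add_mul, SmashProduct.mul_add, hy, hy']
  | hm l c =>
  induction z using induction_mk with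
  | h0 => simp only [SmashProduct.mul_zero]
  | ha z z' hz hz' => simp only [SmashProduct.mul_add, hz, hz']
  | hm m d =>
  rw [mk_mul_mk h l, mk_mul_mk l m]
  have hR : ∀ t : H ⊗[k] H, mk k H B h b * twist k H B l c d t =
      ∑ i ∈ (Coalgebra.Repr.arbitrary k l).index,
        assocAux h ((Coalgebra.Repr.arbitrary k l).left i)
          ((Coalgebra.Repr.arbitrary k l).right i) b c d
          (TensorProduct.assoc k H H H ((Coalgebra.comul (R := k) (A := H)).rTensor H t)) := by
    intro t
    induction t with
    | zero => simp [SmashProduct.mul_zero]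
    | tmul u v =>
      rw [twist_tmul, mk_mul_mk, Bialgebra.comul_mul]
      nth_rewrite 1 [← (Coalgebra.Repr.arbitrary k l).eq]
      simp only [Finset.sum_mul, map_sum, twist_mul, LinearMap.rTensor_tmul]
    | add u v hu hv => simp only [map_add, SmashProduct.mul_add, hu, hv, Finset.sum_add_distrib]
  rw [hR, Coalgebra.coassoc_apply]
  nth_rewrite 1 [← (Coalgebra.Repr.arbitrary k l).eq]
  rw [map_sum, mul_def, map_sum, LinearMap.sum_apply]
  refine Finset.sum_congr rfl fun i _ => ?_
  rw [← mul_def, twist_tmul, mul_assoc_left]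

instance : Ring (SmashProduct k H B) where
  mul_assoc := SmashProduct.mul_assoc
  one_mul := SmashProduct.one_mul
  mul_one := SmashProduct.mul_one
  left_distrib := SmashProduct.mul_add
  right_distrib := SmashProduct.add_mul
  zero_mul := SmashProduct.zero_mul
  mul_zero := SmashProduct.mul_zero
  neg_add_cancel := neg_add_cancel
  zsmul := fun n x => n • x
  zsmul_zero' := SubNegMonoid.zsmul_zero'
  zsmul_succ' := SubNegMonoid.zsmul_succ'
  zsmul_neg' := SubNegMonoid.zsmul_neg'

instance : Algebra k (SmashProduct k H B) :=
  Algebra.ofModule (fun r x y => by simp [mul_def]) (fun r x y => by simp [mul_def])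

theorem algebraMap_def (r : k) :
    algebraMap k (SmashProduct k H B) r = mk k H B (algebraMap k H r) 1 := by
  rw [Algebra.algebraMap_eq_smul_one, one_def, Algebra.algebraMap_eq_smul_one, map_smul,
    LinearMap.smul_apply]

variable (k H B)

/-- The inclusion `H → H # B`, `h ↦ h ⊗ 1`, of algebras. -/
def incl : H →ₐ[k] SmashProduct k H B where
  toFun h := mk k H B h 1
  map_one' := rfl
  map_mul' h l := by
    rw [mk_mul_mk]
    have : ∀ t : H ⊗[k] H, twist k H B h 1 1 t =
        mk k H B (h * TensorProduct.rid k H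
          ((Coalgebra.counit (R := k) (A := H)).lTensor H t)) 1 := by
      intro t
      induction t with
      | zero => simp
      | tmul x y => simp [twist_tmul, one_act, Algebra.algebraMap_eq_smul_one]
      | add x y hx hy => simp only [map_add, hx, hy, LinearMap.add_apply, mul_add]
    rw [this]
    simp
  map_zero' := by simp
  map_add' h l := by simp
  commutes' r := (algebraMap_def r).symm

/-- The linear map `H # B → H ⊗ (H # B)`, `h ⊗ b ↦ ∑ h₍₁₎ ⊗ (h₍₂₎ ⊗ b)`. -/
def coactLin : SmashProduct k H B →ₗ[k] H ⊗[k] SmashProduct k H B :=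
  TensorProduct.lift
    (LinearMap.lcomp k (H ⊗[k] SmashProduct k H B) (Coalgebra.comul (R := k) (A := H)) ∘ₗ
      LinearMap.lTensorHom H ∘ₗ (mk k H B).flip).flip

variable {k H B}

theorem coactLin_mk (h : H) (b : B) :
    coactLin k H B (mk k H B h b) =
      ((mk k H B).flip b).lTensor H (Coalgebra.comul (R := k) h) := rfl

/-- Auxiliary: the map `x ⊗ (y ⊗ z) ↦ h x ⊗ (h' y ⊗ (b · z) c)`. -/
def coactAux (h h' : H) (b c : B) : H ⊗[k] (H ⊗[k] H) →ₗ[k] H ⊗[k] SmashProduct k H B :=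
  TensorProduct.map (LinearMap.mulLeft k h) (twist k H B h' b c)

theorem coactLin_twist (h : H) (b c : B) (t : H ⊗[k] H) :
    coactLin k H B (twist k H B h b c t) =
      ∑ i ∈ (Coalgebra.Repr.arbitrary k h).index,
        coactAux ((Coalgebra.Repr.arbitrary k h).left i)
          ((Coalgebra.Repr.arbitrary k h).right i) b c
          (TensorProduct.assoc k H H H ((Coalgebra.comul (R := k) (A := H)).rTensor H t)) := by
  induction t with
  | zero => simp
  | tmul x y =>
    rw [twist_tmul, coactLin_mk, Bialgebra.comul_mul, LinearMap.rTensor_tmul]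
    nth_rewrite 1 [← (Coalgebra.Repr.arbitrary k h).eq]
    rw [Finset.sum_mul, map_sum]
    refine Finset.sum_congr rfl fun i _ => ?_
    generalize Coalgebra.comul (R := k) x = s
    induction s with
    | zero => simp
    | tmul u v => rw [Algebra.TensorProduct.tmul_mul_tmul]; rfl
    | add u v hu hv => simp only [mul_add, map_add, hu, hv, TensorProduct.add_tmul]
  | add x y hx hy => simp only [map_add, hx, hy, Finset.sum_add_distrib]

theorem coactLin_mul_mk (h l : H) (b c : B) :
    coactLin k H B (mk k H B h b * mk k H B l c) =
      coactLin k H B (mk k H B h b) * coactLin k H B (mk k H B l c) := by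
  rw [mk_mul_mk, coactLin_twist, Coalgebra.coassoc_apply, coactLin_mk, coactLin_mk]
  nth_rewrite 1 [← (Coalgebra.Repr.arbitrary k h).eq]
  rw [map_sum, Finset.sum_mul]
  refine Finset.sum_congr rfl fun i _ => ?_
  generalize Coalgebra.comul (R := k) l = t
  induction t with
  | zero => simp
  | tmul u v =>
    rw [LinearMap.lTensor_tmul, LinearMap.lTensor_tmul, LinearMap.lTensor_tmul,
      Algebra.TensorProduct.tmul_mul_tmul]
    rfl
  | add u v hu hv => simp only [mul_add, map_add, hu, hv]

variable (k H B)

/-- The algebra homomorphism `Δ : H # B → H ⊗ (H # B)`, `Δ(h ⊗ b) = Δ(h) ⊗ b`. -/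
def coactHom : SmashProduct k H B →ₐ[k] H ⊗[k] SmashProduct k H B :=
  AlgHom.ofLinearMap (coactLin k H B)
    (by rw [one_def, coactLin_mk, Bialgebra.comul_one]; rfl)
    (by
      intro x y
      induction x using induction_mk with
      | h0 => simp
      | ha x x' hx hx' => simp only [add_mul, map_add, hx, hx']
      | hm h b =>
      induction y using induction_mk with
      | h0 => simp
      | ha y y' hy hy' => simp only [mul_add, map_add, hy, hy']
      | hm l c => exact coactLin_mul_mk h l b c)

/-- The smash product `H # B` is a left `H`-comodule algebra. -/
instance : LeftComoduleAlgebra k H (SmashProduct k H B) where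
  coact := coactHom k H B
  counit_coact a := by
    change TensorProduct.lid k _ ((Coalgebra.counit (R := k) (A := H)).rTensor _
      (coactLin k H B a)) = a
    induction a using induction_mk with
    | h0 => simp
    | ha x y hx hy => simp only [map_add, hx, hy]
    | hm h b =>
      have : ∀ t : H ⊗[k] H, TensorProduct.lid k (SmashProduct k H B)
          ((Coalgebra.counit (R := k) (A := H)).rTensor _ (((mk k H B).flip b).lTensor H t)) =
          mk k H B (TensorProduct.lid k H
            ((Coalgebra.counit (R := k) (A := H)).rTensor H t)) b := by
        intro t
        induction t with
        | zero => simp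
        | tmul x y => simp
        | add x y hx hy => simp only [map_add, hx, hy, LinearMap.add_apply]
      rw [coactLin_mk, this]
      simp
  coassoc_coact a := by
    change TensorProduct.assoc k H H _ ((Coalgebra.comul (R := k) (A := H)).rTensor _
      (coactLin k H B a)) = (coactLin k H B).lTensor H (coactLin k H B a)
    induction a using induction_mk with
    | h0 => simp
    | ha x y hx hy => simp only [map_add, hx, hy]
    | hm h b =>
      have h1 : ∀ t : H ⊗[k] H, TensorProduct.assoc k H H (SmashProduct k H B)
          ((Coalgebra.comul (R := k) (A := H)).rTensor _ (((mk k H B).flip b).lTensor H t)) =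
          (((mk k H B).flip b).lTensor H).lTensor H (TensorProduct.assoc k H H H
            ((Coalgebra.comul (R := k) (A := H)).rTensor H t)) := by
        intro t
        induction t with
        | zero => simp
        | tmul x y =>
          simp only [LinearMap.lTensor_tmul, LinearMap.rTensor_tmul]
          generalize Coalgebra.comul (R := k) x = s
          induction s with
          | zero => simp
          | tmul u v => rfl
          | add u v hu hv => simp only [map_add, hu, hv, TensorProduct.add_tmul]
        | add x y hx hy => simp only [map_add, hx, hy]
      have h2 : ∀ t : H ⊗[k] H, (coactLin k H B).lTensor H (((mk k H B).flip b).lTensor H t) =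
          (((mk k H B).flip b).lTensor H).lTensor H
            ((Coalgebra.comul (R := k) (A := H)).lTensor H t) := by
        intro t
        induction t with
        | zero => simp
        | tmul x y => rfl
        | add x y hx hy => simp only [map_add, hx, hy]
      rw [coactLin_mk, h1, h2, Coalgebra.coassoc_apply]

end SmashProduct

end Smash

/-! ### Tensor products of `H`-modules with `A`-modules -/

section Tensor

variable (k : Type u) {H A : Type u} [Field k] [Ring H] [HopfAlgebra k H] [Ring A] [Algebra k A]
  [LeftComoduleAlgebra k H A]

/-- The underlying `k`-vector space of the tensor product `V ⊗ M` over `k`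
of an `H`-module `V` and an `A`-module `M`. -/
def HTensor (V : ModuleCat.{u} H) (M : ModuleCat.{u} A) : Type u := V ⊗[k] M

namespace HTensor

variable (V : ModuleCat.{u} H) (M : ModuleCat.{u} A)

instance : AddCommGroup (HTensor k V M) := inferInstanceAs (AddCommGroup (V ⊗[k] M))

/-- The representation `A → H ⊗ A → End V ⊗ End M → End (V ⊗ M)`. -/
def rep : A →ₐ[k] Module.End k (V ⊗[k] M) :=
  (Module.endTensorEndAlgHom (R := k) (S := k) (A := k) (M := V) (N := M)).comp
    ((Algebra.TensorProduct.map (Algebra.lsmul k k V) (Algebra.lsmul k k M)).comp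
      (LeftComoduleAlgebra.coact (k := k) (H := H) (A := A)))

/-- `A` acts on `V ⊗ M` through its coaction: `a (v ⊗ m) = ∑ a₍₋₁₎ v ⊗ a₍₀₎ m`. -/
instance : Module A (HTensor k V M) :=
  Module.compHom (V ⊗[k] M) (rep k V M).toRingHom

theorem smul_def (a : A) (x : V ⊗[k] M) :
    (show V ⊗[k] M from a • (show HTensor k V M from x)) = rep k V M a x := rfl

end HTensor

/-- The tensor product `V ⊗ M` of an `H`-module and an `A`-module, as an `A`-module. -/
def tensorObj (V : ModuleCat.{u} H) (M : ModuleCat.{u} A) : ModuleCat.{u} A :=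
  ModuleCat.of A (HTensor k V M)

/-- The underlying `k`-linear map of a morphism of modules over a `k`-algebra. -/
abbrev klin {R : Type u} [Ring R] [Algebra k R] {M N : ModuleCat.{u} R} (f : M ⟶ N) :
    M →ₗ[k] N :=
  f.hom.restrictScalars k

theorem map_rep {V W : ModuleCat.{u} H} {M N : ModuleCat.{u} A} (f : V ⟶ W) (g : M ⟶ N)
    (a : A) (x : V ⊗[k] M) :
    TensorProduct.map (klin k f) (klin k g) (HTensor.rep k V M a x) =
      HTensor.rep k W N a (TensorProduct.map (klin k f) (klin k g) x) := by
  simp only [HTensor.rep, AlgHom.comp_apply]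
  generalize LeftComoduleAlgebra.coact (k := k) (H := H) a = t
  induction t with
  | zero => simp
  | add s t hs ht => simp only [map_add, LinearMap.add_apply, hs, ht]
  | tmul h b =>
    induction x with
    | zero => simp
    | add x y hx hy => simp only [map_add, hx, hy]
    | tmul v m =>
      simp only [Algebra.TensorProduct.map_tmul, Module.endTensorEndAlgHom_apply]
      simp

/-- The morphism `f ⊗ g : V ⊗ M → W ⊗ N`. -/
def tensorMap {V W : ModuleCat.{u} H} {M N : ModuleCat.{u} A} (f : V ⟶ W) (g : M ⟶ N) :
    tensorObj k V M ⟶ tensorObj k W N :=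
  ModuleCat.ofHom (X := HTensor k V M) (Y := HTensor k W N)
    { toFun := fun x => TensorProduct.map (klin k f) (klin k g) x
      map_add' := fun x y => map_add (TensorProduct.map (klin k f) (klin k g)) x y
      map_smul' := fun a x => map_rep k f g a x }

/-- Tensoring with an `H`-module `V`, as an endofunctor of the category of `A`-modules. -/
def tensorLeft (V : ModuleCat.{u} H) : ModuleCat.{u} A ⥤ ModuleCat.{u} A where
  obj M := tensorObj k V M
  map g := tensorMap k (𝟙 V) g
  map_id M := by
    ext x
    exact LinearMap.congr_fun (TensorProduct.map_id (R := k) (M := V) (N := M)) x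
  map_comp {M N P} f g := by
    ext x
    exact LinearMap.congr_fun
      (TensorProduct.map_comp (klin k (𝟙 V)) (klin k g) (klin k (𝟙 V)) (klin k f)) x

/-- `Λ` is a left integral of `H`: it is nonzero and `h Λ = ε(h) Λ` for all `h`. -/
def IsLeftIntegral (Λ : H) : Prop :=
  Λ ≠ 0 ∧ ∀ h : H, h * Λ = Coalgebra.counit (R := k) h • Λ

variable (H) in
/-- The regular left `H`-module. -/
def regular : ModuleCat.{u} H := ModuleCat.of H H

/-- The `H`-module `H / kΛ` (for a left integral, `kΛ = HΛ` is the submodule generated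
by `Λ`). -/
def regularQuot (Λ : H) : ModuleCat.{u} H := ModuleCat.of H (H ⧸ Submodule.span H {Λ})

/-- The projection `H → H / kΛ`. -/
def regularProj (Λ : H) : regular H ⟶ regularQuot Λ :=
  ModuleCat.ofHom (Submodule.mkQ (Submodule.span H {Λ}))

theorem regularProj_epi (Λ : H) : Epi (regularProj Λ) :=
  (ModuleCat.epi_iff_surjective
    (ModuleCat.ofHom (Submodule.mkQ (Submodule.span H {Λ})))).2 (Submodule.mkQ_surjective _)

/-- An element of `H`, seen in the regular module. -/
def toRegular (h : H) : regular H := (show H from h)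

variable (H) in
/-- The trivial one-dimensional `H`-module `k`, on which `H` acts through the counit. -/
def trivialModule : ModuleCat.{u} H :=
  (ModuleCat.restrictScalars (Bialgebra.counitAlgHom k H).toRingHom).obj (ModuleCat.of k k)

theorem rep_integral {Λ : H} (hΛ : IsLeftIntegral k Λ) (M : ModuleCat.{u} A) (a : A) (m : M) :
    HTensor.rep k (regular H) M a ((toRegular Λ) ⊗ₜ[k] m) = (toRegular Λ) ⊗ₜ[k] (a • m) := by
  have key : ∀ t : H ⊗[k] A,
      Module.endTensorEndAlgHom (R := k) (S := k) (A := k) (M := regular H) (N := M)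
        (Algebra.TensorProduct.map (Algebra.lsmul k k (regular H)) (Algebra.lsmul k k M) t)
        ((toRegular Λ) ⊗ₜ[k] m) =
      (toRegular Λ) ⊗ₜ[k]
        ((TensorProduct.lid k A ((Coalgebra.counit (R := k) (A := H)).rTensor A t)) • m) := by
    intro t
    induction t with
    | zero => simp
    | add s t hs ht =>
      simp only [map_add, LinearMap.add_apply, hs, ht, add_smul, TensorProduct.tmul_add]
    | tmul h b =>
      have h1 : h • toRegular Λ = Coalgebra.counit (R := k) h • toRegular Λ :=
        (hΛ.2 h).trans (Algebra.smul_def _ _)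
      simp only [Algebra.TensorProduct.map_tmul, Module.endTensorEndAlgHom_apply]
      simp [h1, TensorProduct.smul_tmul]
  have := key (LeftComoduleAlgebra.coact (k := k) (H := H) a)
  rw [LeftComoduleAlgebra.counit_coact] at this
  exact this

/-- The embedding `Λ ⊗ Id : M → H ⊗ M`, `m ↦ Λ ⊗ m`. -/
def integralEmb {Λ : H} (hΛ : IsLeftIntegral k Λ) (M : ModuleCat.{u} A) :
    M ⟶ tensorObj k (regular H) M :=
  ModuleCat.ofHom (Y := HTensor k (regular H) M)
    { toFun := fun m => (toRegular Λ) ⊗ₜ[k] m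
      map_add' := fun m n => TensorProduct.tmul_add _ m n
      map_smul' := fun a m => (rep_integral k hΛ M a m).symm }

end Tensor

/-! ### Classes of modules -/

section Classes

variable (k H : Type u) {A : Type u} [Field k] [Ring H] [HopfAlgebra k H] [Ring A] [Algebra k A]
  [LeftComoduleAlgebra k H A]

/-- A class of `A`-modules closed under subquotients, finite direct sums and tensoring
with `H`. -/
class IsAdmissible (C : ObjectProperty (ModuleCat.{u} A)) : Prop extends
    C.IsClosedUnderSubobjects, C.IsClosedUnderQuotients, C.IsClosedUnderFiniteProducts where
  tensor_regular : ∀ M : ModuleCat.{u} A, C M → C (tensorObj k (regular H) M)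

/-- The class of all `A`-modules is admissible. -/
instance : IsAdmissible k H (⊤ : ObjectProperty (ModuleCat.{u} A)) where
  prop_of_mono _ _ _ := trivial
  prop_of_epi _ _ _ := trivial
  isClosedUnderLimitsOfShape _ _ := ⟨fun _ _ => trivial⟩
  tensor_regular _ _ := trivial

variable {H}

/-- Tensoring with the `H`-module `V` preserves the class `C`. -/
def PreservesClass (V : ModuleCat.{u} H) (C : ObjectProperty (ModuleCat.{u} A)) : Prop :=
  ∀ M : ModuleCat.{u} A, C M → C (tensorObj k V M)

/-- The class of modules that are finite-dimensional over `k`. -/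
def finDim (R : Type u) [Ring R] [Algebra k R] : ObjectProperty (ModuleCat.{u} R) :=
  fun M => FiniteDimensional k M

/-- The identity `V ⊗ M → V ⊗ M` is `k`-linear for the two `k`-vector space structures on the
tensor product: the one of `⊗` and the one that comes from the `A`-module structure. -/
def toTensorObj (V : ModuleCat.{u} H) (M : ModuleCat.{u} A) :
    V ⊗[k] M →ₗ[k] (tensorObj k V M : ModuleCat.{u} A) where
  toFun x := x
  map_add' _ _ := rfl
  map_smul' c x := by
    change c • x = HTensor.rep k V M (algebraMap k A c) x
    rw [AlgHom.commutes]
    rfl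

theorem finDim_tensorObj {V : ModuleCat.{u} H} {M : ModuleCat.{u} A}
    (hV : finDim k H V) (hM : finDim k A M) : finDim k A (tensorObj k V M) := by
  have h1 : FiniteDimensional k V := hV
  have h2 : FiniteDimensional k M := hM
  exact Module.Finite.of_surjective (toTensorObj k V M) (fun x => ⟨x, rfl⟩)

variable (H) in
theorem finDim_regular [FiniteDimensional k H] : finDim k H (regular H) :=
  Module.Finite.of_surjective
    ({ toFun := fun h => toRegular h
       map_add' := fun _ _ => rfl
       map_smul' := fun c h => Algebra.smul_def c h } : H →ₗ[k] regular H) (fun h => ⟨h, rfl⟩)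

instance finDim_isAdmissible [FiniteDimensional k H] : IsAdmissible k H (finDim k A) where
  prop_of_mono {M N} f _ hN := by
    have : FiniteDimensional k N := hN
    exact Module.Finite.of_injective (klin k f) ((ModuleCat.mono_iff_injective f).1 inferInstance)
  prop_of_epi {M N} f _ hM := by
    have : FiniteDimensional k M := hM
    exact Module.Finite.of_surjective (klin k f) ((ModuleCat.epi_iff_surjective f).1 inferInstance)
  isClosedUnderLimitsOfShape J _ := ⟨by
    rintro X ⟨p⟩
    have h : ∀ j, FiniteDimensional k (p.diag.obj j) := p.prop_diag_obj
    have := Fintype.ofFinite J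
    refine Module.Finite.of_injective (M := X) (N := ∀ j, p.diag.obj j)
      (LinearMap.pi fun j => klin k (p.π.app j)) fun x y hxy => ?_
    exact Concrete.isLimit_ext p.diag p.isLimit x y fun j => congrFun hxy j⟩
  tensor_regular M hM := finDim_tensorObj k (finDim_regular k H) hM

/-- An admissible class is preserved by tensoring with finite-dimensional `H`-modules. -/
theorem preservesClass_of_finDim (C : ObjectProperty (ModuleCat.{u} A)) [IsAdmissible k H C]
    {V : ModuleCat.{u} H} (hV : finDim k H V) : PreservesClass k V C := by
  intro M hM
  have hV' : FiniteDimensional k V := hV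
  obtain ⟨n, s, hs⟩ := Module.Finite.exists_fin (R := k) (M := V)
  let q : ∀ _ : Fin n, tensorObj k (regular H) M ⟶ tensorObj k V M := fun i =>
    tensorMap k (ModuleCat.ofHom (X := H) (Y := V) (LinearMap.toSpanSingleton H V (s i))) (𝟙 M)
  have hq : ∀ i (m : M), q i (toTensorObj k (regular H) M (toRegular (1 : H) ⊗ₜ m)) =
      toTensorObj k V M (s i ⊗ₜ m) := fun i m =>
    congrArg (fun v : V => toTensorObj k V M (v ⊗ₜ[k] m)) (one_smul H (s i))
  have hC : C (⨁ fun _ : Fin n => tensorObj k (regular H) M) :=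
    C.prop_of_iso (biproduct.isoProduct _).symm
      (C.prop_product fun _ => IsAdmissible.tensor_regular M hM)
  have : Epi (biproduct.desc q) := ⟨fun {Z} g g' h => by
    have h1 : ∀ i, q i ≫ g = q i ≫ g' := fun i => by
      have := congrArg (fun z => biproduct.ι _ i ≫ z) h
      simpa using this
    have h2 : klin k g ∘ₗ toTensorObj k V M = klin k g' ∘ₗ toTensorObj k V M := by
      refine TensorProduct.ext ?_
      refine LinearMap.ext_on_range hs fun i => LinearMap.ext fun m => ?_
      have := congrArg (fun z => z (toTensorObj k (regular H) M (toRegular (1 : H) ⊗ₜ m))) (h1 i)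
      simp only [ModuleCat.comp_apply, hq] at this
      exact this
    ext x
    exact LinearMap.congr_fun h2 x⟩
  exact C.prop_of_epi (biproduct.desc q) hC

/-- Tensoring with `V` as an endofunctor of the full subcategory of modules in `C`. -/
def tensorOn (C : ObjectProperty (ModuleCat.{u} A)) {V : ModuleCat.{u} H}
    (hV : PreservesClass k V C) : C.FullSubcategory ⥤ C.FullSubcategory :=
  C.lift (C.ι ⋙ tensorLeft k V) (fun M => hV M.obj M.property)

theorem finDim_regularQuot [FiniteDimensional k H] (Λ : H) : finDim k H (regularQuot Λ) := by
  have : FiniteDimensional k (regular H) := finDim_regular k H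
  exact Module.Finite.of_surjective (klin k (regularProj Λ))
    ((ModuleCat.epi_iff_surjective (regularProj Λ)).1 (regularProj_epi Λ))

variable (H) in
theorem finDim_trivialModule : finDim k H (trivialModule k H) :=
  Module.Finite.of_surjective
    ({ toFun := fun c => (show k from c)
       map_add' := fun _ _ => rfl
       map_smul' := fun c x => by
        change c * x = Coalgebra.counit (R := k) (algebraMap k H c) * x
        rw [Bialgebra.counit_algebraMap] } : k →ₗ[k] trivialModule k H) (fun c => ⟨c, rfl⟩)

/-- The shift functor `T M = (H / kΛ) ⊗ M`. -/
abbrev shiftT [FiniteDimensional k H] (C : ObjectProperty (ModuleCat.{u} A)) [IsAdmissible k H C]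
    (Λ : H) : C.FullSubcategory ⥤ C.FullSubcategory :=
  tensorOn k C (preservesClass_of_finDim k C (finDim_regularQuot k Λ))

/-- `X --u--> Y --v--> Z --w--> T X` is a standard triangle: `Z` is the cone of `u`, i.e. the
pushout of `u` along `Λ ⊗ Id : X → H ⊗ X`, and `w` is the map out of the pushout that vanishes
on `Y` and is the projection `H ⊗ X → (H / kΛ) ⊗ X = T X` on `H ⊗ X`. -/
def IsStandardTriangle [FiniteDimensional k H] (C : ObjectProperty (ModuleCat.{u} A))
    [IsAdmissible k H C] {Λ : H} (hΛ : IsLeftIntegral k Λ) {X Y Z : C.FullSubcategory}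
    (f : X ⟶ Y) (v : Y ⟶ Z) (w : Z ⟶ (shiftT k C Λ).obj X) : Prop :=
  ∃ f' : tensorObj k (regular H) X.obj ⟶ Z.obj,
    IsPushout f.hom (integralEmb k hΛ X.obj) v.hom f' ∧
    v.hom ≫ w.hom = 0 ∧ f' ≫ w.hom = tensorMap k (regularProj Λ) (𝟙 X.obj)

/-- Given a functor `Q` from the modules in `C` to a category `E`, this expresses that a
pretriangulated structure on `E` makes it a triangulated category (octahedral axiom included),
that its shift functor is induced by `T`, and that its distinguished triangles are exactly the
triangles isomorphic to images of standard triangles. -/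
def IsStandardTriangulation [FiniteDimensional k H] (C : ObjectProperty (ModuleCat.{u} A))
    [IsAdmissible k H C] {Λ : H} (hΛ : IsLeftIntegral k Λ)
    {E : Type*} [Category* E] (Q : C.FullSubcategory ⥤ E)
    [Preadditive E] [HasZeroObject E] [HasShift E ℤ]
    [∀ n : ℤ, (shiftFunctor E n).Additive] [Pretriangulated E] : Prop :=
  IsTriangulated E ∧ Q.Additive ∧
    ∃ e : shiftT k C Λ ⋙ Q ≅ Q ⋙ shiftFunctor E (1 : ℤ),
      ∀ t : Triangle E, t ∈ distTriang E ↔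
        ∃ (X Y Z : C.FullSubcategory) (f : X ⟶ Y) (v : Y ⟶ Z) (w : Z ⟶ (shiftT k C Λ).obj X),
          IsStandardTriangle k C hΛ f v w ∧
          Nonempty (t ≅ Triangle.mk (Q.map f) (Q.map v) (Q.map w ≫ e.hom.app X))

end Classes

/-! ### Stable, homotopy and derived categories -/

section Categories

/-- Morphisms of `R`-modules in the class `P` are identified when their difference factors
through an injective module in `P`. -/
def stableRel {R : Type u} [Ring R] (P : ObjectProperty (ModuleCat.{u} R)) :
    HomRel P.FullSubcategory :=
  fun X Y f g => ∃ I : ModuleCat.{u} R, P I ∧ Injective I ∧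
    ∃ (i : X.obj ⟶ I) (p : I ⟶ Y.obj), f.hom - g.hom = i ≫ p

/-- The stable category of the `R`-modules in the class `P`. -/
abbrev StableCat {R : Type u} [Ring R] (P : ObjectProperty (ModuleCat.{u} R)) :=
  CategoryTheory.Quotient (stableRel P)

/-- The quotient functor from modules to the stable category. -/
abbrev toStable {R : Type u} [Ring R] (P : ObjectProperty (ModuleCat.{u} R)) :
    P.FullSubcategory ⥤ StableCat P :=
  CategoryTheory.Quotient.functor (stableRel P)

/-- Morphisms of `A`-modules in the class `C` are homotopic when their difference factors
through `H ⊗ N` for some `N` in `C`. -/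
def homotopyRel (k H : Type u) {A : Type u} [Field k] [Ring H] [HopfAlgebra k H] [Ring A]
    [Algebra k A] [LeftComoduleAlgebra k H A] (C : ObjectProperty (ModuleCat.{u} A)) :
    HomRel C.FullSubcategory :=
  fun X Y f g => ∃ N : ModuleCat.{u} A, C N ∧
    ∃ (i : X.obj ⟶ tensorObj k (regular H) N) (p : tensorObj k (regular H) N ⟶ Y.obj),
      f.hom - g.hom = i ≫ p

/-- The category of `A`-modules in the class `C` modulo null-homotopic morphisms. -/
abbrev HomotopyCat (k H : Type u) {A : Type u} [Field k] [Ring H] [HopfAlgebra k H] [Ring A]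
    [Algebra k A] [LeftComoduleAlgebra k H A] (C : ObjectProperty (ModuleCat.{u} A)) :=
  CategoryTheory.Quotient (homotopyRel k H C)

variable (k H B : Type u) [Field k] [Ring H] [HopfAlgebra k H] [Ring B] [Algebra k B]
  [RightModuleAlgebra k H B]

/-- Restriction of `H # B`-modules to `H`-modules. -/
def restrict (C : ObjectProperty (ModuleCat.{u} (SmashProduct k H B))) :
    C.FullSubcategory ⥤ (⊤ : ObjectProperty (ModuleCat.{u} H)).FullSubcategory :=
  ObjectProperty.lift ⊤ (C.ι ⋙ ModuleCat.restrictScalars (SmashProduct.incl k H B).toRingHom)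
    (fun _ => trivial)

/-- A morphism of the homotopy category of `H # B`-modules is a quasi-isomorphism when it
restricts to an isomorphism in the stable category of `H`-modules. -/
def quasiIso (C : ObjectProperty (ModuleCat.{u} (SmashProduct k H B))) :
    MorphismProperty (HomotopyCat k H C) :=
  fun X Y f => ∃ g : X.as ⟶ Y.as,
    (CategoryTheory.Quotient.functor (homotopyRel k H C)).map g = f ∧
      IsIso ((toStable ⊤).map ((restrict k H B C).map g))

/-- The derived category `D(B, H)` of the modules in the class `C`. -/
abbrev DerivedCat (C : ObjectProperty (ModuleCat.{u} (SmashProduct k H B))) :=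
  (quasiIso k H B C).Localization

/-- The functor from `H # B`-modules in the class `C` to the derived category. -/
abbrev toDerived (C : ObjectProperty (ModuleCat.{u} (SmashProduct k H B))) :
    C.FullSubcategory ⥤ DerivedCat k H B C :=
  CategoryTheory.Quotient.functor (homotopyRel k H C) ⋙ (quasiIso k H B C).Q

end Categories

/-! ### Grothendieck groups -/

section Grothendieck

universe v w

variable (E : Type w) [Category.{v} E] [Preadditive E] [HasZeroObject E] [HasShift E ℤ]
  [∀ n : ℤ, (shiftFunctor E n).Additive] [Pretriangulated E]

/-- The relations `[Y] = [X] + [Z]` for the distinguished triangles `X → Y → Z → X[1]`. -/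
def triangleRelations : AddSubgroup (FreeAbelianGroup E) :=
  AddSubgroup.closure {z | ∃ t : Triangle E, t ∈ distTriang E ∧
    z = FreeAbelianGroup.of t.obj₂ -
      (FreeAbelianGroup.of t.obj₁ + FreeAbelianGroup.of t.obj₃)}

/-- The Grothendieck group of a triangulated category. -/
def GrothendieckGroup : Type w := FreeAbelianGroup E ⧸ triangleRelations E

instance instAddCommGroupGrothendieckGroup : AddCommGroup (GrothendieckGroup E) :=
  inferInstanceAs (AddCommGroup (FreeAbelianGroup E ⧸ triangleRelations E))

variable {E} in
/-- The class of an object in the Grothendieck group. -/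
def cls (X : E) : GrothendieckGroup E :=
  QuotientAddGroup.mk (s := triangleRelations E) (FreeAbelianGroup.of X)

end Grothendieck

end Hopfological
end

open Hopfological

/-!
An integral `Λ` gives a natural embedding `X → H ⊗ X`, `x ↦ Λ ⊗ x`, which splits as soon as `X` is
of the form `H ⊗ N`. So the modules `H ⊗ N` behave like injective objects for these embeddings, the
morphisms that factor through them are exactly those that extend along `X → H ⊗ X`, and Happel's
construction of the stable category of a Frobenius category applies. The shift `T` is essentially
surjective because `M` is the cokernel of `ker ε ⊗ M → H ⊗ M`, a map through which the embedding of
`ker ε ⊗ M` factors, so that `M` is stably isomorphic to `T (ker ε ⊗ M)`.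

A functor that is right exact and compatible with the embeddings up to null morphisms induces an
exact functor of stable categories. This covers `V ⊗ -`, `- ⊗ M` and the restriction to `H`. The
quasi-isomorphisms are the morphisms inverted by the restriction, so they form a calculus of
fractions compatible with the triangulation, and everything descends to `D(B, H)`. Since both
`V ⊗ -` and `- ⊗ M` are exact, `[V][M] = [V ⊗ M]` is biadditive on Grothendieck groups.
-/

noncomputable section

namespace Hopfological

universe v₁ u₁ v₂ u₂
/-! ### Integer shifts generated by an autoequivalence -/

/-- Sequences of objects indexed by `ℤ` with isomorphisms `T (X n) ≅ X (n + 1)`. They carry a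
strict shift by reindexing, which is transported to `E` when `T` is an equivalence. The target
index of `iso` is a variable so that reindexing does not introduce transports. -/
structure ShiftSpectrum {E : Type u₁} [Category.{v₁} E] (T : E ⥤ E) where
  obj : ℤ → E
  iso : ∀ n m : ℤ, n + 1 = m → (T.obj (obj n) ≅ obj m)

namespace ShiftSpectrum

variable {E : Type u₁} [Category.{v₁} E] {T : E ⥤ E}

/-- Families of morphisms compatible with the structure isomorphisms. -/
@[ext]
structure Hom (X Y : ShiftSpectrum T) where
  app : ∀ n, X.obj n ⟶ Y.obj n
  comm : ∀ n m h, T.map (app n) ≫ (Y.iso n m h).hom = (X.iso n m h).hom ≫ app m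

instance : Category (ShiftSpectrum T) where
  Hom := Hom
  id X := { app := fun _ => 𝟙 _, comm := by simp }
  comp f g :=
    { app := fun n => f.app n ≫ g.app n
      comm := fun n m h => by
        rw [T.map_comp, Category.assoc, g.comm, reassoc_of% f.comm n m h] }

@[simp]
theorem comp_app {X Y Z : ShiftSpectrum T} (f : X ⟶ Y) (g : Y ⟶ Z) (n : ℤ) :
    (f ≫ g).app n = f.app n ≫ g.app n := rfl

@[ext]
theorem hom_ext {X Y : ShiftSpectrum T} {f g : X ⟶ Y} (h : ∀ n, f.app n = g.app n) : f = g :=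
  Hom.ext (funext h)

@[simps]
def isoMk {X Y : ShiftSpectrum T} (e : ∀ n, X.obj n ≅ Y.obj n)
    (comm : ∀ n m h, T.map (e n).hom ≫ (Y.iso n m h).hom = (X.iso n m h).hom ≫ (e m).hom) :
    X ≅ Y where
  hom := { app := fun n => (e n).hom, comm := comm }
  inv :=
    { app := fun n => (e n).inv
      comm := fun n m h => by
        rw [← cancel_mono (e m).hom, Category.assoc, Category.assoc, ← comm, ← T.map_comp_assoc,
          Iso.inv_hom_id, T.map_id, Category.id_comp, Iso.inv_hom_id, Category.comp_id] }
  hom_inv_id := by ext n; exact (e n).hom_inv_id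
  inv_hom_id := by ext n; exact (e n).inv_hom_id

theorem map_eqToHom_comp_iso_hom (X : ShiftSpectrum T) {n n' m m' : ℤ} (hn : n = n')
    (hm : m = m') (h : n + 1 = m) (h' : n' + 1 = m') :
    T.map (eqToHom (congrArg X.obj hn)) ≫ (X.iso n' m' h').hom =
      (X.iso n m h).hom ≫ eqToHom (congrArg X.obj hm) := by
  subst hn hm; simp

theorem app_comp_eqToHom {X Y : ShiftSpectrum T} (f : X ⟶ Y) {n n' : ℤ} (hn : n = n') :
    f.app n ≫ eqToHom (congrArg Y.obj hn) = eqToHom (congrArg X.obj hn) ≫ f.app n' := by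
  subst hn; simp

theorem eqToHom_app {X Y : ShiftSpectrum T} (h : X = Y) (n : ℤ) :
    (eqToHom h).app n = eqToHom (by rw [h]) := by
  subst h; rfl

section Shift

variable (T)

/-- Reindexing of sequences by `n ↦ n + a`. -/
@[simps]
def reindex (a : ℤ) : ShiftSpectrum T ⥤ ShiftSpectrum T where
  obj X := { obj := fun n => X.obj (n + a), iso := fun n m h => X.iso (n + a) (m + a) (by omega) }
  map f := { app := fun n => f.app (n + a), comm := fun _ _ _ => f.comm _ _ _ }

@[simps!]
def reindexZero : reindex T 0 ≅ 𝟭 _ :=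
  NatIso.ofComponents
    (fun X => isoMk (fun n => eqToIso (congrArg X.obj (add_zero n)))
      (fun n m h => X.map_eqToHom_comp_iso_hom (add_zero n) (add_zero m) _ h))
    (fun f => by ext n; exact app_comp_eqToHom f (add_zero n))

@[simps!]
def reindexAdd (a b : ℤ) : reindex T (a + b) ≅ reindex T a ⋙ reindex T b :=
  NatIso.ofComponents
    (fun X => isoMk (fun n => eqToIso (congrArg X.obj (show n + (a + b) = n + b + a by omega)))
      (fun n m h => X.map_eqToHom_comp_iso_hom (by omega) (by omega) _ _))
    (fun f => by ext n; exact app_comp_eqToHom f (show n + (a + b) = n + b + a by omega))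

instance : HasShift (ShiftSpectrum T) ℤ :=
  hasShiftMk _ _
    { F := reindex T
      zero := reindexZero T
      add := reindexAdd T
      assoc_hom_app := fun a b c X => by
        ext n
        simp only [comp_app, eqToHom_app, reindexAdd_hom_app_app, reindex_map_app]
        exact (eqToHom_trans _ _).trans
          ((eqToHom_trans_assoc _ _ _).trans (eqToHom_trans _ _)).symm
      zero_add_hom_app := fun a X => by
        ext n
        simp only [comp_app, eqToHom_app, reindexAdd_hom_app_app, reindex_map_app,
          reindexZero_inv_app_app]
        exact (eqToHom_trans _ _).symm
      add_zero_hom_app := fun a X => by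
        ext n
        simp only [comp_app, eqToHom_app, reindexAdd_hom_app_app, reindexZero_inv_app_app]
        exact (eqToHom_trans _ _).symm }

end Shift

variable (T) in
/-- The term of index zero. -/
@[simps]
def evalZero : ShiftSpectrum T ⥤ E where
  obj X := X.obj 0
  map f := f.app 0

instance [T.Faithful] : (evalZero T).Faithful where
  map_injective {X Y f g} h := by
    ext n
    induction n using Int.induction_on with
    | zero => exact h
    | succ n ih =>
      rw [← cancel_epi (X.iso n (n + 1) rfl).hom, ← f.comm, ← g.comm, ih]
    | pred n ih =>
      apply T.map_injective
      rw [← cancel_mono (Y.iso (-n - 1) (-n) (by omega)).hom, f.comm, g.comm, ih]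

section Full

variable [T.Full] (X Y : ShiftSpectrum T) (f : X.obj 0 ⟶ Y.obj 0)

/-- The components of the extension of a morphism between terms of index zero. -/
def extendApp (n : ℤ) : X.obj n ⟶ Y.obj n :=
  Int.inductionOn' (motive := fun n => X.obj n ⟶ Y.obj n) n 0 f
    (fun n _ g => (X.iso n (n + 1) rfl).inv ≫ T.map g ≫ (Y.iso n (n + 1) rfl).hom)
    (fun n _ g => T.preimage ((X.iso (n - 1) n (by omega)).hom ≫ g ≫
      (Y.iso (n - 1) n (by omega)).inv))

theorem extendApp_zero : extendApp X Y f 0 = f := by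
  unfold extendApp
  exact Int.inductionOn'_self ..

theorem extendApp_comm (n m : ℤ) (h : n + 1 = m) :
    T.map (extendApp X Y f n) ≫ (Y.iso n m h).hom = (X.iso n m h).hom ≫ extendApp X Y f m := by
  rcases le_or_gt 0 n with hn | hn
  · subst h
    rw [extendApp, extendApp, Int.inductionOn'_add_one hn, Iso.hom_inv_id_assoc]
  · obtain rfl : n = m - 1 := by omega
    rw [extendApp, extendApp, Int.inductionOn'_sub_one (by omega), T.map_preimage, Category.assoc,
      Category.assoc, Iso.inv_hom_id, Category.comp_id]

instance : (evalZero T).Full where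
  map_surjective {X Y} f :=
    ⟨{ app := extendApp X Y f, comm := extendApp_comm X Y f }, extendApp_zero X Y f⟩

end Full

section EssSurj

variable [T.IsEquivalence] (X : E)

variable (T) in
/-- The iterates of an object under `T` and a quasi-inverse. -/
def iterate (n : ℤ) : E :=
  Int.inductionOn' (motive := fun _ => E) n 0 X (fun _ _ Y => T.obj Y) (fun _ _ Y => T.inv.obj Y)

theorem iterate_add_one {n : ℤ} (hn : 0 ≤ n) : iterate T X (n + 1) = T.obj (iterate T X n) :=
  Int.inductionOn'_add_one hn

theorem iterate_sub_one {n : ℤ} (hn : n ≤ 0) : iterate T X (n - 1) = T.inv.obj (iterate T X n) :=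
  Int.inductionOn'_sub_one hn

variable (T) in
/-- The sequence of iterates of an object. -/
@[simps obj]
def iterates : ShiftSpectrum T where
  obj := iterate T X
  iso n m h :=
    if hn : 0 ≤ n then eqToIso (by rw [← h, iterate_add_one X hn])
    else T.mapIso (eqToIso (by
        rw [show n = m - 1 by omega, iterate_sub_one X (by omega)]; rfl)) ≪≫
      T.asEquivalence.counitIso.app (iterate T X m)

instance : (evalZero T).EssSurj where
  mem_essImage X := ⟨iterates T X, ⟨eqToIso (by
    rw [evalZero_obj, iterates_obj, iterate, Int.inductionOn'_self])⟩⟩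

instance : (evalZero T).IsEquivalence where

end EssSurj

variable (T) in
/-- On terms of index zero, reindexing by `1` is `T`. -/
def reindexOneIso : reindex T (1 : ℤ) ⋙ evalZero T ≅ evalZero T ⋙ T :=
  NatIso.ofComponents (fun X => (X.iso 0 (0 + 1) rfl).symm) (fun {X Y} f => by
    change f.app (0 + 1) ≫ (Y.iso 0 (0 + 1) rfl).inv =
      (X.iso 0 (0 + 1) rfl).inv ≫ T.map (f.app 0)
    rw [Iso.comp_inv_eq, Category.assoc, f.comm, Iso.inv_hom_id_assoc])

end ShiftSpectrum

open ShiftSpectrum in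
theorem exists_hasShift_iso_shiftFunctor_one {E : Type u₁} [Category.{v₁} E] (T : E ⥤ E)
    [T.IsEquivalence] : ∃ _ : HasShift E ℤ, Nonempty (T ≅ shiftFunctor E (1 : ℤ)) := by
  have : (evalZero T).IsLocalization (MorphismProperty.isomorphisms _) :=
    .of_isEquivalence _ _ (fun _ _ _ h => h)
  have := Localization.full_whiskeringLeft (evalZero T) (MorphismProperty.isomorphisms _) E
  have := Localization.faithful_whiskeringLeft (evalZero T) (MorphismProperty.isomorphisms _) E
  let transported (a : ℤ) : E ⥤ E := (evalZero T).inv ⋙ reindex T a ⋙ evalZero T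
  exact ⟨HasShift.induced (evalZero T) ℤ transported
      (fun a => Functor.isoWhiskerRight (evalZero T).asEquivalence.unitIso.symm
        (reindex T a ⋙ evalZero T)),
    ⟨(Functor.isoWhiskerLeft (evalZero T).inv (reindexOneIso T) ≪≫
      Functor.isoWhiskerRight (evalZero T).asEquivalence.counitIso T).symm⟩⟩

section CommShift

open Functor.CommShift

variable {C : Type u₁} [Category.{v₁} C] {D : Type u₂} [Category.{v₂} D]
  [HasShift C ℤ] [HasShift D ℤ] {F : C ⥤ D}
  (e : shiftFunctor C (1 : ℤ) ⋙ F ≅ F ⋙ shiftFunctor D (1 : ℤ))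

/-- Commutation with the shift by `n`, cancelled from commutation with the shift by `n + 1`. -/
def isoSubOne {n m : ℤ} (h : n + 1 = m) (i : shiftFunctor C m ⋙ F ≅ F ⋙ shiftFunctor D m) :
    shiftFunctor C n ⋙ F ≅ F ⋙ shiftFunctor D n :=
  let shifted : shiftFunctor C n ⋙ F ⋙ shiftFunctor D (1 : ℤ) ≅
      F ⋙ shiftFunctor D n ⋙ shiftFunctor D (1 : ℤ) :=
    Functor.isoWhiskerLeft _ e.symm ≪≫
      Functor.isoWhiskerRight (shiftFunctorAdd' C n 1 m h).symm F ≪≫ i ≪≫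
        Functor.isoWhiskerLeft F (shiftFunctorAdd' D n 1 m h)
  NatIso.ofComponents (fun X => (shiftFunctor D (1 : ℤ)).preimageIso (shifted.app X))
    (fun {X Y} f => (shiftFunctor D (1 : ℤ)).map_injective (by
      simpa using shifted.hom.naturality f))

theorem map_isoSubOne_hom_app {n m : ℤ} (h : n + 1 = m)
    (i : shiftFunctor C m ⋙ F ≅ F ⋙ shiftFunctor D m) (X : C) :
    (shiftFunctor D (1 : ℤ)).map ((isoSubOne e h i).hom.app X) =
      e.inv.app _ ≫ F.map ((shiftFunctorAdd' C n 1 m h).inv.app X) ≫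
        i.hom.app X ≫ (shiftFunctorAdd' D n 1 m h).hom.app (F.obj X) :=
  Functor.map_preimage _ _

theorem isoAdd'_isoSubOne {n m : ℤ} (h : n + 1 = m)
    (i : shiftFunctor C m ⋙ F ≅ F ⋙ shiftFunctor D m) : isoAdd' h (isoSubOne e h i) e = i := by
  ext X
  rw [isoAdd'_hom_app, map_isoSubOne_hom_app]
  simp only [Category.assoc, Iso.hom_inv_id_app, Functor.comp_obj]
  rw [Iso.hom_inv_id_app_assoc, ← F.map_comp_assoc, Iso.hom_inv_id_app, F.map_id]
  exact (Category.id_comp _).trans (Category.comp_id _)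

theorem isoAdd'_one_injective {n m : ℤ} (h : n + 1 = m)
    {e₁ e₂ : shiftFunctor C n ⋙ F ≅ F ⋙ shiftFunctor D n}
    (he : isoAdd' h e₁ e = isoAdd' h e₂ e) : e₁ = e₂ := by
  ext X
  apply (shiftFunctor D (1 : ℤ)).map_injective
  have := congrArg (fun z => z.hom.app X) he
  simpa only [isoAdd'_hom_app, cancel_epi, cancel_mono] using this

/-- Commutation with the shift by `n`, obtained by iterating or cancelling `e`. -/
def commShiftIsoOfOne (n : ℤ) : shiftFunctor C n ⋙ F ≅ F ⋙ shiftFunctor D n :=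
  Int.inductionOn' (motive := fun n => shiftFunctor C n ⋙ F ≅ F ⋙ shiftFunctor D n) n 0
    (isoZero F ℤ) (fun _ _ i => isoAdd' rfl i e) (fun _ _ i => isoSubOne e (by omega) i)

theorem commShiftIsoOfOne_zero : commShiftIsoOfOne e 0 = isoZero F ℤ :=
  Int.inductionOn'_self ..

theorem commShiftIsoOfOne_add_one {n m : ℤ} (h : n + 1 = m) :
    commShiftIsoOfOne e m = isoAdd' h (commShiftIsoOfOne e n) e := by
  rcases le_or_gt 0 n with hn | hn
  · subst h
    exact Int.inductionOn'_add_one hn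
  · obtain rfl : n = m - 1 := by omega
    rw [commShiftIsoOfOne, commShiftIsoOfOne, Int.inductionOn'_sub_one (by omega),
      isoAdd'_isoSubOne]

theorem commShiftIsoOfOne_one : commShiftIsoOfOne e 1 = e := by
  rw [commShiftIsoOfOne_add_one e (zero_add 1), commShiftIsoOfOne_zero, isoZero_isoAdd'_]

theorem commShiftIsoOfOne_add (a b : ℤ) {ab : ℤ} (h : a + b = ab) :
    commShiftIsoOfOne e ab = isoAdd' h (commShiftIsoOfOne e a) (commShiftIsoOfOne e b) := by
  induction b using Int.induction_on generalizing ab with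
  | zero =>
    obtain rfl : a = ab := by omega
    rw [commShiftIsoOfOne_zero, isoAdd'_isoZero]
  | succ b ih =>
    rw [commShiftIsoOfOne_add_one e (show a + b + 1 = ab by omega), ih rfl,
      commShiftIsoOfOne_add_one e (rfl : (b : ℤ) + 1 = b + 1),
      isoAdd'_assoc _ _ e rfl rfl (by omega)]
  | pred b ih =>
    refine isoAdd'_one_injective (m := a + -b) e (by omega) ?_
    rw [← commShiftIsoOfOne_add_one, ih rfl,
      isoAdd'_assoc _ _ e h (show -(b : ℤ) - 1 + 1 = -b by omega) (by omega),
      ← commShiftIsoOfOne_add_one]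

/-- A functor that commutes with the shift by `1` commutes with all shifts by integers. -/
@[reducible]
def commShiftOfOne : F.CommShift ℤ where
  commShiftIso := commShiftIsoOfOne e
  commShiftIso_zero := commShiftIsoOfOne_zero e
  commShiftIso_add a b := commShiftIsoOfOne_add e a b rfl

end CommShift

/-! ### Pretriangulated structures from one-sided rotation -/

section OneSided

variable {E : Type u₁} [Category.{v₁} E] [HasShift E ℤ]

def triangleMkIso {X Y Z X' Y' Z' : E} {f : X ⟶ Y} {g : Y ⟶ Z} {h : Z ⟶ X⟦(1 : ℤ)⟧}
    {f' : X' ⟶ Y'} {g' : Y' ⟶ Z'} {h' : Z' ⟶ X'⟦(1 : ℤ)⟧} (e₁ : X ≅ X') (e₂ : Y ≅ Y')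
    (e₃ : Z ≅ Z') (comm₁ : f ≫ e₂.hom = e₁.hom ≫ f') (comm₂ : g ≫ e₃.hom = e₂.hom ≫ g')
    (comm₃ : h ≫ e₁.hom⟦(1 : ℤ)⟧' = e₃.hom ≫ h') :
    Triangle.mk f g h ≅ Triangle.mk f' g' h' :=
  Triangle.isoMk _ _ e₁ e₂ e₃ comm₁ comm₂ comm₃

theorem exists_isos_of_triangle_mk_iso {X Y Z X' Y' Z' : E} {f : X ⟶ Y} {g : Y ⟶ Z}
    {h : Z ⟶ X⟦(1 : ℤ)⟧} {f' : X' ⟶ Y'} {g' : Y' ⟶ Z'} {h' : Z' ⟶ X'⟦(1 : ℤ)⟧}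
    (j : Triangle.mk f g h ≅ Triangle.mk f' g' h') :
    ∃ (e₁ : X ≅ X') (e₂ : Y ≅ Y') (e₃ : Z ≅ Z'), f ≫ e₂.hom = e₁.hom ≫ f' ∧
      g ≫ e₃.hom = e₂.hom ≫ g' ∧ h ≫ e₁.hom⟦(1 : ℤ)⟧' = e₃.hom ≫ h' :=
  ⟨Triangle.π₁.mapIso j, Triangle.π₂.mapIso j, Triangle.π₃.mapIso j, j.hom.comm₁, j.hom.comm₂,
    j.hom.comm₃⟩

variable [Preadditive E] [HasZeroObject E]

open ZeroObject

variable (E) in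
/-- The axioms of a pretriangulated category, where triangles are only required to stay
distinguished after rotation in one direction. -/
structure PretriangulatedCore where
  dist : Set (Triangle E)
  iso_mem : ∀ T₁ ∈ dist, ∀ T₂, (T₂ ≅ T₁) → T₂ ∈ dist
  contractible_mem : ∀ X : E, contractibleTriangle X ∈ dist
  exists_mem : ∀ {X Y : E} (f : X ⟶ Y),
    ∃ (Z : E) (g : Y ⟶ Z) (h : Z ⟶ X⟦(1 : ℤ)⟧), Triangle.mk f g h ∈ dist
  rotate_mem : ∀ {X Y Z : E} {f : X ⟶ Y} {g : Y ⟶ Z} {h : Z ⟶ X⟦(1 : ℤ)⟧},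
    Triangle.mk f g h ∈ dist → Triangle.mk g h (-f⟦(1 : ℤ)⟧') ∈ dist
  complete : ∀ {X Y Z X' Y' Z' : E} {f : X ⟶ Y} {g : Y ⟶ Z} {h : Z ⟶ X⟦(1 : ℤ)⟧}
      {f' : X' ⟶ Y'} {g' : Y' ⟶ Z'} {h' : Z' ⟶ X'⟦(1 : ℤ)⟧},
      Triangle.mk f g h ∈ dist → Triangle.mk f' g' h' ∈ dist →
      ∀ (a : X ⟶ X') (b : Y ⟶ Y'), f ≫ b = a ≫ f' →
      ∃ c : Z ⟶ Z', g ≫ c = b ≫ g' ∧ h ≫ a⟦(1 : ℤ)⟧' = c ≫ h'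

namespace PretriangulatedCore

variable (D : PretriangulatedCore E) {X Y Z Z' : E} {f : X ⟶ Y} {g : Y ⟶ Z}
  {h : Z ⟶ X⟦(1 : ℤ)⟧} {g' : Y ⟶ Z'} {h' : Z' ⟶ X⟦(1 : ℤ)⟧}
include D

theorem exists_lift (hT : Triangle.mk f g h ∈ D.dist) {A : E} (a : A ⟶ Y) (ha : a ≫ g = 0) :
    ∃ l : A ⟶ X, l ≫ f = a := by
  obtain ⟨c, -, hc⟩ := D.complete (D.rotate_mem (D.contractible_mem A))
    (D.rotate_mem hT) a 0 (by rw [ha, zero_comp])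
  obtain ⟨l, rfl⟩ := (shiftFunctor E (1 : ℤ)).map_surjective c
  refine ⟨l, (shiftFunctor E (1 : ℤ)).map_injective ?_⟩
  simpa using hc.symm

theorem isIso_of_endomorphism (hT : Triangle.mk f g h ∈ D.dist) (x : Z ⟶ Z) (hg : g ≫ x = g)
    (hh : x ≫ h = h) : IsIso x := by
  obtain ⟨l, hl⟩ := D.exists_lift (D.rotate_mem hT) (x - 𝟙 Z) (by
    rw [Preadditive.sub_comp, hh, Category.id_comp, sub_self])
  have sq_zero : (x - 𝟙 Z) ≫ (x - 𝟙 Z) = 0 := by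
    nth_rewrite 1 [← hl]
    rw [Category.assoc, Preadditive.comp_sub, hg, Category.comp_id, sub_self, comp_zero]
  obtain ⟨y, rfl⟩ : ∃ y, x = 𝟙 Z + y := ⟨x - 𝟙 Z, by abel⟩
  rw [add_sub_cancel_left] at sq_zero
  exact ⟨𝟙 Z - y, by simp [sq_zero], by simp [sq_zero]⟩

theorem isIso_of_comm (hT : Triangle.mk f g h ∈ D.dist) (hT' : Triangle.mk f g' h' ∈ D.dist)
    (φ : Z ⟶ Z') (hg : g ≫ φ = g') (hh : φ ≫ h' = h) : IsIso φ := by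
  obtain ⟨ψ, hgψ, hhψ⟩ := D.complete hT' hT (𝟙 X) (𝟙 Y) (by simp)
  rw [Category.id_comp] at hgψ
  rw [CategoryTheory.Functor.map_id, Category.comp_id] at hhψ
  have : IsIso (φ ≫ ψ) := D.isIso_of_endomorphism hT _ (by rw [reassoc_of% hg, hgψ])
    (by rw [Category.assoc, ← hhψ, hh])
  have : IsIso (ψ ≫ φ) := D.isIso_of_endomorphism hT' _ (by rw [reassoc_of% hgψ, hg])
    (by rw [Category.assoc, hh, hhψ])
  have : IsSplitMono φ := ⟨⟨ψ ≫ inv (φ ≫ ψ), by rw [← Category.assoc, IsIso.hom_inv_id]⟩⟩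
  have : Epi φ := epi_of_epi ψ φ
  exact isIso_of_epi_of_isSplitMono φ

/-- Rotating three times is the shift up to signs, so a triangle with a distinguished rotation is
compared with a distinguished triangle on `f` after three rotations. -/
theorem mem_of_rotate_mem (hr : Triangle.mk g h (-f⟦(1 : ℤ)⟧') ∈ D.dist) :
    Triangle.mk f g h ∈ D.dist := by
  obtain ⟨Z', g', h', hT'⟩ := D.exists_mem f
  have hr₃ := D.rotate_mem (D.rotate_mem hr)
  have hr₃' := D.rotate_mem (D.rotate_mem (D.rotate_mem hT'))
  obtain ⟨φ, hgφ, hhφ⟩ := D.complete hr₃ hr₃' (𝟙 _) (𝟙 _) (by simp)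
  rw [Category.id_comp] at hgφ
  rw [CategoryTheory.Functor.map_id, Category.comp_id] at hhφ
  have : IsIso φ := D.isIso_of_comm hr₃ hr₃' φ hgφ hhφ.symm
  obtain ⟨ψ, rfl⟩ := (shiftFunctor E (1 : ℤ)).map_surjective φ
  have : IsIso ψ := isIso_of_reflects_iso ψ (shiftFunctor E (1 : ℤ))
  have hgψ : g ≫ ψ = g' := (shiftFunctor E (1 : ℤ)).map_injective (by simpa using hgφ)
  have hhψ : ψ ≫ h' = h := (shiftFunctor E (1 : ℤ)).map_injective (by simpa using hhφ.symm)
  exact D.iso_mem _ hT' _ (triangleMkIso (Iso.refl X) (Iso.refl Y) (asIso ψ) (by simp)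
    (by simp [hgψ]) (by simp [hhψ]))

variable [∀ n : ℤ, (shiftFunctor E n).Additive]

/-- The pretriangulated structure defined by a `PretriangulatedCore`. -/
@[reducible]
def pretriangulated : Pretriangulated E where
  distinguishedTriangles := D.dist
  isomorphic_distinguished T₁ h T₂ e := D.iso_mem T₁ h T₂ e
  contractible_distinguished := D.contractible_mem
  distinguished_cocone_triangle := D.exists_mem
  rotate_distinguished_triangle _ := ⟨D.rotate_mem, D.mem_of_rotate_mem⟩
  complete_distinguished_triangle_morphism _ _ h₁ h₂ a b h := D.complete h₁ h₂ a b h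

end PretriangulatedCore

end OneSided

/-! ### Stable categories attached to functorial embeddings -/

section IsCokernel

variable {𝒜 : Type u₁} [Category.{v₁} 𝒜] [Preadditive 𝒜]

/-- `z` is a cokernel of `x`, as a proposition. -/
structure IsCokernel {X Y Z : 𝒜} (x : X ⟶ Y) (z : Y ⟶ Z) : Prop where
  zero : x ≫ z = 0
  epi : Epi z
  desc : ∀ {A : 𝒜} (g : Y ⟶ A), x ≫ g = 0 → ∃ h, z ≫ h = g

theorem IsCokernel.biprod_lift_of_isPushout [HasBinaryBiproducts 𝒜]
    {X Y Z P : 𝒜} {f : X ⟶ Y} {j : X ⟶ Z} {v : Y ⟶ P} {g : Z ⟶ P} (h : IsPushout f j v g) :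
    IsCokernel (biprod.lift f j) (biprod.desc v (-g)) where
  zero := by simp [h.w]
  epi := ⟨fun a b hab => h.hom_ext (by simpa using congrArg (fun t => biprod.inl ≫ t) hab)
    (by simpa using congrArg (fun t => biprod.inr ≫ t) hab)⟩
  desc a ha := by
    have hw : f ≫ biprod.inl ≫ a + j ≫ biprod.inr ≫ a = 0 := by
      rw [← ha]; simp [biprod.lift_eq]
    refine ⟨h.desc (biprod.inl ≫ a) (-(biprod.inr ≫ a)) (by
      rw [Preadditive.comp_neg]; exact eq_neg_of_add_eq_zero_left hw), ?_⟩
    ext <;> simp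

theorem IsCokernel.of_isPushout {X Y Z P W : 𝒜} {f : X ⟶ Y}
    {j : X ⟶ Z} {v : Y ⟶ P} {g : Z ⟶ P} (h : IsPushout f j v g) {p : Z ⟶ W}
    (hp : IsCokernel j p) {w : P ⟶ W} (hvw : v ≫ w = 0) (hgw : g ≫ w = p) : IsCokernel v w where
  zero := hvw
  epi := by have := hp.epi; rw [← hgw] at this; exact epi_of_epi g w
  desc a ha := by
    obtain ⟨l, hl⟩ := hp.desc (g ≫ a) (by rw [← h.w_assoc, ha, comp_zero])
    refine ⟨l, h.hom_ext ?_ ?_⟩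
    · rw [reassoc_of% hvw, zero_comp, ha]
    · rw [reassoc_of% hgw, hl]

end IsCokernel

/-- A functorial embedding `i : X ⟶ I X` with cokernel `p : I X ⟶ T X` for which the objects
`I N` are injective relative to the embeddings and projective relative to the projections, and
for which every object is, up to objects of the form `I N`, in the image of `T`. -/
structure StableData (𝒜 : Type u₁) [Category.{v₁} 𝒜] [Preadditive 𝒜] where
  I : 𝒜 ⥤ 𝒜
  T : 𝒜 ⥤ 𝒜
  additive_T : T.Additive
  i : ∀ X, X ⟶ I.obj X
  p : ∀ X, I.obj X ⟶ T.obj X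
  i_naturality : ∀ {X Y : 𝒜} (f : X ⟶ Y), f ≫ i Y = i X ≫ I.map f
  p_naturality : ∀ {X Y : 𝒜} (f : X ⟶ Y), I.map f ≫ p Y = p X ≫ T.map f
  mono_i : ∀ X, Mono (i X)
  isCokernel_p : ∀ X, IsCokernel (i X) (p X)
  lift : ∀ {X Z : 𝒜} (g : Z ⟶ I.obj X), g ≫ p X = 0 → ∃ h, h ≫ i X = g
  extend : ∀ {X N : 𝒜} (g : X ⟶ I.obj N), ∃ g', i X ≫ g' = g
  cover : ∀ {X N : 𝒜} (g : I.obj N ⟶ T.obj X), ∃ g', g' ≫ p X = g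
  exists_loop : ∀ M : 𝒜, ∃ (X N : 𝒜) (a : X ⟶ I.obj N) (b : I.obj N ⟶ M)
    (a' : I.obj N ⟶ I.obj X), IsCokernel a b ∧ a ≫ a' = i X
  exists_pushout : ∀ {X Y : 𝒜} (f : X ⟶ Y),
    ∃ (Z : 𝒜) (v : Y ⟶ Z) (f' : I.obj X ⟶ Z), IsPushout f (i X) v f'

namespace StableData

variable {𝒜 : Type u₁} [Category.{v₁} 𝒜] [Preadditive 𝒜] (D : StableData 𝒜)

attribute [instance] additive_T mono_i

instance (X : 𝒜) : Epi (D.p X) := (D.isCokernel_p X).epi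

theorem i_p (X : 𝒜) : D.i X ≫ D.p X = 0 := (D.isCokernel_p X).zero

theorem i_p_assoc {X Z : 𝒜} (h : D.T.obj X ⟶ Z) : D.i X ≫ D.p X ≫ h = 0 := by
  rw [reassoc_of% D.i_p X, zero_comp]

/-- A morphism is null if it factors through an object of the form `I N`. -/
def Null {X Y : 𝒜} (f : X ⟶ Y) : Prop :=
  ∃ (N : 𝒜) (a : X ⟶ D.I.obj N) (b : D.I.obj N ⟶ Y), f = a ≫ b

variable {D}

theorem null_iff {X Y : 𝒜} {f : X ⟶ Y} : D.Null f ↔ ∃ g, D.i X ≫ g = f := by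
  constructor
  · rintro ⟨N, a, b, rfl⟩
    obtain ⟨a', rfl⟩ := D.extend a
    exact ⟨a' ≫ b, by rw [Category.assoc]⟩
  · rintro ⟨g, rfl⟩
    exact ⟨X, D.i X, g, rfl⟩

theorem Null.add {X Y : 𝒜} {f g : X ⟶ Y} (hf : D.Null f) (hg : D.Null g) : D.Null (f + g) := by
  rw [null_iff] at *
  obtain ⟨a, rfl⟩ := hf
  obtain ⟨b, rfl⟩ := hg
  exact ⟨a + b, Preadditive.comp_add ..⟩

theorem Null.neg {X Y : 𝒜} {f : X ⟶ Y} (hf : D.Null f) : D.Null (-f) := by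
  obtain ⟨N, a, b, rfl⟩ := hf
  exact ⟨N, a, -b, (Preadditive.comp_neg a b).symm⟩

variable (D) in
theorem null_zero (X Y : 𝒜) : D.Null (0 : X ⟶ Y) := null_iff.2 ⟨0, comp_zero⟩

theorem Null.comp_left {X Y Z : 𝒜} {f : X ⟶ Y} (hf : D.Null f) (g : Z ⟶ X) : D.Null (g ≫ f) := by
  obtain ⟨N, a, b, rfl⟩ := hf
  exact ⟨N, g ≫ a, b, (Category.assoc g a b).symm⟩

theorem Null.comp_right {X Y Z : 𝒜} {f : X ⟶ Y} (hf : D.Null f) (g : Y ⟶ Z) : D.Null (f ≫ g) := by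
  obtain ⟨N, a, b, rfl⟩ := hf
  exact ⟨N, a, b ≫ g, Category.assoc a b g⟩

/-- The embedding of `I N` splits, so `T (I N)` is a retract of `I (I N)`. -/
theorem Null.map_T {X Y : 𝒜} {f : X ⟶ Y} (hf : D.Null f) : D.Null (D.T.map f) := by
  obtain ⟨N, a, b, rfl⟩ := hf
  obtain ⟨ρ, hρ⟩ := D.extend (𝟙 (D.I.obj N))
  obtain ⟨s, hs⟩ := (D.isCokernel_p _).desc (𝟙 _ - ρ ≫ D.i _) (by
    rw [Preadditive.comp_sub, reassoc_of% hρ, Category.comp_id, sub_self])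
  have hsp : s ≫ D.p _ = 𝟙 (D.T.obj (D.I.obj N)) := by
    rw [← cancel_epi (D.p _), reassoc_of% hs, Preadditive.sub_comp, Category.assoc, i_p,
      comp_zero, sub_zero, Category.id_comp, Category.comp_id]
  rw [D.T.map_comp]
  exact ⟨_, D.T.map a ≫ s, D.p _ ≫ D.T.map b, by rw [Category.assoc, reassoc_of% hsp]⟩

theorem Null.of_map_T {X Y : 𝒜} {f : X ⟶ Y} (hf : D.Null (D.T.map f)) : D.Null f := by
  obtain ⟨N, a, b, h⟩ := hf
  obtain ⟨b', rfl⟩ := D.cover b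
  obtain ⟨l, hl⟩ := D.lift (D.I.map f - D.p X ≫ a ≫ b') (by
    rw [Preadditive.sub_comp, p_naturality, h, Category.assoc, Category.assoc, sub_self])
  refine null_iff.2 ⟨l, ?_⟩
  rw [← cancel_mono (D.i Y), Category.assoc, hl, i_naturality, Preadditive.comp_sub, i_p_assoc,
    sub_zero]

section Cones

/-- `Z` is the cone of `f`: the pushout of `f` along `i X`, with its maps from `Y` and to `T X`. -/
def IsCone (D : StableData 𝒜) {X Y Z : 𝒜} (f : X ⟶ Y) (v : Y ⟶ Z) (w : Z ⟶ D.T.obj X) : Prop :=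
  ∃ f' : D.I.obj X ⟶ Z, IsPushout f (D.i X) v f' ∧ v ≫ w = 0 ∧ f' ≫ w = D.p X

variable (D) in
theorem exists_isCone {X Y : 𝒜} (f : X ⟶ Y) :
    ∃ (Z : 𝒜) (v : Y ⟶ Z) (w : Z ⟶ D.T.obj X), D.IsCone f v w := by
  obtain ⟨Z, v, f', h⟩ := D.exists_pushout f
  exact ⟨Z, v, h.desc 0 (D.p X) (by rw [comp_zero, i_p]), f', h, h.inl_desc .., h.inr_desc ..⟩

/-- `z` is a cokernel of `x`, where `i X` extends along `x`, and `w` is the map induced by such an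
extension: the classifying map of the extension `Y` of `Z` by `X`. -/
def IsConflation (D : StableData 𝒜) {X Y Z : 𝒜} (x : X ⟶ Y) (z : Y ⟶ Z) (w : Z ⟶ D.T.obj X) :
    Prop :=
  IsCokernel x z ∧ ∃ a : Y ⟶ D.I.obj X, x ≫ a = D.i X ∧ z ≫ w = a ≫ D.p X

theorem IsCone.isConflation {X Y Z : 𝒜} {f : X ⟶ Y} {v : Y ⟶ Z} {w : Z ⟶ D.T.obj X}
    (h : D.IsCone f v w) : D.IsConflation v w (D.T.map f) := by
  obtain ⟨f', hf, hvw, hfw⟩ := h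
  refine ⟨.of_isPushout hf (D.isCokernel_p X) hvw hfw,
    hf.desc (D.i Y) (D.I.map f) (D.i_naturality f), hf.inl_desc .., hf.hom_ext ?_ ?_⟩
  · rw [reassoc_of% hvw, hf.inl_desc_assoc, i_p, zero_comp]
  · rw [reassoc_of% hfw, hf.inr_desc_assoc, p_naturality]

variable (D) in
theorem exists_isConflation_biprod_lift [HasBinaryBiproducts 𝒜] {X Y : 𝒜} (y : X ⟶ Y) :
    ∃ (Z : 𝒜) (z : Y ⊞ D.I.obj X ⟶ Z) (w : Z ⟶ D.T.obj X),
      D.IsConflation (biprod.lift y (D.i X)) z w := by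
  obtain ⟨Z, v, f', h⟩ := D.exists_pushout y
  have hz := IsCokernel.biprod_lift_of_isPushout h
  obtain ⟨w, hw⟩ := hz.desc (biprod.snd ≫ D.p X) (by rw [biprod.lift_snd_assoc, i_p])
  exact ⟨Z, _, w, hz, biprod.snd, biprod.lift_snd .., hw⟩

/-- The octahedron over `X ⟶ Y ⟶ W` when the second morphism is the first map of a conflation. -/
theorem IsCone.exists_octahedron {X Y W Z₁ Z₂ Z₃ : 𝒜} {u : X ⟶ Y} {x : Y ⟶ W} {z : W ⟶ Z₂}
    {w : Z₂ ⟶ D.T.obj Y} {v₁ : Y ⟶ Z₁} {w₁ : Z₁ ⟶ D.T.obj X} {v₃ : W ⟶ Z₃}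
    {w₃ : Z₃ ⟶ D.T.obj X} (hu : D.IsCone u v₁ w₁) (hx : D.IsConflation x z w)
    (hux : D.IsCone (u ≫ x) v₃ w₃) :
    ∃ (m : Z₁ ⟶ Z₃) (n : Z₃ ⟶ Z₂), v₁ ≫ m = x ≫ v₃ ∧ m ≫ w₃ = w₁ ∧ v₃ ≫ n = z ∧
      D.IsConflation m n (w ≫ D.T.map v₁) ∧ D.Null (w₃ ≫ D.T.map u + n ≫ w) := by
  obtain ⟨f₁, h₁, hvw₁, hfw₁⟩ := hu
  obtain ⟨f₃, h₃, hvw₃, hfw₃⟩ := hux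
  obtain ⟨hz, b, hxb, hzw⟩ := hx
  have := hz.epi
  obtain ⟨m, hvm, hfm⟩ := h₁.exists_desc (x ≫ v₃) f₃ (by rw [← h₃.w, Category.assoc])
  obtain ⟨n, hvn, hfn⟩ := h₃.exists_desc z 0 (by
    rw [Category.assoc, hz.zero, comp_zero, comp_zero])
  obtain ⟨a, hva, hfa⟩ := h₃.exists_desc (b ≫ D.I.map v₁) (f₁ ≫ D.i Z₁) (by
    rw [Category.assoc, reassoc_of% hxb, ← i_naturality, ← Category.assoc, h₁.w, Category.assoc])
  obtain ⟨ρ, hvρ, hfρ⟩ := h₃.exists_desc b (D.I.map u) (by rw [Category.assoc, hxb, i_naturality])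
  have hmn : IsCokernel m n :=
    { zero := h₁.hom_ext (by rw [reassoc_of% hvm, hvn, hz.zero, comp_zero])
        (by rw [reassoc_of% hfm, hfn, comp_zero])
      epi := by rw [← hvn] at this; exact epi_of_epi v₃ n
      desc := fun g hg => by
        obtain ⟨l, hl⟩ := hz.desc (v₃ ≫ g) (by rw [← reassoc_of% hvm, hg, comp_zero])
        refine ⟨l, h₃.hom_ext (by rw [reassoc_of% hvn, hl]) ?_⟩
        rw [reassoc_of% hfn, ← hfm, Category.assoc, hg, comp_zero, zero_comp] }
  refine ⟨m, n, hvm, h₁.hom_ext ?_ ?_, hvn, ⟨hmn, a, h₁.hom_ext ?_ ?_, h₃.hom_ext ?_ ?_⟩,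
    ⟨Y, ρ, D.p Y, h₃.hom_ext ?_ ?_⟩⟩
  · rw [reassoc_of% hvm, hvw₃, hvw₁, comp_zero]
  · rw [reassoc_of% hfm, hfw₃, hfw₁]
  · rw [reassoc_of% hvm, hva, reassoc_of% hxb, i_naturality]
  · rw [reassoc_of% hfm, hfa]
  · rw [reassoc_of% hvn, reassoc_of% hzw, reassoc_of% hva, p_naturality]
  · rw [reassoc_of% hfn, reassoc_of% hfa, i_p, zero_comp, comp_zero]
  · rw [Preadditive.comp_add, reassoc_of% hvw₃, reassoc_of% hvn, reassoc_of% hvρ, zero_comp,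
      zero_add, hzw]
  · rw [Preadditive.comp_add, reassoc_of% hfw₃, reassoc_of% hfn, reassoc_of% hfρ, zero_comp,
      add_zero, p_naturality]

end Cones

end StableData

namespace StableData

variable {𝒜 : Type u₁} [Category.{v₁} 𝒜] [Preadditive 𝒜] {D : StableData 𝒜}
  {E : Type u₂} [Category.{v₂} E] {Q : 𝒜 ⥤ E}

variable (D Q) in
/-- `Q` is, up to renaming the objects, the quotient functor modulo the null morphisms. -/
structure IsStableQuotient : Prop where
  full : Q.Full
  obj_surjective : Function.Surjective Q.obj
  map_eq_iff : ∀ {X Y : 𝒜} {f g : X ⟶ Y}, Q.map f = Q.map g ↔ D.Null (f - g)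

namespace IsStableQuotient

variable (hQ : D.IsStableQuotient Q)
include hQ

theorem map_surjective {X Y : 𝒜} : Function.Surjective (Q.map : (X ⟶ Y) → _) :=
  have := hQ.full
  Q.map_surjective

/-- Two morphisms that are mutually inverse modulo null morphisms are isomorphisms in the stable
category. -/
def mapIso {X Y : 𝒜} (f : X ⟶ Y) (g : Y ⟶ X) (hfg : D.Null (f ≫ g - 𝟙 X))
    (hgf : D.Null (g ≫ f - 𝟙 Y)) : Q.obj X ≅ Q.obj Y where
  hom := Q.map f
  inv := Q.map g
  hom_inv_id := by
    rw [← Q.map_comp, ← Q.map_id]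
    exact hQ.map_eq_iff.2 hfg
  inv_hom_id := by
    rw [← Q.map_comp, ← Q.map_id]
    exact hQ.map_eq_iff.2 hgf

theorem exists_map_of_isCone {X Y Z X' Y' Z' : 𝒜} {f : X ⟶ Y} {v : Y ⟶ Z} {w : Z ⟶ D.T.obj X}
    {f' : X' ⟶ Y'} {v' : Y' ⟶ Z'} {w' : Z' ⟶ D.T.obj X'} (h : D.IsCone f v w)
    (h' : D.IsCone f' v' w') (a : X ⟶ X') (b : Y ⟶ Y')
    (comm : Q.map f ≫ Q.map b = Q.map a ≫ Q.map f') :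
    ∃ c : Z ⟶ Z', v ≫ c = b ≫ v' ∧ w ≫ D.T.map a = c ≫ w' := by
  obtain ⟨g, hg, hvw, hgw⟩ := h
  obtain ⟨g', hg', hvw', hgw'⟩ := h'
  rw [← Q.map_comp, ← Q.map_comp, hQ.map_eq_iff, null_iff] at comm
  obtain ⟨l, hl⟩ := comm
  obtain ⟨c, hvc, hgc⟩ := hg.exists_desc (b ≫ v') (D.I.map a ≫ g' + l ≫ v') (by
    rw [Preadditive.comp_add, reassoc_of% hl, ← reassoc_of% D.i_naturality a, ← hg'.w,
      Preadditive.sub_comp, Category.assoc, Category.assoc, add_sub_cancel])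
  refine ⟨c, hvc, hg.hom_ext ?_ ?_⟩
  · rw [reassoc_of% hvw, reassoc_of% hvc, hvw', zero_comp, comp_zero]
  · rw [reassoc_of% hgw, reassoc_of% hgc, Preadditive.add_comp, Category.assoc, Category.assoc,
      hvw', hgw', comp_zero, add_zero, p_naturality]

theorem isZero_obj_I (N : 𝒜) : IsZero (Q.obj (D.I.obj N)) where
  unique_to M := by
    obtain ⟨Y, rfl⟩ := hQ.obj_surjective M
    refine ⟨⟨⟨Q.map 0⟩, fun f => ?_⟩⟩
    obtain ⟨f, rfl⟩ := hQ.map_surjective f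
    exact hQ.map_eq_iff.2 ⟨N, 𝟙 _, f - 0, (Category.id_comp _).symm⟩
  unique_from M := by
    obtain ⟨Y, rfl⟩ := hQ.obj_surjective M
    refine ⟨⟨⟨Q.map 0⟩, fun f => ?_⟩⟩
    obtain ⟨f, rfl⟩ := hQ.map_surjective f
    exact hQ.map_eq_iff.2 ⟨N, f - 0, 𝟙 _, (Category.comp_id _).symm⟩

variable {T' : E ⥤ E} (θ : Q ⋙ T' ≅ D.T ⋙ Q)

include θ in
theorem faithful_of_iso : T'.Faithful where
  map_injective := by
    intro X' Y' f' g' h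
    obtain ⟨X, rfl⟩ := hQ.obj_surjective X'
    obtain ⟨Y, rfl⟩ := hQ.obj_surjective Y'
    obtain ⟨f, rfl⟩ := hQ.map_surjective f'
    obtain ⟨g, rfl⟩ := hQ.map_surjective g'
    have hT : Q.map (D.T.map f) = Q.map (D.T.map g) := by
      rw [← cancel_epi (θ.hom.app X)]
      exact (θ.hom.naturality f).symm.trans (by
        rw [Functor.comp_map, h]; exact θ.hom.naturality g)
    rw [hQ.map_eq_iff, ← D.T.map_sub] at hT
    exact hQ.map_eq_iff.2 hT.of_map_T

include θ in
theorem full_of_iso : T'.Full where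
  map_surjective := by
    intro X' Y' g'
    obtain ⟨X, rfl⟩ := hQ.obj_surjective X'
    obtain ⟨Y, rfl⟩ := hQ.obj_surjective Y'
    obtain ⟨g, hg⟩ := hQ.map_surjective (θ.inv.app X ≫ g' ≫ θ.hom.app Y)
    obtain ⟨q, hq⟩ := D.cover (D.p X ≫ g)
    obtain ⟨f, hf⟩ := D.lift (D.i X ≫ q) (by rw [Category.assoc, hq, i_p_assoc])
    obtain ⟨l, hl⟩ := (D.isCokernel_p X).desc (D.I.map f - q) (by
      rw [Preadditive.comp_sub, ← i_naturality, hf, sub_self])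
    have hfg : Q.map (D.T.map f) = Q.map g := hQ.map_eq_iff.2 ⟨_, l, D.p Y, by
      rw [← cancel_epi (D.p X), reassoc_of% hl, Preadditive.comp_sub, ← p_naturality,
        Preadditive.sub_comp, hq]⟩
    refine ⟨Q.map f, ?_⟩
    rw [← cancel_mono (θ.hom.app Y)]
    refine (θ.hom.naturality f).trans ?_
    rw [Functor.comp_map, hfg, hg, Iso.hom_inv_id_app_assoc]

theorem exists_iso_obj_T (M : 𝒜) : ∃ X, Nonempty (Q.obj (D.T.obj X) ≅ Q.obj M) := by
  obtain ⟨X, N, a, b, a', hab, haa'⟩ := D.exists_loop M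
  have := hab.epi
  obtain ⟨c, hc⟩ := D.extend a
  obtain ⟨φ, hφ⟩ := hab.desc (a' ≫ D.p X) (by rw [reassoc_of% haa', i_p])
  obtain ⟨ψ, hψ⟩ := (D.isCokernel_p X).desc (c ≫ b) (by rw [reassoc_of% hc, hab.zero])
  obtain ⟨l, hl⟩ := hab.desc (a' ≫ c - 𝟙 _) (by
    rw [Preadditive.comp_sub, reassoc_of% haa', hc, Category.comp_id, sub_self])
  obtain ⟨m, hm⟩ := (D.isCokernel_p X).desc (c ≫ a' - 𝟙 _) (by
    rw [Preadditive.comp_sub, reassoc_of% hc, haa', Category.comp_id, sub_self])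
  refine ⟨X, ⟨hQ.mapIso ψ φ ⟨_, m, D.p X, ?_⟩ ⟨_, l, b, ?_⟩⟩⟩
  · rw [← cancel_epi (D.p X), reassoc_of% hm, Preadditive.comp_sub, reassoc_of% hψ, hφ,
      Preadditive.sub_comp, Category.assoc, Category.id_comp, Category.comp_id]
  · rw [← cancel_epi b, reassoc_of% hl, Preadditive.comp_sub, reassoc_of% hφ, hψ,
      Preadditive.sub_comp, Category.assoc, Category.id_comp, Category.comp_id]

include θ in
theorem isEquivalence_of_iso : T'.IsEquivalence where
  faithful := hQ.faithful_of_iso θ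
  full := hQ.full_of_iso θ
  essSurj := ⟨fun M' => by
    obtain ⟨M, rfl⟩ := hQ.obj_surjective M'
    obtain ⟨X, ⟨j⟩⟩ := hQ.exists_iso_obj_T M
    exact ⟨Q.obj X, ⟨θ.app X ≪≫ j⟩⟩⟩

end IsStableQuotient

section Triangles

variable [HasShift E ℤ] (e : D.T ⋙ Q ≅ Q ⋙ shiftFunctor E (1 : ℤ))

/-- The triangles isomorphic to images of cones. -/
def coneTriangles : Set (Triangle E) :=
  {t | ∃ (X Y Z : 𝒜) (f : X ⟶ Y) (v : Y ⟶ Z) (w : Z ⟶ D.T.obj X), D.IsCone f v w ∧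
    Nonempty (t ≅ Triangle.mk (Q.map f) (Q.map v) (Q.map w ≫ e.hom.app X))}

theorem map_T_comp_app {X Y : 𝒜} (f : X ⟶ Y) :
    Q.map (D.T.map f) ≫ e.hom.app Y = e.hom.app X ≫ (Q.map f)⟦(1 : ℤ)⟧' :=
  e.hom.naturality f

theorem mem_coneTriangles_of_iso {t t' : Triangle E} (ht : t ∈ coneTriangles e) (i : t' ≅ t) :
    t' ∈ coneTriangles e := by
  obtain ⟨X, Y, Z, f, v, w, h, ⟨j⟩⟩ := ht
  exact ⟨X, Y, Z, f, v, w, h, ⟨i ≪≫ j⟩⟩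

theorem IsCone.mem_coneTriangles {X Y Z : 𝒜} {f : X ⟶ Y} {v : Y ⟶ Z} {w : Z ⟶ D.T.obj X}
    (h : D.IsCone f v w) :
    Triangle.mk (Q.map f) (Q.map v) (Q.map w ≫ e.hom.app X) ∈ coneTriangles e :=
  ⟨X, Y, Z, f, v, w, h, ⟨Iso.refl _⟩⟩

variable (hQ : D.IsStableQuotient Q)
include hQ

theorem complete_mem_coneTriangles {X₁ Y₁ Z₁ X₂ Y₂ Z₂ : E} {f₁ : X₁ ⟶ Y₁} {g₁ : Y₁ ⟶ Z₁}
    {h₁ : Z₁ ⟶ X₁⟦(1 : ℤ)⟧} {f₂ : X₂ ⟶ Y₂} {g₂ : Y₂ ⟶ Z₂} {h₂ : Z₂ ⟶ X₂⟦(1 : ℤ)⟧}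
    (ht₁ : Triangle.mk f₁ g₁ h₁ ∈ coneTriangles e) (ht₂ : Triangle.mk f₂ g₂ h₂ ∈ coneTriangles e)
    (a : X₁ ⟶ X₂) (b : Y₁ ⟶ Y₂) (hab : f₁ ≫ b = a ≫ f₂) :
    ∃ c : Z₁ ⟶ Z₂, g₁ ≫ c = b ≫ g₂ ∧ h₁ ≫ a⟦(1 : ℤ)⟧' = c ≫ h₂ := by
  obtain ⟨X, Y, Z, f, v, w, hc, ⟨j⟩⟩ := ht₁
  obtain ⟨X', Y', Z', f', v', w', hc', ⟨j'⟩⟩ := ht₂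
  obtain ⟨e₁, e₂, e₃, comm₁, comm₂, comm₃⟩ := exists_isos_of_triangle_mk_iso j
  obtain ⟨e₁', e₂', e₃', comm₁', comm₂', comm₃'⟩ := exists_isos_of_triangle_mk_iso j'
  obtain ⟨α, hα⟩ := hQ.map_surjective (e₁.inv ≫ a ≫ e₁'.hom)
  obtain ⟨β, hβ⟩ := hQ.map_surjective (e₂.inv ≫ b ≫ e₂'.hom)
  obtain ⟨γ, hvγ, hwγ⟩ := hQ.exists_map_of_isCone hc hc' α β (by
    rw [hα, hβ, ← cancel_epi e₁.hom, ← reassoc_of% comm₁, Iso.hom_inv_id_assoc, Category.assoc,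
      Category.assoc, ← comm₁', reassoc_of% hab, Iso.hom_inv_id_assoc])
  refine ⟨e₃.hom ≫ Q.map γ ≫ e₃'.inv, ?_, ?_⟩
  · rw [reassoc_of% comm₂, ← Q.map_comp_assoc, hvγ, Q.map_comp_assoc, hβ,
      ← cancel_mono e₃'.hom]
    simp [comm₂']
  · have ha : a ≫ e₁'.hom = e₁.hom ≫ Q.map α := by rw [hα, Iso.hom_inv_id_assoc]
    rw [← cancel_mono (e₁'.hom⟦(1 : ℤ)⟧'), Category.assoc, ← Functor.map_comp, ha,
      Functor.map_comp, reassoc_of% comm₃, Category.assoc, ← map_T_comp_app, ← Q.map_comp_assoc,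
      hwγ, Q.map_comp_assoc, Category.assoc, Category.assoc, comm₃', Iso.inv_hom_id_assoc]

theorem contractible_mem_coneTriangles [Preadditive E] [HasZeroObject E] (M : E) :
    contractibleTriangle M ∈ coneTriangles e := by
  obtain ⟨X, rfl⟩ := hQ.obj_surjective M
  have hc : D.IsCone (𝟙 X) (D.i X) (D.p X) :=
    ⟨𝟙 _, IsPushout.of_horiz_isIso ⟨by simp⟩, D.i_p X, Category.id_comp _⟩
  exact mem_coneTriangles_of_iso e (hc.mem_coneTriangles e)
    (triangleMkIso (Iso.refl (Q.obj X)) (Iso.refl (Q.obj X))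
      ((isZero_zero _).iso (hQ.isZero_obj_I X)) (by simp) ((hQ.isZero_obj_I X).eq_of_tgt _ _)
      ((isZero_zero _).eq_of_src _ _))

variable [Preadditive E] [Q.Additive]

/-- The pushout `C` of `x` along `i X` maps onto `Z`; this map is invertible modulo null
morphisms because the extension `a` of `i X` along `x` splits off the kernel `I X`. -/
theorem IsConflation.mem_coneTriangles {X Y Z : 𝒜} {x : X ⟶ Y} {z : Y ⟶ Z} {w : Z ⟶ D.T.obj X}
    (h : D.IsConflation x z w) :
    Triangle.mk (Q.map x) (Q.map z) (-(Q.map w ≫ e.hom.app X)) ∈ coneTriangles e := by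
  obtain ⟨hz, a, hxa, hzw⟩ := h
  have := hz.epi
  obtain ⟨C, v, c, f', hf, hvc, hfc⟩ := D.exists_isCone x
  obtain ⟨q, hvq, hfq⟩ := hf.exists_desc z 0 (by rw [hz.zero, comp_zero])
  obtain ⟨ρ, hvρ, hfρ⟩ := hf.exists_desc a (𝟙 _) (by rw [hxa, Category.comp_id])
  obtain ⟨s, hs⟩ := hz.desc (v - a ≫ f') (by
    rw [Preadditive.comp_sub, reassoc_of% hxa, hf.w, sub_self])
  have hsq : s ≫ q = 𝟙 Z := by
    rw [← cancel_epi z, reassoc_of% hs, Preadditive.sub_comp, Category.assoc, hvq, hfq, comp_zero,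
      sub_zero, Category.comp_id]
  have hqs : q ≫ s - 𝟙 C = ρ ≫ (-f') := by
    apply hf.hom_ext
    · simp [reassoc_of% hvq, hs, reassoc_of% hvρ]
    · simp [reassoc_of% hfq, reassoc_of% hfρ]
  have hsc : s ≫ c = -w := by
    rw [← cancel_epi z, reassoc_of% hs, Preadditive.sub_comp, Category.assoc, hvc, hfc, zero_sub,
      Preadditive.comp_neg, hzw]
  have hC : D.IsCone x v c := ⟨f', hf, hvc, hfc⟩
  refine mem_coneTriangles_of_iso e (hC.mem_coneTriangles e) (triangleMkIso (Iso.refl _)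
    (Iso.refl _) (hQ.mapIso s q (by rw [hsq, sub_self]; exact D.null_zero _ _) ⟨_, _, _, hqs⟩)
    ?_ ?_ ?_)
  · simp
  · change Q.map z ≫ Q.map s = 𝟙 _ ≫ Q.map v
    rw [← Q.map_comp, hs, Category.id_comp, hQ.map_eq_iff]
    exact ⟨X, a, -f', by simp⟩
  · change _ ≫ (𝟙 (Q.obj X))⟦(1 : ℤ)⟧' = Q.map s ≫ Q.map c ≫ _
    rw [← Q.map_comp_assoc, hsc, CategoryTheory.Functor.map_id, Category.comp_id, Q.map_neg,
      Preadditive.neg_comp]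

theorem IsCone.rotate_mem_coneTriangles {X Y Z : 𝒜} {f : X ⟶ Y} {v : Y ⟶ Z} {w : Z ⟶ D.T.obj X}
    (h : D.IsCone f v w) :
    Triangle.mk (Q.map v) (Q.map w ≫ e.hom.app X) (-(Q.map f)⟦(1 : ℤ)⟧') ∈ coneTriangles e := by
  refine mem_coneTriangles_of_iso e (h.isConflation.mem_coneTriangles e hQ)
    (triangleMkIso (Iso.refl _) (Iso.refl _) (e.app X).symm ?_ ?_ ?_)
  · simp
  · change (Q.map w ≫ e.hom.app X) ≫ e.inv.app X = 𝟙 _ ≫ Q.map w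
    rw [Category.assoc, Iso.hom_inv_id_app, Category.id_comp]
    exact Category.comp_id _
  · change (-(Q.map f)⟦(1 : ℤ)⟧') ≫ (𝟙 (Q.obj Y))⟦(1 : ℤ)⟧' =
      e.inv.app X ≫ (-(Q.map (D.T.map f) ≫ e.hom.app Y))
    rw [CategoryTheory.Functor.map_id, Category.comp_id, map_T_comp_app,
      Preadditive.comp_neg, Iso.inv_hom_id_app_assoc]

variable [HasZeroObject E] [∀ n : ℤ, (shiftFunctor E n).Additive]

/-- Images of cones satisfy the axioms of distinguished triangles. -/
def core : PretriangulatedCore E where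
  dist := coneTriangles e
  iso_mem _ h _ i := mem_coneTriangles_of_iso e h i
  contractible_mem := contractible_mem_coneTriangles e hQ
  exists_mem := by
    intro X' Y' f'
    obtain ⟨X, rfl⟩ := hQ.obj_surjective X'
    obtain ⟨Y, rfl⟩ := hQ.obj_surjective Y'
    obtain ⟨f, rfl⟩ := hQ.map_surjective f'
    obtain ⟨Z, v, w, h⟩ := D.exists_isCone f
    exact ⟨Q.obj Z, Q.map v, Q.map w ≫ e.hom.app X, h.mem_coneTriangles e⟩
  rotate_mem := by
    rintro X Y Z f g h ⟨X', Y', Z', f', v', w', hc, ⟨j⟩⟩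
    exact mem_coneTriangles_of_iso e (hc.rotate_mem_coneTriangles e hQ) ((rotate E).mapIso j)
  complete := complete_mem_coneTriangles e hQ

/-- The pretriangulated structure of the stable category. -/
@[reducible]
def pretriangulated : Pretriangulated E := (core e hQ).pretriangulated

/-- Every morphism of the stable category is, up to isomorphism, the first map of a conflation,
which reduces the octahedral axiom to `IsCone.exists_octahedron`. -/
theorem isTriangulated [HasBinaryBiproducts 𝒜] :
    letI := pretriangulated e hQ
    IsTriangulated E := by
  let := pretriangulated e hQ
  refine IsTriangulated.mk' ?_
  intro X' Y' W' u' y'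
  obtain ⟨X, rfl⟩ := hQ.obj_surjective X'
  obtain ⟨Y, rfl⟩ := hQ.obj_surjective Y'
  obtain ⟨W, rfl⟩ := hQ.obj_surjective W'
  obtain ⟨u, rfl⟩ := hQ.map_surjective u'
  obtain ⟨y, rfl⟩ := hQ.map_surjective y'
  obtain ⟨Z₂, z, w, hx⟩ := D.exists_isConflation_biprod_lift y
  set x := biprod.lift y (D.i Y)
  obtain ⟨Z₁, v₁, w₁, h₁⟩ := D.exists_isCone u
  obtain ⟨Z₃, v₃, w₃, h₃⟩ := D.exists_isCone (u ≫ x)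
  obtain ⟨m, n, hvm, hmw, hvn, hmn, hn⟩ := h₁.exists_octahedron hx h₃
  refine ⟨Q.obj X, Q.obj Y, Q.obj (W ⊞ D.I.obj Y), Q.obj Z₁, Q.obj Z₂, Q.obj Z₃,
    Q.map u, Q.map x, Iso.refl _, Iso.refl _,
    hQ.mapIso biprod.inl biprod.fst (by simpa using D.null_zero _ _)
      ⟨Y, biprod.snd, -biprod.inr, ?_⟩, ?_, ?_, Q.map v₁, Q.map w₁ ≫ e.hom.app X,
    h₁.mem_coneTriangles e, Q.map z, -(Q.map w ≫ e.hom.app Y), hx.mem_coneTriangles e hQ,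
    Q.map v₃, Q.map w₃ ≫ e.hom.app X, ?_,
    ⟨{ m₁ := Q.map m, m₃ := Q.map n, comm₁ := ?_, comm₂ := ?_, comm₃ := ?_, comm₄ := ?_,
       mem := ?_ }⟩⟩
  · rw [← biprod.total, sub_add_cancel_left, Preadditive.comp_neg]
  · simp
  · change Q.map y ≫ Q.map biprod.inl = 𝟙 _ ≫ Q.map x
    rw [Category.id_comp, ← Q.map_comp, hQ.map_eq_iff]
    exact ⟨Y, D.i Y, -biprod.inr, by simp [x, biprod.lift_eq]⟩
  · rw [← Q.map_comp]; exact h₃.mem_coneTriangles e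
  · rw [← Q.map_comp, ← Q.map_comp, hvm]
  · rw [← Q.map_comp_assoc, hmw]
  · rw [← Q.map_comp, hvn]
  · rw [Category.assoc, ← map_T_comp_app, ← Q.map_comp_assoc, Preadditive.comp_neg,
      ← Q.map_comp_assoc, ← Preadditive.neg_comp, ← Q.map_neg]
    congr 1
    rwa [hQ.map_eq_iff, sub_neg_eq_add]
  · rw [Preadditive.neg_comp, Category.assoc, ← map_T_comp_app, ← Q.map_comp_assoc]
    exact hmn.mem_coneTriangles e hQ

end Triangles

variable (D Q) in
/-- The triangulated structure of `E` is the one of the stable category: the shift is induced by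
`T` and the distinguished triangles are those isomorphic to images of cones. -/
def IsTriangulation [Preadditive E] [HasZeroObject E] [HasShift E ℤ]
    [∀ n : ℤ, (shiftFunctor E n).Additive] [Pretriangulated E] : Prop :=
  IsTriangulated E ∧ Q.Additive ∧
    ∃ e : D.T ⋙ Q ≅ Q ⋙ shiftFunctor E (1 : ℤ), distTriang E = coneTriangles e

section Quotient

variable {r : HomRel 𝒜} (hr : ∀ {X Y : 𝒜} (f g : X ⟶ Y), r f g ↔ D.Null (f - g))
include hr

theorem congruence : Congruence r where
  equivalence := fun {X Y} =>
    { refl := fun f => (hr f f).2 (by rw [sub_self]; exact D.null_zero X Y)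
      symm := fun h => (hr _ _).2 (by rw [← neg_sub]; exact ((hr _ _).1 h).neg)
      trans := fun h h' => (hr _ _).2 (by
        rw [← sub_add_sub_cancel]; exact ((hr _ _).1 h).add ((hr _ _).1 h')) }
  comp_left := fun f _ _ h => (hr _ _).2 (by
    rw [← Preadditive.comp_sub]; exact ((hr _ _).1 h).comp_left f)
  comp_right := fun g h => (hr _ _).2 (by
    rw [← Preadditive.sub_comp]; exact ((hr _ _).1 h).comp_right g)

theorem isStableQuotient : D.IsStableQuotient (Quotient.functor r) where
  full := inferInstance
  obj_surjective X := ⟨X.as, rfl⟩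
  map_eq_iff := by
    intro X Y f g
    have := congruence hr
    rw [Quotient.functor_map_eq_iff, hr]

theorem rel_add ⦃X Y : 𝒜⦄ (f₁ f₂ g₁ g₂ : X ⟶ Y) (hf : r f₁ f₂) (hg : r g₁ g₂) :
    r (f₁ + g₁) (f₂ + g₂) := by
  rw [hr] at *
  rw [add_sub_add_comm]
  exact hf.add hg

/-- The preadditive structure of the stable category. -/
@[reducible]
def preadditive : Preadditive (Quotient r) :=
  have := congruence hr
  Quotient.preadditive r (rel_add hr)

theorem functor_additive : letI := preadditive hr; (Quotient.functor r).Additive :=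
  have := congruence hr
  Quotient.functor_additive r (rel_add hr)

/-- The endofunctor of the stable category induced by `T`. -/
def stableT : CategoryTheory.Quotient r ⥤ CategoryTheory.Quotient r :=
  CategoryTheory.Quotient.lift r (D.T ⋙ Quotient.functor r) (fun X Y f g h => by
    rw [Functor.comp_map, Functor.comp_map, (isStableQuotient hr).map_eq_iff, ← D.T.map_sub]
    exact ((hr f g).1 h).map_T)

omit hr in
theorem hasBinaryBiproducts [HasBinaryBiproducts 𝒜] [Preadditive (CategoryTheory.Quotient r)]
    [(Quotient.functor r).Additive] : HasBinaryBiproducts (CategoryTheory.Quotient r) where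
  has_binary_biproduct := by
    rintro ⟨X⟩ ⟨Y⟩
    have := (Quotient.functor r).preservesFiniteBiproductsOfAdditive
    have := preservesBinaryBiproducts_of_preservesBiproducts (Quotient.functor r)
    exact HasBinaryBiproduct.mk ⟨_, isBinaryBilimitOfPreserves (Quotient.functor r)
      (BinaryBiproduct.isBilimit X Y)⟩

theorem exists_isTriangulation [HasBinaryBiproducts 𝒜] [HasZeroObject 𝒜] :
    ∃ (_ : Preadditive (CategoryTheory.Quotient r)) (_ : HasZeroObject (CategoryTheory.Quotient r))
      (_ : HasShift (CategoryTheory.Quotient r) ℤ)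
      (_ : ∀ n : ℤ, (shiftFunctor (CategoryTheory.Quotient r) n).Additive)
      (_ : Pretriangulated (CategoryTheory.Quotient r)),
      D.IsTriangulation (Quotient.functor r) := by
  have hQ := isStableQuotient hr
  let := preadditive hr
  have := functor_additive hr
  have : (stableT hr).IsEquivalence := hQ.isEquivalence_of_iso (Iso.refl _)
  obtain ⟨_, ⟨j⟩⟩ := exists_hasShift_iso_shiftFunctor_one (stableT hr)
  have := hasBinaryBiproducts (r := r)
  have hshift : ∀ n : ℤ, (shiftFunctor (CategoryTheory.Quotient r) n).Additive := fun n =>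
    (shiftFunctor (CategoryTheory.Quotient r) n).additive_of_preserves_binary_products
  have hzero : HasZeroObject (CategoryTheory.Quotient r) :=
    ⟨_, hQ.isZero_obj_I (Classical.choose (HasZeroObject.zero (C := 𝒜)))⟩
  let e : D.T ⋙ Quotient.functor r ≅
      Quotient.functor r ⋙ shiftFunctor (CategoryTheory.Quotient r) (1 : ℤ) :=
    Functor.isoWhiskerLeft (Quotient.functor r) j
  exact ⟨_, hzero, _, hshift, pretriangulated e hQ, isTriangulated e hQ, inferInstance, e, rfl⟩

end Quotient

end StableData

/-! ### Exact functors between stable categories -/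

section ExactFunctor

universe v₃ u₃

variable {C : Type u₁} [Category.{v₁} C] [Preadditive C] [HasZeroObject C] [HasShift C ℤ]
  [∀ n : ℤ, (shiftFunctor C n).Additive] [Pretriangulated C]
  {D : Type u₂} [Category.{v₂} D] [Preadditive D] [HasZeroObject D] [HasShift D ℤ]
  [∀ n : ℤ, (shiftFunctor D n).Additive] [Pretriangulated D]
  {E : Type u₃} [Category.{v₃} E] [Preadditive E] [HasZeroObject E] [HasShift E ℤ]
  [∀ n : ℤ, (shiftFunctor E n).Additive] [Pretriangulated E]

/-- A functor between triangulated categories is exact if it can be equipped with an isomorphism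
commuting it past the shift, such that it preserves distinguished triangles. -/
def IsExactFunctor (F : C ⥤ D) : Prop :=
  ∃ _ : F.CommShift ℤ, F.IsTriangulated

namespace IsExactFunctor

theorem additive {F : C ⥤ D} (hF : IsExactFunctor F) : F.Additive := by
  obtain ⟨_, _⟩ := hF
  infer_instance

theorem comp {F : C ⥤ D} (hF : IsExactFunctor F) {G : D ⥤ E} (hG : IsExactFunctor G) :
    IsExactFunctor (F ⋙ G) := by
  obtain ⟨_, _⟩ := hF
  obtain ⟨_, _⟩ := hG
  exact ⟨inferInstance, inferInstance⟩

end IsExactFunctor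

end ExactFunctor

namespace StableData

variable {𝒜 : Type u₁} [Category.{v₁} 𝒜] [Preadditive 𝒜] {ℬ : Type u₂} [Category.{v₂} ℬ]
  [Preadditive ℬ]

/-- A functor compatible with the embeddings `X ⟶ I X` up to null morphisms. -/
structure IsCompatible (D : StableData 𝒜) (D' : StableData ℬ) (F : 𝒜 ⥤ ℬ) : Prop where
  additive : F.Additive
  null_id_I : ∀ N, D'.Null (𝟙 (F.obj (D.I.obj N)))
  exists_extension : ∀ X, ∃ e : F.obj (D.I.obj X) ⟶ D'.I.obj (F.obj X),
    F.map (D.i X) ≫ e = D'.i (F.obj X)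
  isCokernel_map_p : ∀ X, IsCokernel (F.map (D.i X)) (F.map (D.p X))
  map_isPushout : ∀ {X Y Z : 𝒜} {f : X ⟶ Y} {v : Y ⟶ Z} {f' : D.I.obj X ⟶ Z},
    IsPushout f (D.i X) v f' → IsPushout (F.map f) (F.map (D.i X)) (F.map v) (F.map f')

namespace IsCompatible

variable {D : StableData 𝒜} {D' : StableData ℬ} {F : 𝒜 ⥤ ℬ} (hF : D.IsCompatible D' F)
include hF

theorem null_comp {X Y : ℬ} {N : 𝒜} (a : X ⟶ F.obj (D.I.obj N)) (b : F.obj (D.I.obj N) ⟶ Y) :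
    D'.Null (a ≫ b) := by
  simpa using ((hF.null_id_I N).comp_left a).comp_right b

theorem null_map {X Y : 𝒜} {f : X ⟶ Y} (hf : D.Null f) : D'.Null (F.map f) := by
  obtain ⟨N, a, b, rfl⟩ := hf
  rw [F.map_comp]
  exact hF.null_comp _ _

theorem exists_coextension (X : 𝒜) : ∃ e : D'.I.obj (F.obj X) ⟶ F.obj (D.I.obj X),
    D'.i (F.obj X) ≫ e = F.map (D.i X) := by
  rw [← null_iff]
  simpa using (hF.null_id_I X).comp_left (F.map (D.i X))

theorem exists_comparison (X : 𝒜) :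
    ∃ (θ : F.obj (D.T.obj X) ⟶ D'.T.obj (F.obj X)) (e : F.obj (D.I.obj X) ⟶ D'.I.obj (F.obj X)),
      F.map (D.i X) ≫ e = D'.i (F.obj X) ∧ F.map (D.p X) ≫ θ = e ≫ D'.p (F.obj X) := by
  obtain ⟨e, he⟩ := hF.exists_extension X
  obtain ⟨θ, hθ⟩ := (hF.isCokernel_map_p X).desc (e ≫ D'.p _) (by rw [reassoc_of% he, i_p])
  exact ⟨θ, e, he, hθ⟩

/-- The map `F (T X) ⟶ T' (F X)` induced by a chosen extension `F (I X) ⟶ I' (F X)`. -/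
def comparison (X : 𝒜) : F.obj (D.T.obj X) ⟶ D'.T.obj (F.obj X) := (hF.exists_comparison X).choose

theorem map_p_comp_comparison (X : 𝒜) : ∃ e : F.obj (D.I.obj X) ⟶ D'.I.obj (F.obj X),
    F.map (D.i X) ≫ e = D'.i (F.obj X) ∧ F.map (D.p X) ≫ hF.comparison X = e ≫ D'.p (F.obj X) :=
  (hF.exists_comparison X).choose_spec

theorem comparison_naturality {X Y : 𝒜} (f : X ⟶ Y) :
    D'.Null (F.map (D.T.map f) ≫ hF.comparison Y - hF.comparison X ≫ D'.T.map (F.map f)) := by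
  obtain ⟨e, he, hθ⟩ := hF.map_p_comp_comparison X
  obtain ⟨e₁, he₁, hθ₁⟩ := hF.map_p_comp_comparison Y
  have := (hF.isCokernel_map_p X).epi
  obtain ⟨h, hh⟩ := (hF.isCokernel_map_p X).desc
    (F.map (D.I.map f) ≫ e₁ - e ≫ D'.I.map (F.map f)) (by
      rw [Preadditive.comp_sub, reassoc_of% he, ← D'.i_naturality, ← F.map_comp_assoc,
        ← D.i_naturality, F.map_comp_assoc, he₁, sub_self])
  refine ⟨F.obj Y, h, D'.p _, ?_⟩
  rw [← cancel_epi (F.map (D.p X)), reassoc_of% hh, Preadditive.comp_sub, ← F.map_comp_assoc,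
    ← D.p_naturality, F.map_comp_assoc, hθ₁, reassoc_of% hθ, ← D'.p_naturality,
    Preadditive.sub_comp, Category.assoc, Category.assoc]

theorem exists_comparison_inverse (X : 𝒜) : ∃ θ' : D'.T.obj (F.obj X) ⟶ F.obj (D.T.obj X),
    D'.Null (hF.comparison X ≫ θ' - 𝟙 _) ∧ D'.Null (θ' ≫ hF.comparison X - 𝟙 _) := by
  obtain ⟨e, he, hθ⟩ := hF.map_p_comp_comparison X
  obtain ⟨e', he'⟩ := hF.exists_coextension X
  have := (hF.isCokernel_map_p X).epi
  obtain ⟨θ', hθ'⟩ := (D'.isCokernel_p _).desc (e' ≫ F.map (D.p X)) (by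
    rw [reassoc_of% he', (hF.isCokernel_map_p X).zero])
  refine ⟨θ', ?_, ?_⟩
  · obtain ⟨h, hh⟩ := (hF.isCokernel_map_p X).desc (e ≫ e' - 𝟙 _) (by
      rw [Preadditive.comp_sub, reassoc_of% he, he', Category.comp_id, sub_self])
    have factorization : hF.comparison X ≫ θ' - 𝟙 _ = h ≫ F.map (D.p X) := by
      rw [← cancel_epi (F.map (D.p X)), reassoc_of% hh, Preadditive.comp_sub, reassoc_of% hθ, hθ',
        Preadditive.sub_comp, Category.assoc, Category.id_comp, Category.comp_id]
    rw [factorization]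
    exact hF.null_comp _ _
  · obtain ⟨h, hh⟩ := (D'.isCokernel_p _).desc (e' ≫ e - 𝟙 _) (by
      rw [Preadditive.comp_sub, reassoc_of% he', he, Category.comp_id, sub_self])
    refine ⟨F.obj X, h, D'.p _, ?_⟩
    rw [← cancel_epi (D'.p _), reassoc_of% hh, Preadditive.comp_sub, reassoc_of% hθ', hθ,
      Preadditive.sub_comp, Category.assoc, Category.id_comp, Category.comp_id]

theorem exists_cone_comparison {X Y Z : 𝒜} {f : X ⟶ Y} {v : Y ⟶ Z} {w : Z ⟶ D.T.obj X}
    (h : D.IsCone f v w) {C : ℬ} {v' : F.obj Y ⟶ C} {w' : C ⟶ D'.T.obj (F.obj X)}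
    (h' : D'.IsCone (F.map f) v' w') :
    ∃ (c : F.obj Z ⟶ C) (c' : C ⟶ F.obj Z), F.map v ≫ c = v' ∧
      c ≫ w' = F.map w ≫ hF.comparison X ∧ D'.Null (c ≫ c' - 𝟙 _) ∧ D'.Null (c' ≫ c - 𝟙 _) := by
  have := hF.additive
  obtain ⟨g, hg, hvw, hgw⟩ := h
  obtain ⟨g', hg', hvw', hgw'⟩ := h'
  replace hg := hF.map_isPushout hg
  replace hvw : F.map v ≫ F.map w = 0 := by rw [← F.map_comp, hvw, F.map_zero]
  replace hgw : F.map g ≫ F.map w = F.map (D.p X) := by rw [← F.map_comp, hgw]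
  obtain ⟨e, he, hθ⟩ := hF.map_p_comp_comparison X
  obtain ⟨e', he'⟩ := hF.exists_coextension X
  obtain ⟨c, hvc, hgc⟩ := hg.exists_desc v' (e ≫ g') (by rw [reassoc_of% he, hg'.w])
  obtain ⟨c', hvc', hgc'⟩ := hg'.exists_desc (F.map v) (e' ≫ F.map g) (by
    rw [reassoc_of% he', hg.w])
  refine ⟨c, c', hvc, hg.hom_ext ?_ ?_, ?_, ?_⟩
  · rw [reassoc_of% hvc, hvw', reassoc_of% hvw, zero_comp]
  · rw [reassoc_of% hgc, hgw', reassoc_of% hgw, hθ]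
  · obtain ⟨h, hh⟩ := (hF.isCokernel_map_p X).desc (e ≫ e' - 𝟙 _) (by
      rw [Preadditive.comp_sub, reassoc_of% he, he', Category.comp_id, sub_self])
    have factorization : c ≫ c' - 𝟙 _ = (F.map w ≫ h) ≫ F.map g := by
      apply hg.hom_ext
      · rw [Category.assoc, reassoc_of% hvw, zero_comp, Preadditive.comp_sub, reassoc_of% hvc,
          hvc', Category.comp_id, sub_self]
      · rw [Category.assoc, reassoc_of% hgw, reassoc_of% hh, Preadditive.comp_sub,
          reassoc_of% hgc, hgc', Preadditive.sub_comp, Category.assoc, Category.id_comp,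
          Category.comp_id]
    rw [factorization]
    exact hF.null_comp _ _
  · obtain ⟨h, hh⟩ := (D'.isCokernel_p _).desc (e' ≫ e - 𝟙 _) (by
      rw [Preadditive.comp_sub, reassoc_of% he', he, Category.comp_id, sub_self])
    refine ⟨F.obj X, w' ≫ h, g', hg'.hom_ext ?_ ?_⟩
    · rw [Category.assoc, reassoc_of% hvw', zero_comp, Preadditive.comp_sub, reassoc_of% hvc',
        hvc, Category.comp_id, sub_self]
    · rw [Category.assoc, reassoc_of% hgw', reassoc_of% hh, Preadditive.comp_sub,
        reassoc_of% hgc', hgc, Preadditive.sub_comp, Category.assoc, Category.id_comp,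
        Category.comp_id]

universe v₃ u₃

section Induced

variable {E' : Type u₃} [Category.{v₃} E'] {Q' : ℬ ⥤ E'} (hQ' : D'.IsStableQuotient Q')
include hQ'

def comparisonIso : D.T ⋙ F ⋙ Q' ≅ F ⋙ D'.T ⋙ Q' :=
  NatIso.ofComponents (fun X => hQ'.mapIso (hF.comparison X)
    (hF.exists_comparison_inverse X).choose (hF.exists_comparison_inverse X).choose_spec.1
    (hF.exists_comparison_inverse X).choose_spec.2) (fun {X Y} f => by
      change Q'.map (F.map (D.T.map f)) ≫ Q'.map (hF.comparison Y) =
        Q'.map (hF.comparison X) ≫ Q'.map (D'.T.map (F.map f))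
      rw [← Q'.map_comp, ← Q'.map_comp, hQ'.map_eq_iff]
      exact hF.comparison_naturality f)

theorem map_mem_coneTriangles [HasShift E' ℤ] (e' : D'.T ⋙ Q' ≅ Q' ⋙ shiftFunctor E' (1 : ℤ))
    {X Y Z : 𝒜} {f : X ⟶ Y} {v : Y ⟶ Z} {w : Z ⟶ D.T.obj X} (h : D.IsCone f v w) :
    Triangle.mk (Q'.map (F.map f)) (Q'.map (F.map v))
      (Q'.map (F.map w) ≫ Q'.map (hF.comparison X) ≫ e'.hom.app (F.obj X)) ∈
        coneTriangles e' := by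
  obtain ⟨C, v', w', h'⟩ := D'.exists_isCone (F.map f)
  obtain ⟨c, c', hvc, hcw, hcc', hc'c⟩ := hF.exists_cone_comparison h h'
  refine mem_coneTriangles_of_iso e' (h'.mem_coneTriangles e')
    (triangleMkIso (Iso.refl _) (Iso.refl _) (hQ'.mapIso c c' hcc' hc'c) ?_ ?_ ?_)
  · simp
  · change Q'.map _ ≫ Q'.map c = 𝟙 _ ≫ _
    rw [← Q'.map_comp, hvc, Category.id_comp]
  · change _ ≫ (𝟙 _)⟦(1 : ℤ)⟧' = Q'.map c ≫ _ ≫ _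
    rw [CategoryTheory.Functor.map_id, Category.comp_id, ← Q'.map_comp_assoc, ← hcw,
      Q'.map_comp_assoc]

variable {r : HomRel 𝒜} (hr : ∀ {X Y : 𝒜} (f g : X ⟶ Y), r f g ↔ D.Null (f - g))
include hr

/-- The functor induced on the stable categories. -/
def stableFunctor : CategoryTheory.Quotient r ⥤ E' :=
  CategoryTheory.Quotient.lift r (F ⋙ Q') (fun X Y f g h => by
    have := hF.additive
    rw [Functor.comp_map, Functor.comp_map, hQ'.map_eq_iff, ← F.map_sub]
    exact hF.null_map ((hr f g).1 h))

variable [HasShift (CategoryTheory.Quotient r) ℤ] [HasShift E' ℤ]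
  (e : D.T ⋙ Quotient.functor r ≅
    Quotient.functor r ⋙ shiftFunctor (CategoryTheory.Quotient r) (1 : ℤ))
  (e' : D'.T ⋙ Q' ≅ Q' ⋙ shiftFunctor E' (1 : ℤ))

def shiftIso : shiftFunctor _ (1 : ℤ) ⋙ hF.stableFunctor hQ' hr ≅
    hF.stableFunctor hQ' hr ⋙ shiftFunctor _ (1 : ℤ) :=
  Quotient.natIsoLift r (Functor.isoWhiskerRight e.symm (hF.stableFunctor hQ' hr) ≪≫
    hF.comparisonIso hQ' ≪≫ Functor.isoWhiskerLeft F e')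

theorem map_app_comp_shiftIso_hom_app (X : 𝒜) :
    (hF.stableFunctor hQ' hr).map (e.hom.app X) ≫
      (hF.shiftIso hQ' hr e e').hom.app ((Quotient.functor r).obj X) =
    Q'.map (hF.comparison X) ≫ e'.hom.app (F.obj X) := by
  change _ ≫ (hF.stableFunctor hQ' hr).map (e.inv.app X) ≫ Q'.map (hF.comparison X) ≫
    e'.hom.app (F.obj X) = _
  rw [← Functor.map_comp_assoc, Iso.hom_inv_id_app, CategoryTheory.Functor.map_id]
  exact Category.id_comp _

end Induced

theorem isExactFunctor_stableFunctor {E' : Type u₃} [Category.{v₃} E'] {Q' : ℬ ⥤ E'}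
    (hQ' : D'.IsStableQuotient Q') {r : HomRel 𝒜}
    (hr : ∀ {X Y : 𝒜} (f g : X ⟶ Y), r f g ↔ D.Null (f - g))
    [Preadditive (CategoryTheory.Quotient r)] [HasZeroObject (CategoryTheory.Quotient r)]
    [HasShift (CategoryTheory.Quotient r) ℤ]
    [∀ n : ℤ, (shiftFunctor (CategoryTheory.Quotient r) n).Additive]
    [Pretriangulated (CategoryTheory.Quotient r)]
    [Preadditive E'] [HasZeroObject E'] [HasShift E' ℤ]
    [∀ n : ℤ, (shiftFunctor E' n).Additive] [Pretriangulated E']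
    (h : D.IsTriangulation (Quotient.functor r)) (h' : D'.IsTriangulation Q') :
    IsExactFunctor (hF.stableFunctor hQ' hr) := by
  obtain ⟨-, -, e, he⟩ := h
  obtain ⟨-, -, e', he'⟩ := h'
  let G := hF.stableFunctor hQ' hr
  let := commShiftOfOne (hF.shiftIso hQ' hr e e')
  refine ⟨inferInstance, ⟨fun t ht => ?_⟩⟩
  rw [he] at ht
  obtain ⟨X, Y, Z, f, v, w, hc, ⟨j⟩⟩ := ht
  have third_morphism : G.map ((Quotient.functor r).map w ≫ e.hom.app X) ≫
      (G.commShiftIso (1 : ℤ)).hom.app ((Quotient.functor r).obj X) =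
      Q'.map (F.map w) ≫ Q'.map (hF.comparison X) ≫ e'.hom.app (F.obj X) := by
    rw [G.map_comp, Category.assoc]
    refine congrArg (Q'.map (F.map w) ≫ ·) ?_
    rw [← hF.map_app_comp_shiftIso_hom_app hQ' hr e e' X]
    have commShiftIso_one : G.commShiftIso (1 : ℤ) = hF.shiftIso hQ' hr e e' :=
      commShiftIsoOfOne_one _
    rw [commShiftIso_one]
  refine isomorphic_distinguished _ ?_ _ (G.mapTriangle.mapIso j)
  rw [he']
  have mem := hF.map_mem_coneTriangles hQ' e' hc
  rw [← third_morphism] at mem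
  exact mem

end IsCompatible

end StableData

section TensorProducts

variable (k : Type u) {H A : Type u} [Field k] [Ring H] [HopfAlgebra k H] [Ring A] [Algebra k A]
  [LeftComoduleAlgebra k H A]

/-- The orbit map `a ↦ a • m` of an element of a module over a `k`-algebra, as a `k`-linear map. -/
def orbitMap {R : Type u} [Ring R] [Algebra k R] (M : ModuleCat.{u} R) (m : M) : R →ₗ[k] M :=
  (LinearMap.toSpanSingleton R M m).restrictScalars k

@[simp]
theorem orbitMap_apply {R : Type u} [Ring R] [Algebra k R] (M : ModuleCat.{u} R) (m : M) (a : R) :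
    orbitMap k M m a = a • m := rfl

def tensorEquiv (V : ModuleCat.{u} H) (M : ModuleCat.{u} A) :
    V ⊗[k] M ≃ₗ[k] (tensorObj k V M : ModuleCat.{u} A) :=
  { toTensorObj k V M with
    invFun := fun x => x
    left_inv := fun _ => rfl
    right_inv := fun _ => rfl }

/-- The element `v ⊗ m` of the module `V ⊗ M`. -/
def pureTensor (V : ModuleCat.{u} H) (M : ModuleCat.{u} A) (v : V) (m : M) : tensorObj k V M :=
  tensorEquiv k V M (v ⊗ₜ m)

variable {V W U : ModuleCat.{u} H} {M N : ModuleCat.{u} A}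

theorem tensorObj_induction {p : tensorObj k V M → Prop} (x : tensorObj k V M) (zero : p 0)
    (pure : ∀ v m, p (pureTensor k V M v m)) (add : ∀ x y, p x → p y → p (x + y)) : p x :=
  TensorProduct.induction_on (motive := p) x zero pure add

theorem smul_tensorEquiv (a : A) (x : V ⊗[k] M) :
    a • tensorEquiv k V M x = tensorEquiv k V M (HTensor.rep k V M a x) := rfl

theorem rep_tmul (a : A) (v : V) (m : M) : HTensor.rep k V M a (v ⊗ₜ m) =
    TensorProduct.map (orbitMap k V v) (orbitMap k M m)
      (LeftComoduleAlgebra.coact (k := k) (H := H) a) := by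
  simp only [HTensor.rep, AlgHom.comp_apply]
  generalize LeftComoduleAlgebra.coact (k := k) (H := H) a = t
  induction t with
  | zero => simp
  | add s t hs ht => simp only [map_add, LinearMap.add_apply, hs, ht]
  | tmul h b =>
    simp only [Algebra.TensorProduct.map_tmul, Module.endTensorEndAlgHom_apply]
    simp

theorem smul_pureTensor (a : A) (v : V) (m : M) : a • pureTensor k V M v m =
    tensorEquiv k V M (TensorProduct.map (orbitMap k V v) (orbitMap k M m)
      (LeftComoduleAlgebra.coact (k := k) (H := H) a)) := by
  rw [pureTensor, smul_tensorEquiv, rep_tmul]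

/-- A linear map `V ⊗ M → N` is equivariant if it is linear over `A` for the action on `V ⊗ M`
through the coaction. -/
def IsEquivariant (f : V ⊗[k] M →ₗ[k] N) : Prop :=
  ∀ (a : A) (v : V) (m : M), f (TensorProduct.map (orbitMap k V v) (orbitMap k M m)
    (LeftComoduleAlgebra.coact (k := k) (H := H) a)) = a • f (v ⊗ₜ m)

variable {k} in
/-- The `A`-linear map out of a tensor product given by an equivariant linear map. -/
def tensorDescLinear {f : V ⊗[k] M →ₗ[k] N} (hf : IsEquivariant k f) :
    tensorObj k V M →ₗ[A] N where
  toFun x := f ((tensorEquiv k V M).symm x)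
  map_add' x y := by rw [map_add, map_add]
  map_smul' a x := by
    induction x using tensorObj_induction k with
    | zero => simp
    | add x y hx hy => simp only [smul_add, map_add, hx, hy]
    | pure v m =>
      rw [smul_pureTensor, LinearEquiv.symm_apply_apply, hf, pureTensor,
        LinearEquiv.symm_apply_apply, RingHom.id_apply]

theorem tensorObj_hom_ext {f g : tensorObj k V M ⟶ N}
    (h : ∀ v m, f (pureTensor k V M v m) = g (pureTensor k V M v m)) : f = g := by
  ext x
  induction x using tensorObj_induction k with
  | zero => simp
  | add x y hx hy => simp only [map_add, hx, hy]
  | pure v m => exact h v m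

@[simp]
theorem tensorMap_pureTensor (f : V ⟶ W) (g : M ⟶ N) (v : V) (m : M) :
    tensorMap k f g (pureTensor k V M v m) = pureTensor k W N (f v) (g m) := rfl

theorem pureTensor_add (v : V) (m m' : M) :
    pureTensor k V M v (m + m') = pureTensor k V M v m + pureTensor k V M v m' := by
  simp only [pureTensor, TensorProduct.tmul_add, map_add]

theorem add_pureTensor (v v' : V) (m : M) :
    pureTensor k V M (v + v') m = pureTensor k V M v m + pureTensor k V M v' m := by
  simp only [pureTensor, TensorProduct.add_tmul, map_add]

theorem zero_pureTensor (m : M) : pureTensor k V M 0 m = 0 := by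
  rw [pureTensor, TensorProduct.zero_tmul, map_zero]

theorem tensorMap_comp_id (f : V ⟶ W) (f' : W ⟶ U) (M : ModuleCat.{u} A) :
    tensorMap k (f ≫ f') (𝟙 M) = tensorMap k f (𝟙 M) ≫ tensorMap k f' (𝟙 M) :=
  tensorObj_hom_ext k fun _ _ => by simp

theorem tensorMap_id_id (V : ModuleCat.{u} H) (M : ModuleCat.{u} A) :
    tensorMap k (𝟙 V) (𝟙 M) = 𝟙 (tensorObj k V M) :=
  tensorObj_hom_ext k fun _ _ => by simp

theorem tensorMap_exchange (f : V ⟶ W) (g : M ⟶ N) :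
    tensorMap k f (𝟙 M) ≫ tensorMap k (𝟙 W) g = tensorMap k (𝟙 V) g ≫ tensorMap k f (𝟙 N) :=
  tensorObj_hom_ext k fun _ _ => by simp

theorem tensorMap_add_left (f f' : V ⟶ W) (g : M ⟶ N) :
    tensorMap k (f + f') g = tensorMap k f g + tensorMap k f' g :=
  tensorObj_hom_ext k fun _ _ => by simp [add_pureTensor]

theorem tensorMap_add_right (f : V ⟶ W) (g g' : M ⟶ N) :
    tensorMap k f (g + g') = tensorMap k f g + tensorMap k f g' :=
  tensorObj_hom_ext k fun _ _ => by simp [pureTensor_add]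

variable {k} in
def tensorLinearEquiv {f : V ⊗[k] M ≃ₗ[k] N} (hf : IsEquivariant k f.toLinearMap) :
    tensorObj k V M ≃ₗ[A] N :=
  { tensorDescLinear hf with
    invFun := fun n => tensorEquiv k V M (f.symm n)
    left_inv := f.left_inv
    right_inv := f.right_inv }

variable {k} in
/-- The isomorphism out of a tensor product given by an equivariant linear equivalence. -/
def tensorIso {f : V ⊗[k] M ≃ₗ[k] N} (hf : IsEquivariant k f.toLinearMap) : tensorObj k V M ≅ N :=
  (tensorLinearEquiv hf).toModuleIso

def assocEquiv (V W : ModuleCat.{u} H) (M : ModuleCat.{u} A) :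
    (tensorObj k V W : ModuleCat.{u} H) ⊗[k] M ≃ₗ[k]
      (tensorObj k V (tensorObj k W M) : ModuleCat.{u} A) :=
  TensorProduct.congr (tensorEquiv k V W).symm (LinearEquiv.refl k M) ≪≫ₗ
    TensorProduct.assoc k V W M ≪≫ₗ
    TensorProduct.congr (LinearEquiv.refl k V) (tensorEquiv k W M) ≪≫ₗ
    tensorEquiv k V (tensorObj k W M)

theorem assocEquiv_tmul (v : V) (w : W) (m : M) :
    assocEquiv k V W M (pureTensor k V W v w ⊗ₜ m) =
      pureTensor k V (tensorObj k W M) v (pureTensor k W M w m) := rfl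

theorem assocEquiv_map_orbitMap (v : V) (w : W) (m : M) (t : H ⊗[k] A) :
    assocEquiv k V W M
        (TensorProduct.map (orbitMap k (tensorObj k V W) (pureTensor k V W v w))
          (orbitMap k M m) t) =
      tensorEquiv k V (tensorObj k W M) (TensorProduct.map (orbitMap k V v)
        ((tensorEquiv k W M).toLinearMap ∘ₗ TensorProduct.map (orbitMap k W w) (orbitMap k M m))
        (TensorProduct.assoc k H H A ((Coalgebra.comul (R := k) (A := H)).rTensor A t))) := by
  induction t with
  | zero => simp
  | add x y hx hy => simp only [map_add, hx, hy]
  | tmul h b =>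
    rw [TensorProduct.map_tmul, orbitMap_apply, smul_pureTensor, LinearMap.rTensor_tmul]
    change assocEquiv k V W M (tensorEquiv k V W (TensorProduct.map _ _
      (Coalgebra.comul (R := k) h)) ⊗ₜ _) = _
    generalize Coalgebra.comul (R := k) h = s
    induction s with
    | zero => simp
    | add x y hx hy => simp only [map_add, TensorProduct.add_tmul, hx, hy]
    | tmul x y => rfl

theorem tensorEquiv_map_lTensor_coact (v : V) (w : W) (m : M) (t : H ⊗[k] A) :
    tensorEquiv k V (tensorObj k W M) (TensorProduct.map (orbitMap k V v)
        ((tensorEquiv k W M).toLinearMap ∘ₗ TensorProduct.map (orbitMap k W w) (orbitMap k M m))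
        ((LeftComoduleAlgebra.coact (k := k) (H := H) (A := A)).toLinearMap.lTensor H t)) =
      tensorEquiv k V (tensorObj k W M) (TensorProduct.map (orbitMap k V v)
        (orbitMap k (tensorObj k W M) (pureTensor k W M w m)) t) := by
  induction t with
  | zero => simp
  | add x y hx hy => simp only [map_add, hx, hy]
  | tmul h b =>
    rw [LinearMap.lTensor_tmul, TensorProduct.map_tmul, TensorProduct.map_tmul, orbitMap_apply,
      orbitMap_apply, smul_pureTensor]
    rfl

theorem isEquivariant_assocEquiv (V W : ModuleCat.{u} H) (M : ModuleCat.{u} A) :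
    IsEquivariant k (assocEquiv k V W M).toLinearMap := by
  intro a x m
  induction x using tensorObj_induction k with
  | zero => simp [orbitMap]
  | add x y hx hy =>
    have orbitMap_add : orbitMap k (tensorObj k V W) (x + y) =
        orbitMap k (tensorObj k V W) x + orbitMap k (tensorObj k V W) y := by ext; simp
    rw [orbitMap_add, TensorProduct.map_add_left, LinearMap.add_apply, map_add, hx, hy,
      TensorProduct.add_tmul, map_add, smul_add]
  | pure v w =>
    rw [LinearEquiv.coe_coe, assocEquiv_map_orbitMap, LeftComoduleAlgebra.coassoc_coact,
      tensorEquiv_map_lTensor_coact, assocEquiv_tmul, smul_pureTensor]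

/-- The associativity isomorphism `(V ⊗ W) ⊗ M ≅ V ⊗ (W ⊗ M)`. -/
def assocIso (V W : ModuleCat.{u} H) (M : ModuleCat.{u} A) :
    tensorObj k (tensorObj k V W) M ≅ tensorObj k V (tensorObj k W M) :=
  tensorIso (isEquivariant_assocEquiv k V W M)

theorem tensorObj_hom_ext₃ {f g : tensorObj k (tensorObj k V W) M ⟶ N}
    (h : ∀ v w m, f (pureTensor k (tensorObj k V W) M (pureTensor k V W v w) m) =
      g (pureTensor k (tensorObj k V W) M (pureTensor k V W v w) m)) : f = g :=
  tensorObj_hom_ext k fun x m => by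
    induction x using tensorObj_induction k with
    | zero => simp only [zero_pureTensor, map_zero]
    | add x y hx hy => simp only [add_pureTensor, map_add, hx, hy]
    | pure v w => exact h v w m

def trivialEquiv : trivialModule k H ≃ₗ[k] k where
  toFun c := c
  map_add' _ _ := rfl
  map_smul' c x := by
    change Coalgebra.counit (R := k) (algebraMap k H c) * _ = c * _
    rw [Bialgebra.counit_algebraMap]
  invFun c := c
  left_inv _ := rfl
  right_inv _ := rfl

theorem isEquivariant_lid (M : ModuleCat.{u} A) :
    IsEquivariant k (V := trivialModule k H) (TensorProduct.congr (trivialEquiv k)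
      (LinearEquiv.refl k M) ≪≫ₗ TensorProduct.lid k M).toLinearMap := by
  intro a c m
  have apply_orbitMap : ∀ t : H ⊗[k] A,
      (TensorProduct.congr (trivialEquiv k) (LinearEquiv.refl k M) ≪≫ₗ TensorProduct.lid k M)
        (TensorProduct.map (orbitMap k (trivialModule k H) c) (orbitMap k M m) t) =
      trivialEquiv k c • (TensorProduct.lid k A
        ((Coalgebra.counit (R := k) (A := H)).rTensor A t)) • m := by
    intro t
    induction t with
    | zero => simp
    | add x y hx hy => simp only [map_add, hx, hy, add_smul, smul_add]
    | tmul h b =>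
      change (Coalgebra.counit (R := k) h * trivialEquiv k c) • b • m = _
      simp [smul_smul, mul_comm]
  rw [LinearEquiv.coe_coe, apply_orbitMap, LeftComoduleAlgebra.counit_coact]
  change _ = a • trivialEquiv k c • m
  rw [smul_comm]

/-- The unit isomorphism `k ⊗ M ≅ M`. -/
def leftUnitIso (M : ModuleCat.{u} A) : tensorObj k (trivialModule k H) M ≅ M :=
  tensorIso (isEquivariant_lid k M)

theorem coact_self (a : H) : LeftComoduleAlgebra.coact (k := k) (H := H) a =
    Coalgebra.comul (R := k) a := rfl

theorem isEquivariant_rid (V : ModuleCat.{u} H) :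
    IsEquivariant k (M := trivialModule k H) (TensorProduct.congr (LinearEquiv.refl k V)
      (trivialEquiv k) ≪≫ₗ TensorProduct.rid k V).toLinearMap := by
  intro a v c
  have apply_orbitMap : ∀ t : H ⊗[k] H,
      (TensorProduct.congr (LinearEquiv.refl k V) (trivialEquiv k) ≪≫ₗ TensorProduct.rid k V)
        (TensorProduct.map (orbitMap k V v) (orbitMap k (trivialModule k H) c) t) =
      trivialEquiv k c • (TensorProduct.rid k H
        ((Coalgebra.counit (R := k) (A := H)).lTensor H t)) • v := by
    intro t
    induction t with
    | zero => simp
    | add x y hx hy => simp only [map_add, hx, hy, add_smul, smul_add]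
    | tmul b h =>
      change (Coalgebra.counit (R := k) h * trivialEquiv k c) • b • v = _
      simp [smul_smul, mul_comm]
  rw [LinearEquiv.coe_coe, apply_orbitMap, coact_self]
  simp [smul_comm a]

/-- The unit isomorphism `V ⊗ k ≅ V`. -/
def rightUnitIso (V : ModuleCat.{u} H) : tensorObj k V (trivialModule k H) ≅ V :=
  tensorIso (isEquivariant_rid k V)

end TensorProducts

section FreeModules

open LinearMap WithConv

variable (k : Type u) {H : Type u} [Field k] [Ring H] [HopfAlgebra k H]

/-- The linear map `h ⊗ v ↦ ∑ h₍₁₎ ⊗ s(h₍₂₎) v`. -/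
def twistMap (V : ModuleCat.{u} H) (s : WithConv (H →ₗ[k] H)) : H ⊗[k] V →ₗ[k] H ⊗[k] V :=
  (TensorProduct.lift (Algebra.lsmul k k V).toLinearMap).lTensor H ∘ₗ
    (TensorProduct.assoc k H H V).toLinearMap ∘ₗ (s.ofConv.lTensor H ∘ₗ Coalgebra.comul).rTensor V

theorem twistMap_tmul {V : ModuleCat.{u} H} (s : WithConv (H →ₗ[k] H)) (h : H) (v : V) :
    twistMap k V s (h ⊗ₜ v) =
      (orbitMap k V v ∘ₗ s.ofConv).lTensor H (Coalgebra.comul (R := k) h) := by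
  simp only [twistMap, LinearMap.comp_apply, LinearMap.rTensor_tmul]
  generalize Coalgebra.comul (R := k) h = t
  induction t with
  | zero => simp
  | add x y hx hy => simp only [map_add, TensorProduct.add_tmul, hx, hy]
  | tmul x y => rfl

theorem twistMap_lTensor_orbitMap {V : ModuleCat.{u} H} (s t : WithConv (H →ₗ[k] H)) (v : V)
    (z : H ⊗[k] H) : twistMap k V s ((orbitMap k V v ∘ₗ t.ofConv).lTensor H z) =
      (orbitMap k V v ∘ₗ LinearMap.mul' k H ∘ₗ TensorProduct.map s.ofConv t.ofConv).lTensor H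
        (TensorProduct.assoc k H H H ((Coalgebra.comul (R := k) (A := H)).rTensor H z)) := by
  induction z with
  | zero => simp
  | add x y hx hy => simp only [map_add, hx, hy]
  | tmul x y =>
    rw [LinearMap.lTensor_tmul, twistMap_tmul, LinearMap.rTensor_tmul]
    generalize Coalgebra.comul (R := k) x = w
    induction w with
    | zero => simp
    | add x y hx hy => simp only [map_add, TensorProduct.add_tmul, hx, hy]
    | tmul a b => simp [smul_smul]

theorem twistMap_mul (V : ModuleCat.{u} H) (s t : WithConv (H →ₗ[k] H)) :
    twistMap k V (s * t) = twistMap k V s ∘ₗ twistMap k V t := by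
  refine TensorProduct.ext' fun h v => ?_
  rw [LinearMap.comp_apply, twistMap_tmul, twistMap_tmul, twistMap_lTensor_orbitMap,
    Coalgebra.coassoc_apply, ← LinearMap.lTensor_comp_apply]
  rfl

theorem twistMap_one (V : ModuleCat.{u} H) : twistMap k V 1 = LinearMap.id := by
  refine TensorProduct.ext' fun h v => ?_
  have lTensor_orbitMap : ∀ z : H ⊗[k] H,
      (orbitMap k V v ∘ₗ (1 : WithConv (H →ₗ[k] H)).ofConv).lTensor H z =
      TensorProduct.rid k H ((Coalgebra.counit (R := k) (A := H)).lTensor H z) ⊗ₜ v := by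
    intro z
    induction z with
    | zero => simp
    | add x y hx hy => simp only [map_add, TensorProduct.add_tmul, hx, hy]
    | tmul x y =>
      simp only [LinearMap.lTensor_tmul, TensorProduct.rid_tmul, LinearMap.comp_apply,
        orbitMap_apply, LinearMap.convOne_apply, TensorProduct.smul_tmul]
      rw [algebraMap_smul]
  rw [twistMap_tmul, lTensor_orbitMap]
  simp

variable (H) in
def regularEquiv : H ≃ₗ[k] regular H where
  toFun := toRegular
  invFun h := h
  left_inv _ := rfl
  right_inv _ := rfl
  map_add' _ _ := rfl
  map_smul' c h := Algebra.smul_def c h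

def regularTensorEquiv (V : ModuleCat.{u} H) :
    H ⊗[k] V ≃ₗ[k] (tensorObj k (regular H) V : ModuleCat.{u} H) :=
  TensorProduct.congr (regularEquiv k H) (LinearEquiv.refl k V) ≪≫ₗ tensorEquiv k (regular H) V

theorem regularTensorEquiv_tmul {V : ModuleCat.{u} H} (h : H) (v : V) :
    regularTensorEquiv k V (h ⊗ₜ v) = pureTensor k (regular H) V (toRegular h) v := rfl

theorem smul_regularTensorEquiv {V : ModuleCat.{u} H} (a : H) (v : V) (z : H ⊗[k] H) :
    a • regularTensorEquiv k V ((orbitMap k V v).lTensor H z) =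
      regularTensorEquiv k V ((orbitMap k V v).lTensor H (Coalgebra.comul (R := k) a * z)) := by
  induction z with
  | zero => simp
  | add x y hx hy => simp only [map_add, smul_add, mul_add, hx, hy]
  | tmul x y =>
    rw [LinearMap.lTensor_tmul, regularTensorEquiv_tmul, smul_pureTensor, coact_self]
    generalize Coalgebra.comul (R := k) a = t
    induction t with
    | zero => simp
    | add x y hx hy => simp only [map_add, add_mul, hx, hy]
    | tmul p q =>
      rw [Algebra.TensorProduct.tmul_mul_tmul, LinearMap.lTensor_tmul,
        orbitMap_apply k V v (q * y), mul_smul]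
      rfl

/-- The isomorphism `h ⊗ v ↦ ∑ h₍₁₎ ⊗ h₍₂₎ v` from the module induced from the vector space `V` to
the tensor product `H ⊗ V`, which is therefore free. -/
def inducedEquiv (V : ModuleCat.{u} H) : H ⊗[k] V ≃ₗ[H] tensorObj k (regular H) V where
  toFun x := regularTensorEquiv k V (twistMap k V (toConv LinearMap.id) x)
  map_add' x y := by rw [map_add, map_add]
  map_smul' a x := by
    induction x with
    | zero => simp
    | add x y hx hy => simp only [smul_add, map_add, hx, hy]
    | tmul h v =>
      rw [TensorProduct.smul_tmul', twistMap_tmul, twistMap_tmul, smul_eq_mul,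
        Bialgebra.comul_mul, RingHom.id_apply]
      exact (smul_regularTensorEquiv k a v _).symm
  invFun x := twistMap k V (toConv (HopfAlgebra.antipode k)) ((regularTensorEquiv k V).symm x)
  left_inv x := by
    beta_reduce
    rw [LinearEquiv.symm_apply_apply, ← LinearMap.comp_apply, ← twistMap_mul, antipode_mul_id,
      twistMap_one, LinearMap.id_apply]
  right_inv x := by
    beta_reduce
    rw [← LinearMap.comp_apply (twistMap k V _), ← twistMap_mul, id_mul_antipode, twistMap_one,
      LinearMap.id_apply, LinearEquiv.apply_symm_apply]

theorem projective_regular_tensorObj (V : ModuleCat.{u} H) :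
    Projective (tensorObj k (regular H) V) :=
  have := Module.Projective.of_equiv (inducedEquiv k V)
  (IsProjective.iff_projective (tensorObj k (regular H) V)).1 this

end FreeModules

section CoinducedModules

open LinearMap WithConv

variable (k : Type u) {H : Type u} [Field k] [Ring H] [HopfAlgebra k H]

variable (H) in
/-- The `H`-module coinduced from the vector space `V`: the space of linear maps `H → V`, with
`(a F)(x) = F(x a)`. -/
def coinduced (V : Type u) [AddCommGroup V] [Module k V] : ModuleCat.{u} H :=
  (ModuleCat.coextendScalars (algebraMap k H)).obj (ModuleCat.of k V)

variable (H) in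
def coinducedEquiv (V : Type u) [AddCommGroup V] [Module k V] :
    (H →ₗ[k] V) ≃ₗ[k] coinduced k H V where
  toFun F := (ModuleCat.CoextendScalars.equiv (algebraMap k H) (ModuleCat.of k V)).symm
    { toFun := fun x : H => F x
      map_add' := F.map_add
      map_smul' := fun c (x : H) =>
        (congrArg F (Algebra.smul_def c x).symm).trans (F.map_smul c x) }
  invFun F :=
    { toFun := fun x : H =>
        ModuleCat.CoextendScalars.equiv (algebraMap k H) (ModuleCat.of k V) F x
      map_add' := (ModuleCat.CoextendScalars.equiv (algebraMap k H) (ModuleCat.of k V) F).map_add'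
      map_smul' := fun c x => (congrArg _ (Algebra.smul_def c x)).trans
        ((ModuleCat.CoextendScalars.equiv (algebraMap k H) (ModuleCat.of k V) F).map_smul' c x) }
  left_inv _ := rfl
  right_inv _ := rfl
  map_add' _ _ := rfl
  map_smul' c F := ModuleCat.CoextendScalars.ext <| LinearMap.ext fun x : H => by
    change c • F x = F (x * algebraMap k H c)
    rw [← Algebra.commutes, ← Algebra.smul_def, map_smul]

theorem smul_coinducedEquiv {V : Type u} [AddCommGroup V] [Module k V] (a : H) (F : H →ₗ[k] V) :
    a • coinducedEquiv k H V F = coinducedEquiv k H V (F ∘ₗ LinearMap.mulRight k a) := rfl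

instance injective_coinduced (V : Type u) [AddCommGroup V] [Module k V] :
    Injective (coinduced k H V) :=
  (ModuleCat.restrictCoextendScalarsAdj (algebraMap k H)).map_injective _
    (Module.injective_object_of_injective_module k V
      (inj := Module.injective_of_isSemisimpleRing k V))

/-- The linear map sending `F : H → V` to `x ↦ ∑ s(x₍₁₎) F(x₍₂₎)`. -/
def cotwistMap (V : ModuleCat.{u} H) (s : WithConv (H →ₗ[k] H)) :
    (H →ₗ[k] V) →ₗ[k] (H →ₗ[k] V) where
  toFun F := TensorProduct.lift (Algebra.lsmul k k V).toLinearMap ∘ₗ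
    TensorProduct.map s.ofConv F ∘ₗ Coalgebra.comul
  map_add' F G := by
    rw [TensorProduct.map_add_right, LinearMap.add_comp, LinearMap.comp_add]
  map_smul' c F := by
    rw [TensorProduct.map_smul_right, LinearMap.smul_comp, LinearMap.comp_smul]; rfl

theorem cotwistMap_apply {V : ModuleCat.{u} H} (s : WithConv (H →ₗ[k] H)) (F : H →ₗ[k] V) (h : H) :
    cotwistMap k V s F h = TensorProduct.lift (Algebra.lsmul k k V).toLinearMap
      (TensorProduct.map s.ofConv F (Coalgebra.comul (R := k) h)) := rfl

theorem lift_lsmul_map_mul {V : ModuleCat.{u} H} (s t : WithConv (H →ₗ[k] H)) (F : H →ₗ[k] V)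
    (z : H ⊗[k] H) : TensorProduct.lift (Algebra.lsmul k k V).toLinearMap
      (TensorProduct.map (s * t).ofConv F z) =
    TensorProduct.lift (Algebra.lsmul k k V).toLinearMap (TensorProduct.map s.ofConv
      (TensorProduct.lift (Algebra.lsmul k k V).toLinearMap ∘ₗ TensorProduct.map t.ofConv F)
        (TensorProduct.assoc k H H H ((Coalgebra.comul (R := k) (A := H)).rTensor H z))) := by
  induction z with
  | zero => simp
  | add x y hx hy => simp only [map_add, hx, hy]
  | tmul x y =>
    simp only [LinearMap.convMul_def, TensorProduct.map_tmul, LinearMap.comp_apply,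
      LinearMap.rTensor_tmul]
    generalize Coalgebra.comul (R := k) x = w
    induction w with
    | zero => simp
    | add x y hx hy => simp only [map_add, TensorProduct.add_tmul, hx, hy]
    | tmul a b => simp

theorem cotwistMap_mul (V : ModuleCat.{u} H) (s t : WithConv (H →ₗ[k] H)) :
    cotwistMap k V (s * t) = cotwistMap k V s ∘ₗ cotwistMap k V t := by
  ext F h
  rw [LinearMap.comp_apply, cotwistMap_apply, cotwistMap_apply, lift_lsmul_map_mul,
    Coalgebra.coassoc_apply, LinearMap.lTensor_def, ← LinearMap.comp_apply
      (TensorProduct.map _ _) (TensorProduct.map _ _), ← TensorProduct.map_comp]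
  rfl

theorem cotwistMap_one (V : ModuleCat.{u} H) : cotwistMap k V 1 = LinearMap.id := by
  ext F h
  have lift_lsmul_map_one : ∀ z : H ⊗[k] H, TensorProduct.lift (Algebra.lsmul k k V).toLinearMap
      (TensorProduct.map (1 : WithConv (H →ₗ[k] H)).ofConv F z) =
      F (TensorProduct.lid k H ((Coalgebra.counit (R := k) (A := H)).rTensor H z)) := by
    intro z
    induction z with
    | zero => simp
    | add x y hx hy => simp only [map_add, hx, hy]
    | tmul x y => simp
  rw [cotwistMap_apply, lift_lsmul_map_one]
  simp

/-- The automorphism `F ↦ (x ↦ ∑ x₍₁₎ F(x₍₂₎))` of the space of linear maps `H → V`. -/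
def cotwistEquiv (V : ModuleCat.{u} H) : (H →ₗ[k] V) ≃ₗ[k] (H →ₗ[k] V) :=
  LinearEquiv.ofLinearMap (cotwistMap k V (toConv LinearMap.id))
    (cotwistMap k V (toConv (HopfAlgebra.antipode k)))
    (by rw [← cotwistMap_mul, id_mul_antipode, cotwistMap_one])
    (by rw [← cotwistMap_mul, antipode_mul_id, cotwistMap_one])

variable [FiniteDimensional k H]

/-- The linear equivalence `V ⊗ H^* ≃ Hom(H, V)`, `v ⊗ f ↦ (x ↦ ∑ f(x₍₂₎) x₍₁₎ v)`. -/
def tensorDualEquiv (V : ModuleCat.{u} H) : V ⊗[k] coinduced k H k ≃ₗ[k] (H →ₗ[k] V) :=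
  TensorProduct.comm k V (coinduced k H k) ≪≫ₗ
    TensorProduct.congr (coinducedEquiv k H k).symm (LinearEquiv.refl k V) ≪≫ₗ
    dualTensorHomEquiv k H V ≪≫ₗ cotwistEquiv k V

theorem tensorDualEquiv_tmul {V : ModuleCat.{u} H} (v : V) (f : H →ₗ[k] k) (x : H) :
    tensorDualEquiv k V (v ⊗ₜ coinducedEquiv k H k f) x =
      TensorProduct.lift (LinearMap.lsmul k V).flip
        (TensorProduct.map (orbitMap k V v) f (Coalgebra.comul (R := k) x)) := by
  change TensorProduct.lift (Algebra.lsmul k k V).toLinearMap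
    (TensorProduct.map LinearMap.id (dualTensorHom k H V (f ⊗ₜ v)) (Coalgebra.comul (R := k) x)) = _
  generalize Coalgebra.comul (R := k) x = t
  induction t with
  | zero => simp
  | add x y hx hy => simp only [map_add, hx, hy]
  | tmul x y => exact smul_comm x (f y) v

theorem isEquivariant_tensorDualEquiv (V : ModuleCat.{u} H) :
    IsEquivariant k (tensorDualEquiv k V ≪≫ₗ coinducedEquiv k H V).toLinearMap := by
  intro a v f
  obtain ⟨f, rfl⟩ := (coinducedEquiv k H k).surjective f
  rw [LinearEquiv.coe_coe, LinearEquiv.trans_apply, LinearEquiv.trans_apply, smul_coinducedEquiv,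
    coact_self]
  congr 1
  ext x
  rw [LinearMap.comp_apply, LinearMap.mulRight_apply, tensorDualEquiv_tmul, Bialgebra.comul_mul]
  generalize Coalgebra.comul (R := k) a = t
  induction t with
  | zero => simp
  | add s t hs ht => simp only [map_add, mul_add, LinearMap.add_apply, hs, ht]
  | tmul b c =>
    rw [TensorProduct.map_tmul, orbitMap_apply, orbitMap_apply, smul_coinducedEquiv,
      tensorDualEquiv_tmul]
    generalize Coalgebra.comul (R := k) x = s
    induction s with
    | zero => simp
    | add s t hs ht => simp only [map_add, add_mul, hs, ht]
    | tmul x y => simp [mul_smul]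

/-- The isomorphism from the tensor product `V ⊗ H^*` to the module coinduced from `V`. -/
def tensorDualIso (V : ModuleCat.{u} H) : tensorObj k V (coinduced k H k) ≅ coinduced k H V :=
  tensorIso (isEquivariant_tensorDualEquiv k V)

end CoinducedModules

section SelfInjectivity

variable (k H : Type u) [Field k] [Ring H] [HopfAlgebra k H]

/-- The regular module as a retract of `H ⊗ H^*`. Through `inducedEquiv`, which makes `H ⊗ H^*`
induced from the vector space `H^*`, the retraction comes from the splitting of the line spanned by
the counit off `H^*`. -/
def regularRetract : Retract (regular H) (tensorObj k (regular H) (coinduced k H k)) :=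
  let counit : coinduced k H k := coinducedEquiv k H k Coalgebra.counit
  let evalOne : coinduced k H k →ₗ[k] k :=
    LinearMap.applyₗ (R := k) (1 : H) ∘ₗ (coinducedEquiv k H k).symm.toLinearMap
  let incl : regular H →ₗ[H] tensorObj k (regular H) (coinduced k H k) :=
    (inducedEquiv k (coinduced k H k)).toLinearMap ∘ₗ
      ((TensorProduct.AlgebraTensorModule.mk k H H (coinduced k H k)).flip counit : H →ₗ[H] _)
  let retraction : tensorObj k (regular H) (coinduced k H k) →ₗ[H] regular H :=
    ((TensorProduct.AlgebraTensorModule.rid k H H).toLinearMap ∘ₗ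
      TensorProduct.AlgebraTensorModule.lTensor H H evalOne : _ →ₗ[H] H) ∘ₗ
      (inducedEquiv k (coinduced k H k)).symm.toLinearMap
  { i := ModuleCat.ofHom (X := regular H) incl
    r := ModuleCat.ofHom (Y := regular H) retraction
    retract := by
      have evalOne_counit : evalOne counit = 1 := Bialgebra.counit_one
      ext
      change TensorProduct.AlgebraTensorModule.rid k H H
        (TensorProduct.AlgebraTensorModule.lTensor H H evalOne
          ((inducedEquiv k (coinduced k H k)).symm
            (inducedEquiv k (coinduced k H k) (_ ⊗ₜ counit)))) = _
      rw [LinearEquiv.symm_apply_apply, TensorProduct.AlgebraTensorModule.lTensor_tmul,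
        evalOne_counit, TensorProduct.AlgebraTensorModule.rid_tmul, one_smul]
      rfl }

/-- The trivial `H`-module on a vector space: `H` acts through the counit. -/
def trivialOn (N : Type u) [AddCommGroup N] [Module k N] : ModuleCat.{u} H :=
  (ModuleCat.restrictScalars (Bialgebra.counitAlgHom k H).toRingHom).obj (ModuleCat.of k N)

def trivialOnEquiv (N : Type u) [AddCommGroup N] [Module k N] : trivialOn k H N ≃ₗ[k] N where
  toFun c := c
  map_add' _ _ := rfl
  map_smul' c x := by
    change Coalgebra.counit (R := k) (algebraMap k H c) • (show N from x) = c • (show N from x)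
    rw [Bialgebra.counit_algebraMap]
  invFun c := c
  left_inv _ := rfl
  right_inv _ := rfl

/-- The module `H ⊗ N` induced from the vector space `N`. -/
def induced (N : Type u) [AddCommGroup N] [Module k N] : ModuleCat.{u} H :=
  ModuleCat.of H (H ⊗[k] N)

def inducedUnderlyingEquiv (N : Type u) [AddCommGroup N] [Module k N] :
    H ⊗[k] N ≃ₗ[k] induced k H N where
  toFun x := x
  map_add' _ _ := rfl
  map_smul' c x := (algebraMap_smul H c x).symm
  invFun x := x
  left_inv _ := rfl
  right_inv _ := rfl

def trivialOnTensorEquiv (N : Type u) [AddCommGroup N] [Module k N] :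
    trivialOn k H N ⊗[k] regular H ≃ₗ[k] induced k H N :=
  TensorProduct.comm k _ _ ≪≫ₗ
    TensorProduct.congr (regularEquiv k H).symm (trivialOnEquiv k H N) ≪≫ₗ
    inducedUnderlyingEquiv k H N

theorem isEquivariant_trivialOnTensorEquiv (N : Type u) [AddCommGroup N] [Module k N] :
    IsEquivariant k (trivialOnTensorEquiv k H N).toLinearMap := by
  intro a n h
  have apply_orbitMap : ∀ t : H ⊗[k] H, trivialOnTensorEquiv k H N
      (TensorProduct.map (orbitMap k (trivialOn k H N) n) (orbitMap k (regular H) h) t) =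
      inducedUnderlyingEquiv k H N ((TensorProduct.lid k H
        ((Coalgebra.counit (R := k) (A := H)).rTensor H t) * (regularEquiv k H).symm h) ⊗ₜ
          trivialOnEquiv k H N n) := by
    intro t
    induction t with
    | zero => simp
    | add x y hx hy => simp only [map_add, hx, hy, add_mul, TensorProduct.add_tmul]
    | tmul x y =>
      change inducedUnderlyingEquiv k H N ((y * (regularEquiv k H).symm h) ⊗ₜ
        (Coalgebra.counit (R := k) x • trivialOnEquiv k H N n)) = _
      simp [TensorProduct.smul_tmul]
  rw [LinearEquiv.coe_coe, apply_orbitMap, coact_self, Coalgebra.rTensor_counit_comul,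
    TensorProduct.lid_tmul, one_smul]
  rfl

def trivialOnTensorIso (N : Type u) [AddCommGroup N] [Module k N] :
    tensorObj k (trivialOn k H N) (regular H) ≅ induced k H N :=
  tensorIso (isEquivariant_trivialOnTensorEquiv k H N)

variable {H}

theorem exists_isLeftIntegral_of_free {M : Type*} [AddCommGroup M] [Module H M] [Module.Free H M]
    {m : M} (hm : m ≠ 0)
    (invariant : ∀ a : H, a • m = algebraMap k H (Coalgebra.counit (R := k) a) • m) :
    ∃ Λ : H, IsLeftIntegral k Λ := by
  let b := Module.Free.chooseBasis H M
  obtain ⟨i, hi⟩ := Finsupp.ne_iff.1 (b.repr.map_ne_zero_iff.2 hm)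
  refine ⟨b.repr m i, hi, fun a => ?_⟩
  have coordinate_invariant := congrArg (fun x => b.repr x i) (invariant a)
  simp only [map_smul, Finsupp.smul_apply, smul_eq_mul] at coordinate_invariant
  rw [coordinate_invariant, Algebra.smul_def]

variable [FiniteDimensional k H]

theorem injective_tensorObj_regular (V : ModuleCat.{u} H) :
    Injective (tensorObj k V (regular H)) :=
  have tensorRetract : Retract (tensorObj k V (regular H))
      (tensorObj k V (tensorObj k (regular H) (coinduced k H k))) :=
    (regularRetract k H).map (tensorLeft k V)
  have coinducedIso : tensorObj k V (tensorObj k (regular H) (coinduced k H k)) ≅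
      coinduced k H (tensorObj k V (regular H)) :=
    (assocIso k V (regular H) (coinduced k H k)).symm ≪≫
      tensorDualIso k (tensorObj k V (regular H))
  (tensorRetract.trans (.ofIso coinducedIso)).injective

theorem injective_regular_tensorObj (V : ModuleCat.{u} H) :
    Injective (tensorObj k (regular H) V) :=
  Injective.of_iso (trivialOnTensorIso k H V ≪≫ (inducedEquiv k V).toModuleIso)
    (injective_tensorObj_regular k (trivialOn k H V))

variable (H)

include k in
theorem injective_regular : Injective (regular H) :=
  Injective.of_iso (leftUnitIso k (H := H) (regular H))
    (injective_tensorObj_regular k (trivialModule k H))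

/-- `x ↦ ε(x) 1` is an invariant element of the module coinduced from `H`, which is free because it
is isomorphic to `H ⊗ H^*`. -/
theorem exists_isLeftIntegral : ∃ Λ : H, IsLeftIntegral k Λ := by
  let counitOne : H →ₗ[k] regular H :=
    (regularEquiv k H).toLinearMap ∘ₗ Algebra.linearMap k H ∘ₗ Coalgebra.counit
  have counitOne_apply (h : H) :
      counitOne h = toRegular (algebraMap k H (Coalgebra.counit (R := k) h)) := rfl
  have counitOne_ne_zero : coinducedEquiv k H (regular H) counitOne ≠ 0 := by
    refine (LinearEquiv.map_ne_zero_iff _).2 fun h => ?_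
    have one_eq_zero : toRegular (1 : H) = 0 := by
      simpa [counitOne_apply] using LinearMap.congr_fun h 1
    have : Nontrivial H := (Bialgebra.counitAlgHom k H).toRingHom.domain_nontrivial
    exact one_ne_zero (α := H) one_eq_zero
  have invariant (a : H) : a • coinducedEquiv k H (regular H) counitOne =
      algebraMap k H (Coalgebra.counit (R := k) a) • coinducedEquiv k H (regular H) counitOne := by
    rw [smul_coinducedEquiv, smul_coinducedEquiv]
    congr 1
    ext x
    simp [counitOne_apply]
  have : Module.Free H (coinduced k H (regular H)) := .of_equiv
    ((inducedEquiv k (coinduced k H k)).trans (tensorDualIso k (regular H)).toLinearEquiv)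
  exact exists_isLeftIntegral_of_free k counitOne_ne_zero invariant

end SelfInjectivity

/-! ### Exactness of tensor products -/

section RightExact

variable {𝒜 : Type u₁} [Category.{v₁} 𝒜] [Preadditive 𝒜] {ℬ : Type u₂} [Category.{v₂} ℬ]
  [Preadditive ℬ] {X Y Z : 𝒜} {x : X ⟶ Y} {z : Y ⟶ Z}

namespace IsCokernel

theorem of_isColimit (zero : x ≫ z = 0) (h : IsColimit (CokernelCofork.ofπ z zero)) :
    IsCokernel x z where
  zero := zero
  epi := ⟨fun _ _ hg => Cofork.IsColimit.hom_ext h hg⟩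
  desc g hg := ⟨h.desc (CokernelCofork.ofπ g hg), h.fac _ WalkingParallelPair.one⟩

theorem nonempty_isColimit (h : IsCokernel x z) :
    Nonempty (IsColimit (CokernelCofork.ofπ z h.zero)) :=
  have := h.epi
  ⟨CokernelCofork.IsColimit.ofπ _ _ (fun g hg => (h.desc g hg).choose)
    (fun g hg => (h.desc g hg).choose_spec)
    (fun g hg _ hm => by rw [← cancel_epi z, hm, (h.desc g hg).choose_spec])⟩

theorem map (h : IsCokernel x z) (F : 𝒜 ⥤ ℬ) [F.Additive] [PreservesFiniteColimits F] :
    IsCokernel (F.map x) (F.map z) :=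
  .of_isColimit (by rw [← F.map_comp, h.zero, F.map_zero])
    (CokernelCofork.mapIsColimit _ h.nonempty_isColimit.some F)

theorem of_map (F : 𝒜 ⥤ ℬ) [F.Additive] [F.Full] [F.Faithful]
    (h : IsCokernel (F.map x) (F.map z)) : IsCokernel x z where
  zero := F.map_injective (by rw [F.map_comp, h.zero, F.map_zero])
  epi := have := h.epi; F.epi_of_epi_map inferInstance
  desc g hg := by
    obtain ⟨l, hl⟩ := h.desc (F.map g) (by rw [← F.map_comp, hg, F.map_zero])
    exact ⟨F.preimage l, F.map_injective (by rw [F.map_comp, F.map_preimage, hl])⟩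

theorem of_exact [Balanced 𝒜] {zero : x ≫ z = 0} (h : (ShortComplex.mk x z zero).Exact)
    [Epi z] : IsCokernel x z :=
  have : Epi (ShortComplex.mk x z zero).g := ‹Epi z›
  .of_isColimit zero h.gIsCokernel

theorem epi_comp (h : IsCokernel x z) {W : 𝒜} (e : W ⟶ X) [Epi e] : IsCokernel (e ≫ x) z where
  zero := by rw [Category.assoc, h.zero, comp_zero]
  epi := h.epi
  desc g hg := h.desc g (by rwa [← cancel_epi e, comp_zero, ← Category.assoc])

theorem comp_iso (h : IsCokernel x z) {W : 𝒜} (e : Z ≅ W) : IsCokernel x (z ≫ e.hom) where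
  zero := by rw [← Category.assoc, h.zero, zero_comp]
  epi := have := h.epi; inferInstance
  desc g hg := by
    obtain ⟨l, hl⟩ := h.desc g hg
    exact ⟨e.inv ≫ l, by rw [Category.assoc, e.hom_inv_id_assoc, hl]⟩

theorem exists_lift {𝒜 : Type u₁} [Category.{v₁} 𝒜] [Abelian 𝒜] {X Y Z : 𝒜} {x : X ⟶ Y}
    {z : Y ⟶ Z} (h : IsCokernel x z) [Mono x] {W : 𝒜} (g : W ⟶ Y) (hg : g ≫ z = 0) :
    ∃ l, l ≫ x = g :=
  have hx := Abelian.monoIsKernelOfCokernel _ h.nonempty_isColimit.some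
  ⟨hx.lift (KernelFork.ofι g hg), hx.fac _ WalkingParallelPair.zero⟩

end IsCokernel

theorem StableData.IsCompatible.of_preservesFiniteColimits {D : StableData 𝒜} {D' : StableData ℬ}
    (F : 𝒜 ⥤ ℬ) [F.Additive] [PreservesFiniteColimits F]
    (null_id_I : ∀ N, D'.Null (𝟙 (F.obj (D.I.obj N))))
    (exists_extension : ∀ X, ∃ e : F.obj (D.I.obj X) ⟶ D'.I.obj (F.obj X),
      F.map (D.i X) ≫ e = D'.i (F.obj X)) : D.IsCompatible D' F where
  additive := inferInstance
  null_id_I := null_id_I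
  exists_extension := exists_extension
  isCokernel_map_p X := (D.isCokernel_p X).map F
  map_isPushout h := h.map F

end RightExact

section TensorFunctors

variable (k : Type u) {H A : Type u} [Field k] [Ring H] [HopfAlgebra k H] [Ring A] [Algebra k A]
  [LeftComoduleAlgebra k H A]

instance tensorLeft_additive (V : ModuleCat.{u} H) :
    (tensorLeft k V : ModuleCat.{u} A ⥤ ModuleCat.{u} A).Additive where
  map_add {_ _ f g} := tensorMap_add_right k (𝟙 V) f g

/-- The functor `- ⊗ M` on `H`-modules, for an `A`-module `M`. -/
def tensorRight (M : ModuleCat.{u} A) : ModuleCat.{u} H ⥤ ModuleCat.{u} A where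
  obj V := tensorObj k V M
  map f := tensorMap k f (𝟙 M)
  map_id V := tensorMap_id_id k V M
  map_comp f g := tensorMap_comp_id k f g M

instance tensorRight_additive (M : ModuleCat.{u} A) :
    (tensorRight k M : ModuleCat.{u} H ⥤ ModuleCat.{u} A).Additive where
  map_add {_ _ f g} := tensorMap_add_left k f g (𝟙 M)

open ShortComplex.ShortExact in
instance tensorLeft_preservesFiniteColimits (V : ModuleCat.{u} H) :
    PreservesFiniteColimits (tensorLeft k V : ModuleCat.{u} A ⥤ ModuleCat.{u} A) := by
  rw [Functor.preservesFiniteColimits_iff_forall_exact_map_and_epi]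
  intro S hS
  have surjective_g := (ModuleCat.epi_iff_surjective S.g).1 hS.epi_g
  have exact_S := (moduleCat_exact_iff_function_exact S).1 hS.exact
  exact ⟨(moduleCat_exact_iff_function_exact _).2
      (lTensor_exact (f := klin k S.f) (g := klin k S.g) V exact_S surjective_g),
    (ModuleCat.epi_iff_surjective _).2 (LinearMap.lTensor_surjective (g := klin k S.g) V
      surjective_g)⟩

open ShortComplex.ShortExact in
instance tensorRight_preservesFiniteColimits (M : ModuleCat.{u} A) :
    PreservesFiniteColimits (tensorRight k M : ModuleCat.{u} H ⥤ ModuleCat.{u} A) := by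
  rw [Functor.preservesFiniteColimits_iff_forall_exact_map_and_epi]
  intro S hS
  have surjective_g := (ModuleCat.epi_iff_surjective S.g).1 hS.epi_g
  have exact_S := (moduleCat_exact_iff_function_exact S).1 hS.exact
  exact ⟨(moduleCat_exact_iff_function_exact _).2
      (rTensor_exact (f := klin k S.f) (g := klin k S.g) M exact_S surjective_g),
    (ModuleCat.epi_iff_surjective _).2 (LinearMap.rTensor_surjective (g := klin k S.g) M
      surjective_g)⟩

variable {V W U : ModuleCat.{u} H}

theorem IsCokernel.tensorMap_id {f : V ⟶ W} {g : W ⟶ U} (h : IsCokernel f g)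
    (M : ModuleCat.{u} A) : IsCokernel (tensorMap k f (𝟙 M)) (tensorMap k g (𝟙 M)) :=
  h.map (tensorRight k M)

instance mono_tensorMap_id (f : V ⟶ W) [Mono f] (M : ModuleCat.{u} A) :
    Mono (tensorMap k f (𝟙 M)) :=
  (ModuleCat.mono_iff_injective _).2 (Module.Flat.rTensor_preserves_injective_linearMap (M := M)
    (klin k f) ((ModuleCat.mono_iff_injective f).1 inferInstance))

instance mono_id_tensorMap {M N : ModuleCat.{u} A} (f : M ⟶ N) [Mono f] (V : ModuleCat.{u} H) :
    Mono (tensorMap k (𝟙 V) f) :=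
  (ModuleCat.mono_iff_injective _).2 (Module.Flat.lTensor_preserves_injective_linearMap (M := V)
    (klin k f) ((ModuleCat.mono_iff_injective f).1 inferInstance))

end TensorFunctors

section FullSubcategory

variable {R S : Type u} [Ring R] [Ring S] (C : ObjectProperty (ModuleCat.{u} R))
  [C.IsClosedUnderSubobjects] [C.IsClosedUnderQuotients] [C.IsClosedUnderFiniteProducts]

instance containsZero_of_isClosedUnderFiniteProducts : C.ContainsZero where
  exists_zero := by
    refine ⟨∏ᶜ (fun i : Fin 0 => i.elim0), ?_, C.prop_product fun i => i.elim0⟩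
    rw [IsZero.iff_id_eq_zero]
    exact Limits.Pi.hom_ext _ _ fun i => i.elim0

instance fullSubcategoryι_preservesFiniteColimits : PreservesFiniteColimits C.ι := by
  have := C.preservesCokernels_ι
  exact C.ι.preservesFiniteColimits_of_preservesCokernels

theorem preservesFiniteColimits_of_comp_ι {C' : ObjectProperty (ModuleCat.{u} S)}
    {G : ModuleCat.{u} R ⥤ ModuleCat.{u} S} [PreservesFiniteColimits G]
    {F : C.FullSubcategory ⥤ C'.FullSubcategory} (e : C.ι ⋙ G ≅ F ⋙ C'.ι) :
    PreservesFiniteColimits F where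
  preservesFiniteColimits J _ _ := by
    have : PreservesColimitsOfShape J (F ⋙ C'.ι) := preservesColimitsOfShape_of_natIso e
    exact preservesColimitsOfShape_of_reflects_of_preserves F C'.ι

theorem isPushout_hom_iff {X Y Z W : C.FullSubcategory} {f : X ⟶ Y} {g : X ⟶ Z}
    {g' : Y ⟶ W} {f' : Z ⟶ W} : IsPushout f.hom g.hom g'.hom f'.hom ↔ IsPushout f g g' f' :=
  ⟨fun h => IsPushout.of_map C.ι (by ext : 1; exact h.w) h, fun h => h.map C.ι⟩

end FullSubcategory

/-! ### The integral embedding -/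

section Counit

variable (k H : Type u) [Field k] [Ring H] [HopfAlgebra k H]

def counitLinear : regular H →ₗ[H] trivialModule k H where
  toFun h := (trivialEquiv k).symm (Coalgebra.counit (R := k) (A := H) h)
  map_add' x y := congrArg (trivialEquiv k).symm
    (map_add (Coalgebra.counit (R := k) (A := H)) x y)
  map_smul' a x := congrArg (trivialEquiv k).symm (Bialgebra.counit_mul (R := k) a x)

/-- The counit as a morphism from the regular to the trivial module. -/
def counitHom : regular H ⟶ trivialModule k H :=
  ModuleCat.ofHom (X := regular H) (Y := trivialModule k H) (counitLinear k H)

instance epi_counitHom : Epi (counitHom k H) :=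
  (ModuleCat.epi_iff_surjective _).2 fun c =>
    ⟨toRegular (algebraMap k H (trivialEquiv k c)),
      congrArg (trivialEquiv k).symm (Bialgebra.counit_algebraMap (trivialEquiv k c))⟩

/-- The augmentation ideal, as a left `H`-module. -/
abbrev augmentation : ModuleCat.{u} H := kernel (counitHom k H)

abbrev augmentationι : augmentation k H ⟶ regular H := kernel.ι (counitHom k H)

end Counit

section Integral

variable (k : Type u) {H A : Type u} [Field k] [Ring H] [HopfAlgebra k H] [Ring A] [Algebra k A]
  [LeftComoduleAlgebra k H A] {Λ : H} (hΛ : IsLeftIntegral k Λ)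

theorem integralEmb_naturality {M N : ModuleCat.{u} A} (f : M ⟶ N) :
    f ≫ integralEmb k hΛ N = integralEmb k hΛ M ≫ tensorMap k (𝟙 (regular H)) f := by
  ext
  rfl

theorem integralEmb_assoc (V : ModuleCat.{u} H) (M : ModuleCat.{u} A) :
    tensorMap k (integralEmb k hΛ V) (𝟙 M) ≫ (assocIso k (regular H) V M).hom =
      integralEmb k hΛ (tensorObj k V M) :=
  tensorObj_hom_ext k fun _ _ => rfl

def integralLinear : trivialModule k H →ₗ[H] regular H where
  toFun c := trivialEquiv k c • toRegular Λ
  map_add' x y := by rw [map_add, add_smul]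
  map_smul' h c := by
    have smul_integral : h • toRegular Λ = Coalgebra.counit (R := k) h • toRegular Λ :=
      (hΛ.2 h).trans (Algebra.smul_def _ _)
    have trivialEquiv_smul :
        trivialEquiv k (h • c) = Coalgebra.counit (R := k) h * trivialEquiv k c := rfl
    rw [RingHom.id_apply, trivialEquiv_smul, smul_comm h, smul_integral, smul_smul, mul_comm]

/-- The inclusion of the trivial module into `H` as the span of the integral `Λ`. -/
def integralHom : trivialModule k H ⟶ regular H :=
  ModuleCat.ofHom (X := trivialModule k H) (Y := regular H) (integralLinear k hΛ)

theorem integralHom_apply (c : trivialModule k H) :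
    integralHom k hΛ c = trivialEquiv k c • toRegular Λ := rfl

instance mono_integralHom : Mono (integralHom k hΛ) := by
  rw [ModuleCat.mono_iff_injective]
  intro c d h
  rw [integralHom_apply, integralHom_apply] at h
  have toRegular_ne_zero : toRegular Λ ≠ 0 := hΛ.1
  exact (trivialEquiv k).injective (smul_left_injective k toRegular_ne_zero h)

instance epi_regularProj : Epi (regularProj Λ) := regularProj_epi Λ

theorem integralHom_exact : Function.Exact (integralHom k hΛ) (regularProj Λ) := by
  intro x
  constructor
  · intro hx
    obtain ⟨h, rfl⟩ := Submodule.mem_span_singleton.1 ((Submodule.Quotient.mk_eq_zero _).1 hx)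
    exact ⟨(trivialEquiv k).symm (Coalgebra.counit (R := k) h),
      ((hΛ.2 h).trans (Algebra.smul_def _ _)).symm⟩
  · rintro ⟨c, rfl⟩
    exact (Submodule.Quotient.mk_eq_zero _).2
      (Submodule.mem_span_singleton.2 ⟨algebraMap k H (trivialEquiv k c), rfl⟩)

theorem isCokernel_regularProj : IsCokernel (integralHom k hΛ) (regularProj Λ) :=
  .of_exact (zero := by ext x; exact (integralHom_exact k hΛ).apply_apply_eq_zero x)
    ((ShortComplex.ShortExact.moduleCat_exact_iff_function_exact _).2 (integralHom_exact k hΛ))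

theorem integralEmb_eq (M : ModuleCat.{u} A) :
    integralEmb k hΛ M = (leftUnitIso k M).inv ≫ tensorMap k (integralHom k hΛ) (𝟙 M) := by
  rw [Iso.eq_inv_comp]
  exact tensorObj_hom_ext k fun c m =>
    ((TensorProduct.smul_tmul (trivialEquiv k c) (toRegular Λ) m).symm :
      toRegular Λ ⊗ₜ[k] (trivialEquiv k c • m) = (trivialEquiv k c • toRegular Λ) ⊗ₜ[k] m)

instance mono_integralEmb (M : ModuleCat.{u} A) : Mono (integralEmb k hΛ M) := by
  rw [integralEmb_eq]
  infer_instance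

theorem isCokernel_integralEmb (M : ModuleCat.{u} A) :
    IsCokernel (integralEmb k hΛ M) (tensorMap k (regularProj Λ) (𝟙 M)) := by
  rw [integralEmb_eq]
  exact ((isCokernel_regularProj k hΛ).tensorMap_id k M).epi_comp _

/-- The morphism `ε ⊗ M : H ⊗ M ⟶ M`. -/
def counitTensor (M : ModuleCat.{u} A) : tensorObj k (regular H) M ⟶ M :=
  tensorMap k (counitHom k H) (𝟙 M) ≫ (leftUnitIso k M).hom

theorem isCokernel_counitTensor (M : ModuleCat.{u} A) :
    IsCokernel (tensorMap k (augmentationι k H) (𝟙 M)) (counitTensor k (H := H) M) :=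
  ((IsCokernel.of_exact (ShortComplex.exact_kernel (counitHom k H))).tensorMap_id k M).comp_iso _

theorem counitTensor_naturality {M N : ModuleCat.{u} A} (f : M ⟶ N) :
    tensorMap k (𝟙 (regular H)) f ≫ counitTensor k N = counitTensor k M ≫ f :=
  tensorObj_hom_ext k fun h m => (map_smul (klin k f) (Coalgebra.counit (R := k) (A := H) h) m).symm

theorem counitTensor_assoc (V : ModuleCat.{u} H) (M : ModuleCat.{u} A) :
    (assocIso k (regular H) V M).hom ≫ counitTensor k (tensorObj k V M) =
      tensorMap k (counitTensor k V) (𝟙 M) :=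
  tensorObj_hom_ext₃ k fun h v m =>
    ((tensorEquiv k V M).map_smul (Coalgebra.counit (R := k) (A := H) h) (v ⊗ₜ m)).symm

/-- The lift of `g` along `π` extends a lift `H ⊗ W ⟶ H` of `ε ⊗ W`; the section of
`ε ⊗ H : H ⊗ H ⟶ H` makes it available on `H ⊗ N`. -/
theorem exists_lift_regular {W : ModuleCat.{u} H} (π : regular H ⟶ W) [Epi π]
    {M N : ModuleCat.{u} A} (g : tensorObj k (regular H) N ⟶ tensorObj k W M) :
    ∃ g', g' ≫ tensorMap k π (𝟙 M) = g := by
  have : Projective (regular H) :=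
    (IsProjective.iff_projective (regular H)).1 (inferInstanceAs (Module.Projective H H))
  have := projective_regular_tensorObj k W
  have := (isCokernel_counitTensor k (H := H) (regular H)).epi
  obtain ⟨σ, hσ⟩ := Projective.factors (𝟙 (regular H)) (counitTensor k (H := H) (regular H))
  obtain ⟨l, hl⟩ := Projective.factors (counitTensor k (H := H) W) π
  refine ⟨tensorMap k σ (𝟙 N) ≫ (assocIso k _ _ _).hom ≫ tensorMap k (𝟙 _) g ≫
    (assocIso k _ _ _).inv ≫ tensorMap k l (𝟙 M), ?_⟩
  simp only [Category.assoc]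
  rw [← tensorMap_comp_id, hl, ← counitTensor_assoc, Iso.inv_hom_id_assoc, counitTensor_naturality,
    reassoc_of% counitTensor_assoc, ← Category.assoc, ← tensorMap_comp_id, hσ, tensorMap_id_id,
    Category.id_comp]

variable [FiniteDimensional k H]

theorem exists_extension_integralEmb {M N : ModuleCat.{u} A}
    (g : M ⟶ tensorObj k (regular H) N) : ∃ g', integralEmb k hΛ M ≫ g' = g := by
  have := injective_regular k H
  obtain ⟨ρ, hρ⟩ := Injective.factors (𝟙 (regular H)) (integralEmb k hΛ (regular H))
  refine ⟨tensorMap k (𝟙 _) g ≫ (assocIso k _ _ _).inv ≫ tensorMap k ρ (𝟙 N), ?_⟩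
  rw [← reassoc_of% integralEmb_naturality k hΛ g, ← integralEmb_assoc, Category.assoc,
    Iso.hom_inv_id_assoc, ← tensorMap_comp_id, hρ, tensorMap_id_id, Category.comp_id]

theorem exists_tensorMap_augmentationι_comp_eq_integralEmb (M : ModuleCat.{u} A) :
    ∃ e : tensorObj k (regular H) M ⟶ tensorObj k (regular H) (tensorObj k (augmentation k H) M),
      tensorMap k (augmentationι k H) (𝟙 M) ≫ e = integralEmb k hΛ _ := by
  have := injective_regular_tensorObj k (augmentation k H)
  obtain ⟨e, he⟩ := Injective.factors (integralEmb k hΛ (augmentation k H)) (augmentationι k H)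
  refine ⟨tensorMap k e (𝟙 M) ≫ (assocIso k _ _ _).hom, ?_⟩
  rw [← Category.assoc, ← tensorMap_comp_id, he, integralEmb_assoc]

theorem finDim_augmentation : finDim k H (augmentation k H) :=
  (finDim k H).prop_of_mono (augmentationι k H) (finDim_regular k H)

end Integral

/-! ### The stable data of an admissible class of modules -/

section AdmissibleClass

variable (k : Type u) {H A : Type u} [Field k] [Ring H] [HopfAlgebra k H] [FiniteDimensional k H]
  [Ring A] [Algebra k A] [LeftComoduleAlgebra k H A] {Λ : H} (hΛ : IsLeftIntegral k Λ)
  (C : ObjectProperty (ModuleCat.{u} A)) [IsAdmissible k H C]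

instance tensorOn_additive {V : ModuleCat.{u} H} (hV : PreservesClass k V C) :
    (tensorOn k C hV).Additive where
  map_add {_ _ f g} := by
    ext : 1
    exact tensorMap_add_right k (𝟙 V) f.hom g.hom

/-- The embeddings `Λ ⊗ M : M ⟶ H ⊗ M` of the modules `M` of `C`, with cokernels
`(H ⧸ kΛ) ⊗ M`. -/
def stableData : StableData C.FullSubcategory where
  I := tensorOn k C (V := regular H) (fun M hM => IsAdmissible.tensor_regular M hM)
  T := shiftT k C Λ
  additive_T := inferInstance
  i X := ObjectProperty.homMk (integralEmb k hΛ X.obj)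
  p X := ObjectProperty.homMk (tensorMap k (regularProj Λ) (𝟙 X.obj))
  i_naturality f := by
    ext : 1
    exact integralEmb_naturality k hΛ f.hom
  p_naturality f := by
    ext : 1
    exact (tensorMap_exchange k (regularProj Λ) f.hom).symm
  mono_i X := C.ι.mono_of_mono_map (mono_integralEmb k hΛ X.obj)
  isCokernel_p X := .of_map C.ι (isCokernel_integralEmb k hΛ X.obj)
  lift g hg := by
    obtain ⟨m, hm⟩ := (isCokernel_integralEmb k hΛ _).exists_lift g.hom (congrArg (·.hom) hg)
    exact ⟨ObjectProperty.homMk m, by ext : 1; exact hm⟩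
  extend g := by
    obtain ⟨m, hm⟩ := exists_extension_integralEmb k hΛ g.hom
    exact ⟨ObjectProperty.homMk m, by ext : 1; exact hm⟩
  cover g := by
    obtain ⟨m, hm⟩ := exists_lift_regular k (regularProj Λ) g.hom
    exact ⟨ObjectProperty.homMk m, by ext : 1; exact hm⟩
  exists_loop M := by
    obtain ⟨e, he⟩ := exists_tensorMap_augmentationι_comp_eq_integralEmb k hΛ M.obj
    exact ⟨⟨tensorObj k (augmentation k H) M.obj, preservesClass_of_finDim k C
      (finDim_augmentation k) _ M.property⟩, M, ObjectProperty.homMk (tensorMap k _ (𝟙 M.obj)),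
      ObjectProperty.homMk (counitTensor k M.obj), ObjectProperty.homMk e,
      .of_map C.ι (isCokernel_counitTensor k M.obj), by ext : 1; exact he⟩
  exists_pushout f := ⟨_, _, _, IsPushout.of_hasPushout _ _⟩

theorem stableData_isCone_iff {X Y Z : C.FullSubcategory} (f : X ⟶ Y) (v : Y ⟶ Z)
    (w : Z ⟶ (shiftT k C Λ).obj X) :
    (stableData k hΛ C).IsCone f v w ↔ IsStandardTriangle k C hΛ f v w := by
  constructor
  · rintro ⟨f', h, hvw, hfw⟩
    exact ⟨f'.hom, (isPushout_hom_iff C).2 h, congrArg (·.hom) hvw, congrArg (·.hom) hfw⟩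
  · rintro ⟨f', h, hvw, hfw⟩
    exact ⟨ObjectProperty.homMk f', (isPushout_hom_iff C).1 h, by ext : 1; exact hvw,
      by ext : 1; exact hfw⟩

theorem homotopyRel_iff {X Y : C.FullSubcategory} (f g : X ⟶ Y) :
    homotopyRel k H C f g ↔ (stableData k hΛ C).Null (f - g) := by
  constructor
  · rintro ⟨N, hN, a, b, h⟩
    exact ⟨⟨N, hN⟩, ObjectProperty.homMk a, ObjectProperty.homMk b, by ext : 1; exact h⟩
  · rintro ⟨N, a, b, h⟩
    exact ⟨N.obj, N.property, a.hom, b.hom, congrArg (·.hom) h⟩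

theorem stableRel_iff (P : ObjectProperty (ModuleCat.{u} H)) [IsAdmissible k H P]
    {X Y : P.FullSubcategory} (f g : X ⟶ Y) :
    stableRel P f g ↔ (stableData k hΛ P).Null (f - g) := by
  constructor
  · rintro ⟨I, hI, _, a, b, h⟩
    obtain ⟨ρ, hρ⟩ := Injective.factors (𝟙 I) (integralEmb k hΛ I)
    refine ⟨⟨I, hI⟩, ObjectProperty.homMk (a ≫ integralEmb k hΛ I),
      ObjectProperty.homMk (ρ ≫ b), ?_⟩
    ext : 1
    change f.hom - g.hom = (a ≫ integralEmb k hΛ I) ≫ ρ ≫ b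
    rw [h, Category.assoc, reassoc_of% hρ]
  · rintro ⟨N, a, b, h⟩
    exact ⟨_, ((stableData k hΛ P).I.obj N).property, injective_regular_tensorObj k N.obj, a.hom,
      b.hom, congrArg (·.hom) h⟩

end AdmissibleClass

/-! ### Tensor and restriction functors -/

section CompatibleTensor

variable (k : Type u) {H A : Type u} [Field k] [Ring H] [HopfAlgebra k H]
  [Ring A] [Algebra k A] [LeftComoduleAlgebra k H A] {Λ : H} (hΛ : IsLeftIntegral k Λ)

/-- The embedding `V → V ⊗ H`, `v ↦ v ⊗ Λ`. -/
def integralEmbRight (V : ModuleCat.{u} H) : V ⟶ tensorObj k V (regular H) :=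
  (rightUnitIso k V).inv ≫ tensorMap k (𝟙 V) (integralHom k hΛ)

instance mono_integralEmbRight (V : ModuleCat.{u} H) : Mono (integralEmbRight k hΛ V) := by
  rw [integralEmbRight]
  infer_instance

theorem integralEmbRight_apply (V : ModuleCat.{u} H) (v : V) :
    integralEmbRight k hΛ V v = pureTensor k V (regular H) v (toRegular Λ) :=
  congrArg (pureTensor k V (regular H) v) (one_smul k (toRegular Λ))

theorem exists_retraction_integralEmb (J : ModuleCat.{u} H) [Injective J] (M : ModuleCat.{u} A) :
    ∃ r, integralEmb k hΛ (tensorObj k J M) ≫ r = 𝟙 _ := by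
  obtain ⟨ρ, hρ⟩ := Injective.factors (𝟙 J) (integralEmb k hΛ J)
  refine ⟨(assocIso k _ _ _).inv ≫ tensorMap k ρ (𝟙 M), ?_⟩
  rw [← integralEmb_assoc, Category.assoc, Iso.hom_inv_id_assoc, ← tensorMap_comp_id, hρ,
    tensorMap_id_id]

variable [FiniteDimensional k H]

theorem exists_retraction_integralEmb_tensorObj_regular (V : ModuleCat.{u} H)
    (M : ModuleCat.{u} A) :
    ∃ r, integralEmb k hΛ (tensorObj k V (tensorObj k (regular H) M)) ≫ r = 𝟙 _ := by
  have := injective_tensorObj_regular k V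
  obtain ⟨r, hr⟩ := exists_retraction_integralEmb k hΛ (tensorObj k V (regular H)) M
  refine ⟨tensorMap k (𝟙 _) (assocIso k _ _ _).inv ≫ r ≫ (assocIso k _ _ _).hom, ?_⟩
  rw [← reassoc_of% integralEmb_naturality, reassoc_of% hr, Iso.inv_hom_id]

/-- Injectivity of `H ⊗ V` replaces the missing braiding `V ⊗ H ⟶ H ⊗ V`. -/
theorem exists_tensorMap_integralEmb_comp_eq (V : ModuleCat.{u} H) (M : ModuleCat.{u} A) :
    ∃ e : tensorObj k V (tensorObj k (regular H) M) ⟶ tensorObj k (regular H) (tensorObj k V M),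
      tensorMap k (𝟙 V) (integralEmb k hΛ M) ≫ e = integralEmb k hΛ (tensorObj k V M) := by
  have := injective_regular_tensorObj k V
  obtain ⟨e, he⟩ := Injective.factors (integralEmb k hΛ V) (integralEmbRight k hΛ V)
  have e_pureTensor (v : V) :
      e (pureTensor k V (regular H) v (toRegular Λ)) = integralEmb k hΛ V v := by
    rw [← he, ModuleCat.comp_apply, integralEmbRight_apply]
  refine ⟨(assocIso k _ _ _).inv ≫ tensorMap k e (𝟙 M) ≫ (assocIso k _ _ _).hom, ?_⟩
  rw [← integralEmb_assoc, ← Category.assoc, ← Category.assoc]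
  refine congrArg (· ≫ _) (tensorObj_hom_ext k fun v m => ?_)
  exact congrArg (pureTensor k _ M · m) (e_pureTensor v)

variable (C : ObjectProperty (ModuleCat.{u} A)) [IsAdmissible k H C]

theorem isCompatible_tensorOn {V : ModuleCat.{u} H} (hV : PreservesClass k V C) :
    (stableData k hΛ C).IsCompatible (stableData k hΛ C) (tensorOn k C hV) := by
  have : PreservesFiniteColimits (tensorOn k C hV) :=
    preservesFiniteColimits_of_comp_ι C (G := tensorLeft k V) (Iso.refl _)
  refine StableData.IsCompatible.of_preservesFiniteColimits _ (fun N => ?_) (fun X => ?_)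
  · obtain ⟨r, hr⟩ := exists_retraction_integralEmb_tensorObj_regular k hΛ V N.obj
    exact StableData.null_iff.2 ⟨ObjectProperty.homMk r, by ext : 1; exact hr⟩
  · obtain ⟨e, he⟩ := exists_tensorMap_integralEmb_comp_eq k hΛ V X.obj
    exact ⟨ObjectProperty.homMk e, by ext : 1; exact he⟩

/-- The functor `- ⊗ M` on finite-dimensional `H`-modules, for a module `M` in `C`. -/
def tensorWith (M : C.FullSubcategory) : (finDim k H).FullSubcategory ⥤ C.FullSubcategory :=
  C.lift ((finDim k H).ι ⋙ tensorRight k M.obj)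
    (fun V => preservesClass_of_finDim k C V.property M.obj M.property)

instance tensorWith_additive (M : C.FullSubcategory) :
    (tensorWith k (H := H) C M).Additive where
  map_add {_ _ f g} := by
    ext : 1
    exact tensorMap_add_left k f.hom g.hom (𝟙 M.obj)

theorem isCompatible_tensorWith (M : C.FullSubcategory) :
    (stableData k hΛ (finDim k H)).IsCompatible (stableData k hΛ C) (tensorWith k C M) := by
  have : PreservesFiniteColimits (tensorWith k (H := H) C M) :=
    preservesFiniteColimits_of_comp_ι (finDim k H) (G := tensorRight k M.obj) (Iso.refl _)
  refine StableData.IsCompatible.of_preservesFiniteColimits _ (fun V => ?_) (fun V => ?_)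
  · refine ⟨(tensorWith k C M).obj V, ObjectProperty.homMk (assocIso k _ _ _).hom,
      ObjectProperty.homMk (assocIso k _ _ _).inv, ?_⟩
    ext : 1
    exact (assocIso k (regular H) V.obj M.obj).hom_inv_id.symm
  · exact ⟨ObjectProperty.homMk (assocIso k _ _ _).hom, by
      ext : 1; exact integralEmb_assoc k hΛ V.obj M.obj⟩

end CompatibleTensor

section Restriction

variable (k H B : Type u) [Field k] [Ring H] [HopfAlgebra k H] [Ring B] [Algebra k B]
  [RightModuleAlgebra k H B]

/-- Restriction of `H # B`-modules to `H`-modules. -/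
abbrev res : ModuleCat.{u} (SmashProduct k H B) ⥤ ModuleCat.{u} H :=
  ModuleCat.restrictScalars (SmashProduct.incl k H B).toRingHom

variable {B}

/-- The identity of a module, as a linear map over `k` to its restriction. The two `k`-structures
come from `k ⟶ H # B` and `k ⟶ H` and agree only propositionally. -/
def resEquiv (M : ModuleCat.{u} (SmashProduct k H B)) : M ≃ₗ[k] (res k H B).obj M where
  toFun m := m
  invFun m := m
  left_inv _ := rfl
  right_inv _ := rfl
  map_add' _ _ := rfl
  map_smul' c m := by
    change algebraMap k (SmashProduct k H B) c • m =
      SmashProduct.incl k H B (algebraMap k H c) • m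
    rw [AlgHom.commutes]

variable {H}

theorem smul_resEquiv (M : ModuleCat.{u} (SmashProduct k H B)) (h : H) (m : M) :
    h • resEquiv k H M m = resEquiv k H M (SmashProduct.incl k H B h • m) := rfl

theorem coact_incl (h : H) :
    LeftComoduleAlgebra.coact (k := k) (H := H) (SmashProduct.incl k H B h) =
      (SmashProduct.incl k H B).toLinearMap.lTensor H (Coalgebra.comul (R := k) h) := rfl

theorem isEquivariant_resEquiv (V : ModuleCat.{u} H) (M : ModuleCat.{u} (SmashProduct k H B)) :
    IsEquivariant k (V := V) (M := (res k H B).obj M) (TensorProduct.congr (LinearEquiv.refl k V)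
      (resEquiv k H M).symm ≪≫ₗ tensorEquiv k V M ≪≫ₗ
        resEquiv k H (tensorObj k V M)).toLinearMap := by
  intro a v m
  obtain ⟨m, rfl⟩ := (resEquiv k H M).surjective m
  change _ = a • resEquiv k H (tensorObj k V M) (pureTensor k V M v m)
  rw [smul_resEquiv, smul_pureTensor, coact_incl]
  have map_orbitMap : ∀ t : H ⊗[k] H, TensorProduct.congr (LinearEquiv.refl k V)
      (resEquiv k H M).symm (TensorProduct.map (orbitMap k V v)
        (orbitMap k ((res k H B).obj M) (resEquiv k H M m)) t) =
      TensorProduct.map (orbitMap k V v) (orbitMap k M m)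
        ((SmashProduct.incl k H B).toLinearMap.lTensor H t) := by
    intro t
    induction t with
    | zero => simp only [map_zero]
    | add x y hx hy => simp only [map_add, hx, hy]
    | tmul x y => rfl
  exact congrArg (fun x => resEquiv k H (tensorObj k V M) (tensorEquiv k V M x)) (map_orbitMap _)

def resTensorIso (V : ModuleCat.{u} H) (M : ModuleCat.{u} (SmashProduct k H B)) :
    tensorObj k V ((res k H B).obj M) ≅ (res k H B).obj (tensorObj k V M) :=
  tensorIso (isEquivariant_resEquiv k V M)

theorem map_integralEmb_comp_resTensorIso_inv {Λ : H} (hΛ : IsLeftIntegral k Λ)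
    (M : ModuleCat.{u} (SmashProduct k H B)) :
    (res k H B).map (integralEmb k hΛ M) ≫ (resTensorIso k (regular H) M).inv =
      integralEmb k hΛ ((res k H B).obj M) := by
  rw [Iso.comp_inv_eq]
  ext
  rfl

variable [FiniteDimensional k H] {Λ : H} (hΛ : IsLeftIntegral k Λ)
  (C : ObjectProperty (ModuleCat.{u} (SmashProduct k H B))) [IsAdmissible k H C]

instance restrict_additive : (restrict k H B C).Additive where
  map_add {_ _ f g} := by
    ext : 1
    exact (res k H B).map_add (f := f.hom) (g := g.hom)

theorem isCompatible_restrict :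
    (stableData k hΛ C).IsCompatible (stableData k hΛ (⊤ : ObjectProperty (ModuleCat.{u} H)))
      (restrict k H B C) := by
  have : PreservesFiniteColimits (restrict k H B C) :=
    preservesFiniteColimits_of_comp_ι C (G := res k H B) (Iso.refl _)
  refine StableData.IsCompatible.of_preservesFiniteColimits _ (fun N => ?_) (fun N => ?_)
  · refine ⟨(restrict k H B C).obj N, ObjectProperty.homMk (resTensorIso k (regular H) N.obj).inv,
      ObjectProperty.homMk (resTensorIso k (regular H) N.obj).hom, ?_⟩
    ext : 1
    exact (resTensorIso k (regular H) N.obj).inv_hom_id.symm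
  · exact ⟨ObjectProperty.homMk (resTensorIso k (regular H) N.obj).inv, by
      ext : 1; exact map_integralEmb_comp_resTensorIso_inv k hΛ N.obj⟩

end Restriction

/-! ### Grothendieck groups -/

section GrothendieckGroups

universe v₃ u₃

open ZeroObject

variable {S : Type u₁} [Category.{v₁} S] [Preadditive S] [HasZeroObject S] [HasShift S ℤ]
  [∀ n : ℤ, (shiftFunctor S n).Additive] [Pretriangulated S]
  {E : Type u₂} [Category.{v₂} E] [Preadditive E] [HasZeroObject E] [HasShift E ℤ]
  [∀ n : ℤ, (shiftFunctor E n).Additive] [Pretriangulated E]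
  {E' : Type u₃} [Category.{v₃} E'] [Preadditive E'] [HasZeroObject E'] [HasShift E' ℤ]
  [∀ n : ℤ, (shiftFunctor E' n).Additive] [Pretriangulated E']
  {𝒜 ℬ : Type*} [Category* 𝒜] [Category* ℬ] {G : Type*} [AddCommGroup G]

theorem cls_eq_of_distTriang {t : Triangle E} (ht : t ∈ distTriang E) :
    cls t.obj₂ = cls t.obj₁ + cls t.obj₃ :=
  (QuotientAddGroup.eq_iff_sub_mem (N := triangleRelations E)).2
    (AddSubgroup.subset_closure ⟨t, ht, rfl⟩)

theorem cls_zero : cls (0 : E) = 0 := by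
  have : cls (0 : E) = cls (0 : E) + cls (0 : E) :=
    cls_eq_of_distTriang (contractible_distinguished (0 : E))
  exact left_eq_add.1 this

theorem cls_eq_of_iso {X Y : E} (i : X ≅ Y) : cls X = cls Y := by
  have distinguished : Triangle.mk i.hom (0 : Y ⟶ 0) (0 : 0 ⟶ X⟦(1 : ℤ)⟧) ∈ distTriang E :=
    isomorphic_distinguished _ (contractible_distinguished X) _
      (triangleMkIso (Iso.refl X) i.symm (Iso.refl _) (by simp) (by simp) (by simp))
  have cls_Y : cls Y = cls X + cls (0 : E) := cls_eq_of_distTriang distinguished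
  rw [cls_Y, cls_zero, add_zero]

theorem grothendieckGroup_hom_ext (Q : 𝒜 ⥤ E) [Q.EssSurj] {f g : GrothendieckGroup E →+ G}
    (h : ∀ X, f (cls (Q.obj X)) = g (cls (Q.obj X))) : f = g :=
  QuotientAddGroup.addMonoidHom_ext (triangleRelations E) <| FreeAbelianGroup.lift_ext _ _ fun Y =>
    have eval_cls := cls_eq_of_iso (Q.objObjPreimageIso Y)
    (congrArg f eval_cls).symm.trans ((h _).trans (congrArg g eval_cls))

/-- The homomorphism out of the Grothendieck group given by a function on objects that is additive
on distinguished triangles. -/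
def liftCls (f : E → G) (hf : ∀ t ∈ distTriang E, f t.obj₂ = f t.obj₁ + f t.obj₃) :
    GrothendieckGroup E →+ G :=
  QuotientAddGroup.lift (triangleRelations E) (FreeAbelianGroup.lift f) <|
    (AddSubgroup.closure_le (K := (FreeAbelianGroup.lift f).ker)).2 <| by
      rintro _ ⟨t, ht, rfl⟩
      simp [AddMonoidHom.mem_ker, hf t ht]

@[simp]
theorem liftCls_cls (f : E → G) (hf) (X : E) : liftCls f hf (cls X) = f X :=
  FreeAbelianGroup.lift_apply_of f X

theorem IsExactFunctor.cls_obj {F : S ⥤ E} (hF : IsExactFunctor F) {t : Triangle S}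
    (ht : t ∈ distTriang S) :
    cls (F.obj t.obj₂) = cls (F.obj t.obj₁) + cls (F.obj t.obj₃) := by
  obtain ⟨_, _⟩ := hF
  exact cls_eq_of_distTriang (F.map_distinguished t ht)

/-- The map of Grothendieck groups induced by an exact functor. -/
def IsExactFunctor.map {F : S ⥤ E} (hF : IsExactFunctor F) :
    GrothendieckGroup S →+ GrothendieckGroup E :=
  liftCls (fun X => cls (F.obj X)) fun _ ht => hF.cls_obj ht

@[simp]
theorem IsExactFunctor.map_cls {F : S ⥤ E} (hF : IsExactFunctor F) (X : S) :
    hF.map (cls X) = cls (F.obj X) :=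
  liftCls_cls _ _ _

theorem exists_biadditive_of_isExactFunctor (P : 𝒜 ⥤ S) [P.EssSurj] (Q : ℬ ⥤ E) [Q.EssSurj]
    {F : 𝒜 → E ⥤ E'} (hF : ∀ V, IsExactFunctor (F V)) {F' : ℬ → S ⥤ E'}
    (hF' : ∀ M, IsExactFunctor (F' M))
    (e : ∀ V M, Nonempty ((F V).obj (Q.obj M) ≅ (F' M).obj (P.obj V))) :
    ∃ φ : GrothendieckGroup S →+ GrothendieckGroup E →+ GrothendieckGroup E',
      ∀ V M, φ (cls (P.obj V)) (cls (Q.obj M)) = cls ((F' M).obj (P.obj V)) := by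
  have map_cls (X : S) (M : ℬ) :
      (hF (P.objPreimage X)).map (cls (Q.obj M)) = cls ((F' M).obj X) := by
    rw [IsExactFunctor.map_cls]
    exact cls_eq_of_iso ((e _ M).some ≪≫ (F' M).mapIso (P.objObjPreimageIso X))
  refine ⟨liftCls (fun X => (hF (P.objPreimage X)).map) fun t ht =>
    grothendieckGroup_hom_ext Q fun M => ?_, fun V M => ?_⟩
  · simp only [AddMonoidHom.add_apply, map_cls, (hF' M).cls_obj ht]
  · rw [liftCls_cls, map_cls]

theorem assoc_of_assoc_cls (P : 𝒜 ⥤ S) [P.EssSurj] (Q : ℬ ⥤ E) [Q.EssSurj]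
    {φ : GrothendieckGroup S →+ GrothendieckGroup S →+ GrothendieckGroup S}
    {ψ : GrothendieckGroup S →+ GrothendieckGroup E →+ GrothendieckGroup E}
    (h : ∀ U V M, ψ (φ (cls (P.obj U)) (cls (P.obj V))) (cls (Q.obj M)) =
      ψ (cls (P.obj U)) (ψ (cls (P.obj V)) (cls (Q.obj M))))
    (x y : GrothendieckGroup S) (z : GrothendieckGroup E) : ψ (φ x y) z = ψ x (ψ y z) := by
  have assoc_left_two (U V z) :
      ψ (φ (cls (P.obj U)) (cls (P.obj V))) z = ψ (cls (P.obj U)) (ψ (cls (P.obj V)) z) :=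
    DFunLike.congr_fun (grothendieckGroup_hom_ext Q (f := ψ (φ (cls (P.obj U)) (cls (P.obj V))))
      (g := (ψ (cls (P.obj U))).comp (ψ (cls (P.obj V)))) (h U V)) z
  have assoc_left_one (U y z) : ψ (φ (cls (P.obj U)) y) z = ψ (cls (P.obj U)) (ψ y z) :=
    DFunLike.congr_fun (grothendieckGroup_hom_ext P (f := (ψ.flip z).comp (φ (cls (P.obj U))))
      (g := (ψ (cls (P.obj U))).comp (ψ.flip z)) (assoc_left_two U · z)) y
  exact DFunLike.congr_fun (grothendieckGroup_hom_ext P (f := (ψ.flip z).comp (φ.flip y))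
    (g := ψ.flip (ψ y z)) (assoc_left_one · y z)) x

end GrothendieckGroups

section RingOfBiadditive

variable {K L : Type*} [AddCommGroup K] [AddCommGroup L] {φ : K →+ K →+ K} {e : K}

/-- The ring whose multiplication is an associative biadditive map with a unit `e`. -/
abbrev ringOfBiadditive (assoc : ∀ x y z, φ (φ x y) z = φ x (φ y z))
    (unit_left : φ e = AddMonoidHom.id K) (unit_right : φ.flip e = AddMonoidHom.id K) : Ring K where
  __ := (inferInstance : AddCommGroup K)
  mul x y := φ x y
  one := e
  left_distrib x := map_add (φ x)
  right_distrib x y := DFunLike.congr_fun (map_add φ x y)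
  zero_mul := DFunLike.congr_fun (map_zero φ)
  mul_zero x := map_zero (φ x)
  one_mul := DFunLike.congr_fun unit_left
  mul_one := DFunLike.congr_fun unit_right
  mul_assoc := assoc

/-- The module over `ringOfBiadditive` given by an associative and unital biadditive action. -/
abbrev moduleOfBiadditive {assoc : ∀ x y z, φ (φ x y) z = φ x (φ y z)}
    {unit_left : φ e = AddMonoidHom.id K} {unit_right : φ.flip e = AddMonoidHom.id K}
    (ψ : K →+ L →+ L) (smul_assoc : ∀ x y z, ψ (φ x y) z = ψ x (ψ y z))
    (smul_unit : ψ e = AddMonoidHom.id L) :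
    letI := ringOfBiadditive assoc unit_left unit_right
    Module K L :=
  letI := ringOfBiadditive assoc unit_left unit_right
  { smul := fun x m => ψ x m
    one_smul := DFunLike.congr_fun smul_unit
    mul_smul := smul_assoc
    smul_zero := fun x => map_zero (ψ x)
    smul_add := fun x => map_add (ψ x)
    add_smul := fun x y => DFunLike.congr_fun (map_add ψ x y)
    zero_smul := DFunLike.congr_fun (map_zero ψ) }

end RingOfBiadditive

/-! ### Localization at the morphisms inverted by an exact functor -/

section Localization

open ZeroObject

variable {𝒯 : Type u₁} [Category.{v₁} 𝒯] [Preadditive 𝒯] [HasZeroObject 𝒯] [HasShift 𝒯 ℤ]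
  [∀ n : ℤ, (shiftFunctor 𝒯 n).Additive] [Pretriangulated 𝒯]
  {𝒰 : Type u₂} [Category.{v₂} 𝒰] [Preadditive 𝒰] [HasZeroObject 𝒰] [HasShift 𝒰 ℤ]
  [∀ n : ℤ, (shiftFunctor 𝒰 n).Additive] [Pretriangulated 𝒰]

instance isTriangulated_isZero : ObjectProperty.IsTriangulated (IsZero (C := 𝒰)) where
  exists_zero := ⟨0, isZero_zero _, isZero_zero _⟩
  isStableUnderShiftBy n := ⟨fun _ hX => (shiftFunctor 𝒰 n).map_isZero hX⟩
  toIsTriangulatedClosed₂ := .mk' fun T hT h₁ h₃ => Triangle.isZero₂_of_isZero₁₃ T hT h₁ h₃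

theorem trW_isZero_iff {X Y : 𝒰} (f : X ⟶ Y) :
    ObjectProperty.trW (IsZero (C := 𝒰)) f ↔ IsIso f := by
  constructor
  · rw [ObjectProperty.trW_iff]
    rintro ⟨Z, g, h, hT, hZ⟩
    exact (Triangle.isZero₃_iff_isIso₁ _ hT).1 hZ
  · intro _
    exact ObjectProperty.trW_of_isIso _ f

variable {W : MorphismProperty 𝒯}

/-- Both `W` and the calculus of fractions come from the kernel of `F`. -/
theorem IsExactFunctor.calculusOfFractions [IsTriangulated 𝒯] {F : 𝒯 ⥤ 𝒰} (hF : IsExactFunctor F)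
    (hW : ∀ {X Y : 𝒯} (f : X ⟶ Y), W f ↔ IsIso (F.map f)) :
    W.HasLeftCalculusOfFractions ∧ W.HasRightCalculusOfFractions ∧
      W.IsCompatibleWithTriangulation := by
  obtain ⟨_, _⟩ := hF
  have eq_trW : W = (ObjectProperty.inverseImage (IsZero (C := 𝒰)) F).trW := by
    ext X Y f
    rw [ObjectProperty.inverseImage_trW_iff, trW_isZero_iff, hW]
  rw [eq_trW]
  exact ⟨inferInstance, inferInstance, inferInstance⟩

variable [W.HasLeftCalculusOfFractions] [W.IsCompatibleWithTriangulation]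

theorem isExactFunctor_Q : IsExactFunctor W.Q :=
  ⟨inferInstance, inferInstance⟩

theorem IsExactFunctor.localizationLift {F : 𝒯 ⥤ 𝒰} (hF : IsExactFunctor F)
    (h : W.IsInvertedBy F) : IsExactFunctor (Localization.lift F h W.Q) := by
  obtain ⟨_, _⟩ := hF
  let G := Localization.lift F h W.Q
  let : G.CommShift ℤ := Functor.commShiftOfLocalization W.Q W ℤ F G
  have : NatTrans.CommShift (Localization.fac F h W.Q).hom ℤ :=
    inferInstanceAs (NatTrans.CommShift (Localization.Lifting.iso W.Q W F G).hom ℤ)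
  have := Localization.essSurj_mapArrow W.Q W
  exact ⟨inferInstance, Functor.isTriangulated_of_precomp_iso (Localization.fac F h W.Q)⟩

end Localization

namespace StableData

universe v₃ u₃

theorem IsTriangulation.comp {𝒜 : Type u₁} [Category.{v₁} 𝒜] [Preadditive 𝒜] {D : StableData 𝒜}
    {E : Type u₂} [Category.{v₂} E] [Preadditive E] [HasZeroObject E] [HasShift E ℤ]
    [∀ n : ℤ, (shiftFunctor E n).Additive] [Pretriangulated E] {Q : 𝒜 ⥤ E}
    {E' : Type u₃} [Category.{v₃} E'] [Preadditive E'] [HasZeroObject E'] [HasShift E' ℤ]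
    [∀ n : ℤ, (shiftFunctor E' n).Additive] [Pretriangulated E'] [IsTriangulated E']
    (h : D.IsTriangulation Q) (L : E ⥤ E') [L.CommShift ℤ] [L.IsTriangulated]
    [L.mapArrow.EssSurj] : D.IsTriangulation (Q ⋙ L) := by
  obtain ⟨-, _, e, he⟩ := h
  let e' : D.T ⋙ Q ⋙ L ≅ (Q ⋙ L) ⋙ shiftFunctor E' (1 : ℤ) :=
    Functor.isoWhiskerRight e L ≪≫ Functor.isoWhiskerLeft Q (L.commShiftIso (1 : ℤ))
  have map_connecting {X Z : 𝒜} (w : Z ⟶ D.T.obj X) :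
      L.map (Q.map w ≫ e.hom.app X) ≫ (L.commShiftIso (1 : ℤ)).hom.app (Q.obj X) =
        (Q ⋙ L).map w ≫ e'.hom.app X := by
    simp [e']
  have mapTriangle_cone {X Y Z : 𝒜} (f : X ⟶ Y) (v : Y ⟶ Z) (w : Z ⟶ D.T.obj X) :
      L.mapTriangle.obj (Triangle.mk (Q.map f) (Q.map v) (Q.map w ≫ e.hom.app X)) =
        Triangle.mk ((Q ⋙ L).map f) ((Q ⋙ L).map v) ((Q ⋙ L).map w ≫ e'.hom.app X) :=
    congrArg (Triangle.mk ((Q ⋙ L).map f) ((Q ⋙ L).map v)) (map_connecting w)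
  refine ⟨inferInstance, inferInstance, e', ?_⟩
  ext t
  rw [L.distTriang_iff]
  constructor
  · rintro ⟨t', i, ht'⟩
    rw [he] at ht'
    obtain ⟨X, Y, Z, f, v, w, hc, ⟨j⟩⟩ := ht'
    exact ⟨X, Y, Z, f, v, w, hc, ⟨i ≪≫ L.mapTriangle.mapIso j ≪≫ eqToIso (mapTriangle_cone f v w)⟩⟩
  · rintro ⟨X, Y, Z, f, v, w, hc, ⟨j⟩⟩
    refine ⟨_, j ≪≫ eqToIso (mapTriangle_cone f v w).symm, ?_⟩
    rw [he]
    exact hc.mem_coneTriangles e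

end StableData

/-! ### Tensor actions on Grothendieck groups -/

section TensorAction

universe v₃ u₃

variable (k : Type u) {H A : Type u} [Field k] [Ring H] [HopfAlgebra k H] [Ring A] [Algebra k A]
  [LeftComoduleAlgebra k H A] (C : ObjectProperty (ModuleCat.{u} A)) [IsAdmissible k H C]

/-- Tensoring the modules of a class with a finite-dimensional module. -/
abbrev tensorFin (V : (finDim k H).FullSubcategory) : C.FullSubcategory ⥤ C.FullSubcategory :=
  tensorOn k C (preservesClass_of_finDim k C V.property)

/-- The trivial module `k`, as a finite-dimensional module. -/
abbrev trivialFin (H : Type u) [Ring H] [HopfAlgebra k H] : (finDim k H).FullSubcategory :=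
  ⟨trivialModule k H, finDim_trivialModule k H⟩

variable {S : Type u₁} [Category.{v₁} S] [Preadditive S] [HasZeroObject S] [HasShift S ℤ]
  [∀ n : ℤ, (shiftFunctor S n).Additive] [Pretriangulated S] (P : (finDim k H).FullSubcategory ⥤ S)
  {E : Type u₂} [Category.{v₂} E] [Preadditive E] [HasZeroObject E] [HasShift E ℤ]
  [∀ n : ℤ, (shiftFunctor E n).Additive] [Pretriangulated E] (Q : C.FullSubcategory ⥤ E)

/-- A biadditive map of Grothendieck groups that is given by `V ⊗ M` on the classes of modules,
where `P` and `Q` send modules to the objects of the triangulated categories. -/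
def IsTensorAction
    (ψ : GrothendieckGroup S →+ GrothendieckGroup E →+ GrothendieckGroup E) : Prop :=
  ∀ V M, ψ (cls (P.obj V)) (cls (Q.obj M)) = cls (Q.obj ((tensorFin k C V).obj M))

variable {k C P Q} {φ : GrothendieckGroup S →+ GrothendieckGroup S →+ GrothendieckGroup S}
  {ψ : GrothendieckGroup S →+ GrothendieckGroup E →+ GrothendieckGroup E}

theorem IsTensorAction.unit_left [Q.EssSurj] (hψ : IsTensorAction k C P Q ψ) :
    ψ (cls (P.obj (trivialFin k H))) = AddMonoidHom.id (GrothendieckGroup E) :=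
  grothendieckGroup_hom_ext Q fun M =>
    (hψ _ M).trans (cls_eq_of_iso (Q.mapIso (C.isoMk (leftUnitIso k M.obj))))

variable [FiniteDimensional k H]

theorem IsTensorAction.assoc [P.EssSurj] [Q.EssSurj] (hψ : IsTensorAction k C P Q ψ)
    (hφ : IsTensorAction k (finDim k H) P P φ) (x y : GrothendieckGroup S)
    (z : GrothendieckGroup E) : ψ (φ x y) z = ψ x (ψ y z) := by
  refine assoc_of_assoc_cls P Q (fun U V M => ?_) x y z
  rw [hφ, hψ, hψ, hψ]
  exact cls_eq_of_iso (Q.mapIso (C.isoMk (assocIso k U.obj V.obj M.obj)))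

theorem IsTensorAction.unit_right [P.EssSurj] (hφ : IsTensorAction k (finDim k H) P P φ) :
    φ.flip (cls (P.obj (trivialFin k H))) = AddMonoidHom.id (GrothendieckGroup S) :=
  grothendieckGroup_hom_ext P fun V =>
    (hφ V _).trans (cls_eq_of_iso (P.mapIso ((finDim k H).isoMk (rightUnitIso k V.obj))))

end TensorAction

/-! ### The stable and the derived category -/

section StableCategory

variable (k : Type u) {H A : Type u} [Field k] [Ring H] [HopfAlgebra k H] [FiniteDimensional k H]
  [Ring A] [Algebra k A] [LeftComoduleAlgebra k H A] {Λ : H} (hΛ : IsLeftIntegral k Λ)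

theorem isStandardTriangulation_iff (C : ObjectProperty (ModuleCat.{u} A)) [IsAdmissible k H C]
    {E : Type*} [Category* E] (Q : C.FullSubcategory ⥤ E) [Preadditive E] [HasZeroObject E]
    [HasShift E ℤ] [∀ n : ℤ, (shiftFunctor E n).Additive] [Pretriangulated E] :
    IsStandardTriangulation k C hΛ Q ↔ (stableData k hΛ C).IsTriangulation Q := by
  have mem_coneTriangles_iff (e : shiftT k C Λ ⋙ Q ≅ Q ⋙ shiftFunctor E (1 : ℤ))
      (t : Triangle E) : t ∈ StableData.coneTriangles (D := stableData k hΛ C) e ↔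
        ∃ (X Y Z : C.FullSubcategory) (f : X ⟶ Y) (v : Y ⟶ Z) (w : Z ⟶ (shiftT k C Λ).obj X),
          IsStandardTriangle k C hΛ f v w ∧
          Nonempty (t ≅ Triangle.mk (Q.map f) (Q.map v) (Q.map w ≫ e.hom.app X)) := by
    simp only [← stableData_isCone_iff]
    rfl
  refine and_congr_right fun _ => and_congr_right fun _ => exists_congr fun e => ?_
  rw [Set.ext_iff]
  exact forall_congr' fun t => iff_congr Iff.rfl (mem_coneTriangles_iff e t).symm

theorem exists_isTriangulation_quotient (C : ObjectProperty (ModuleCat.{u} A)) [IsAdmissible k H C]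
    {r : HomRel C.FullSubcategory}
    (hr : ∀ {M N : C.FullSubcategory} (f g : M ⟶ N), r f g ↔ (stableData k hΛ C).Null (f - g)) :
    ∃ (_ : Preadditive (CategoryTheory.Quotient r)) (_ : HasZeroObject (CategoryTheory.Quotient r))
      (_ : HasShift (CategoryTheory.Quotient r) ℤ)
      (_ : ∀ n : ℤ, (shiftFunctor (CategoryTheory.Quotient r) n).Additive)
      (_ : Pretriangulated (CategoryTheory.Quotient r)),
      (stableData k hΛ C).IsTriangulation (CategoryTheory.Quotient.functor r) :=
  StableData.exists_isTriangulation hr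

theorem exists_isTensorAction_toStable [Preadditive (StableCat (finDim k H))]
    [HasZeroObject (StableCat (finDim k H))] [HasShift (StableCat (finDim k H)) ℤ]
    [∀ n : ℤ, (shiftFunctor (StableCat (finDim k H)) n).Additive]
    [Pretriangulated (StableCat (finDim k H))]
    (h₀ : (stableData k hΛ (finDim k H)).IsTriangulation (toStable (finDim k H))) :
    ∃ φ, IsTensorAction k (finDim k H) (toStable (finDim k H)) (toStable (finDim k H)) φ :=
  have hr {V W : (finDim k H).FullSubcategory} (f g : V ⟶ W) := stableRel_iff k hΛ (finDim k H) f g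
  exists_biadditive_of_isExactFunctor (toStable (finDim k H)) (toStable (finDim k H))
    (fun V => (isCompatible_tensorOn k hΛ (finDim k H)
      (preservesClass_of_finDim k _ V.property)).isExactFunctor_stableFunctor
        (StableData.isStableQuotient hr) hr h₀ h₀)
    (fun W => (isCompatible_tensorWith k hΛ (finDim k H) W).isExactFunctor_stableFunctor
      (StableData.isStableQuotient hr) hr h₀ h₀)
    fun _ _ => ⟨Iso.refl _⟩

end StableCategory

section DerivedCategory

variable (k H B : Type u) [Field k] [Ring H] [HopfAlgebra k H] [FiniteDimensional k H] [Ring B]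
  [Algebra k B] [RightModuleAlgebra k H B] {Λ : H} (hΛ : IsLeftIntegral k Λ)
  (C : ObjectProperty (ModuleCat.{u} (SmashProduct k H B))) [IsAdmissible k H C]

/-- Restriction of modules along `H → H # B`, from the homotopy to the stable category. -/
abbrev stableRestrict : HomotopyCat k H C ⥤ StableCat (⊤ : ObjectProperty (ModuleCat.{u} H)) :=
  (isCompatible_restrict k hΛ C).stableFunctor
    (StableData.isStableQuotient (stableRel_iff k hΛ ⊤)) (homotopyRel_iff k hΛ C)

variable {B C} in
theorem quasiIso_iff {X Y : HomotopyCat k H C} (f : X ⟶ Y) :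
    quasiIso k H B C f ↔ IsIso ((stableRestrict k H B hΛ C).map f) := by
  constructor
  · rintro ⟨g, rfl, h⟩
    exact h
  · intro h
    obtain ⟨g, rfl⟩ := (CategoryTheory.Quotient.functor (homotopyRel k H C)).map_surjective
      (X := X.as) (Y := Y.as) f
    exact ⟨g, rfl, h⟩

variable {B}

def tensorOnRestrictIso {V : ModuleCat.{u} H} (hV : PreservesClass k V C) :
    tensorOn k C hV ⋙ restrict k H B C ≅ restrict k H B C ⋙
      tensorOn k (⊤ : ObjectProperty (ModuleCat.{u} H)) (V := V) (fun _ _ => trivial) :=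
  NatIso.ofComponents (fun M => ObjectProperty.isoMk ⊤ (resTensorIso k V M.obj).symm)
    fun {M N} f => by
      ext : 1
      change (res k H B).map (tensorMap k (𝟙 V) f.hom) ≫ (resTensorIso k V N.obj).inv =
        (resTensorIso k V M.obj).inv ≫ tensorMap k (𝟙 V) ((res k H B).map f.hom)
      rw [Iso.comp_inv_eq, Category.assoc, Iso.eq_inv_comp]
      exact tensorObj_hom_ext k fun _ _ => rfl

variable {V : ModuleCat.{u} H} (hV : PreservesClass k V C)

/-- The functor `V ⊗ -` on the homotopy category. -/
abbrev homotopyTensor : HomotopyCat k H C ⥤ HomotopyCat k H C :=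
  (isCompatible_tensorOn k hΛ C hV).stableFunctor
    (StableData.isStableQuotient (homotopyRel_iff k hΛ C)) (homotopyRel_iff k hΛ C)

theorem quasiIso_homotopyTensor_map {X Y : HomotopyCat k H C} {f : X ⟶ Y}
    (hf : quasiIso k H B C f) : quasiIso k H B C ((homotopyTensor k H hΛ C hV).map f) := by
  obtain ⟨g, rfl, h⟩ := hf
  refine ⟨(tensorOn k C hV).map g, rfl, ?_⟩
  let stableTensor := (isCompatible_tensorOn k hΛ (⊤ : ObjectProperty (ModuleCat.{u} H)) (V := V)
    (fun _ _ => trivial)).stableFunctor (StableData.isStableQuotient (stableRel_iff k hΛ ⊤))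
      (stableRel_iff k hΛ ⊤)
  have isIso_tensor_restrict :
      IsIso (stableTensor.map ((toStable ⊤).map ((restrict k H B C).map g))) :=
    inferInstance
  exact (NatIso.isIso_map_iff
    (Functor.isoWhiskerRight (tensorOnRestrictIso k H C hV) (toStable ⊤)) g).2 isIso_tensor_restrict

theorem isInvertedBy_homotopyTensor_comp_Q :
    (quasiIso k H B C).IsInvertedBy (homotopyTensor k H hΛ C hV ⋙ (quasiIso k H B C).Q) :=
  fun _ _ _ hf => (quasiIso k H B C).Q_inverts _ (quasiIso_homotopyTensor_map k H hΛ C hV hf)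

/-- The functor `V ⊗ -` on the derived category. -/
abbrev derivedTensor : DerivedCat k H B C ⥤ DerivedCat k H B C :=
  Localization.lift (homotopyTensor k H hΛ C hV ⋙ (quasiIso k H B C).Q)
    (isInvertedBy_homotopyTensor_comp_Q k H hΛ C hV) (quasiIso k H B C).Q

def toDerivedCompDerivedTensorIso :
    toDerived k H B C ⋙ derivedTensor k H hΛ C hV ≅ tensorOn k C hV ⋙ toDerived k H B C :=
  Functor.isoWhiskerLeft (CategoryTheory.Quotient.functor (homotopyRel k H C))
    (Localization.fac (homotopyTensor k H hΛ C hV ⋙ (quasiIso k H B C).Q)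
      (isInvertedBy_homotopyTensor_comp_Q k H hΛ C hV) (quasiIso k H B C).Q)

/-- The functor `- ⊗ M` from the stable category to the derived category. -/
abbrev derivedTensorRight (M : C.FullSubcategory) :
    StableCat (finDim k H) ⥤ DerivedCat k H B C :=
  (isCompatible_tensorWith k hΛ C M).stableFunctor
    (StableData.isStableQuotient (homotopyRel_iff k hΛ C)) (stableRel_iff k hΛ (finDim k H)) ⋙
      (quasiIso k H B C).Q

instance essSurj_toDerived : (toDerived k H B C).EssSurj :=
  have := Localization.essSurj (quasiIso k H B C).Q (quasiIso k H B C)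
  inferInstance

section Triangulation

variable {k H} [Preadditive (StableCat (finDim k H))]
  [HasZeroObject (StableCat (finDim k H))] [HasShift (StableCat (finDim k H)) ℤ]
  [∀ n : ℤ, (shiftFunctor (StableCat (finDim k H)) n).Additive]
  [Pretriangulated (StableCat (finDim k H))]

theorem exists_isTriangulation_toDerived
    (h₀ : (stableData k hΛ (finDim k H)).IsTriangulation (toStable (finDim k H))) :
    ∃ (_ : Preadditive (DerivedCat k H B C)) (_ : HasZeroObject (DerivedCat k H B C))
      (_ : HasShift (DerivedCat k H B C) ℤ)
      (_ : ∀ n : ℤ, (shiftFunctor (DerivedCat k H B C) n).Additive)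
      (_ : Pretriangulated (DerivedCat k H B C)),
      (stableData k hΛ C).IsTriangulation (toDerived k H B C) ∧
      (∀ {V : ModuleCat.{u} H} (hV : PreservesClass k V C),
        IsExactFunctor (derivedTensor k H hΛ C hV)) ∧
      ∀ M : C.FullSubcategory, IsExactFunctor (derivedTensorRight k H hΛ C M) := by
  have hr {M N : C.FullSubcategory} (f g : M ⟶ N) := homotopyRel_iff k hΛ C f g
  obtain ⟨_, _, _, _, _, h⟩ := exists_isTriangulation_quotient k hΛ C hr
  obtain ⟨_, _, _, _, _, h'⟩ := exists_isTriangulation_quotient k hΛ _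
    (stableRel_iff k hΛ (⊤ : ObjectProperty (ModuleCat.{u} H)))
  have := h.1
  have exact_restrict : IsExactFunctor (stableRestrict k H B hΛ C) :=
    (isCompatible_restrict k hΛ C).isExactFunctor_stableFunctor _ hr h h'
  obtain ⟨_, _, _⟩ := exact_restrict.calculusOfFractions (quasiIso_iff k H hΛ)
  have := Localization.essSurj_mapArrow (quasiIso k H B C).Q (quasiIso k H B C)
  refine ⟨inferInstance, inferInstance, inferInstance, inferInstance, inferInstance,
    h.comp (quasiIso k H B C).Q, fun hV => ?_, fun M => ?_⟩
  · exact (((isCompatible_tensorOn k hΛ C hV).isExactFunctor_stableFunctor _ hr h h).comp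
      isExactFunctor_Q).localizationLift _
  · exact ((isCompatible_tensorWith k hΛ C M).isExactFunctor_stableFunctor _
      (stableRel_iff k hΛ (finDim k H)) h₀ h).comp isExactFunctor_Q

theorem exists_isTensorAction_toDerived [Preadditive (DerivedCat k H B C)]
    [HasZeroObject (DerivedCat k H B C)] [HasShift (DerivedCat k H B C) ℤ]
    [∀ n : ℤ, (shiftFunctor (DerivedCat k H B C) n).Additive] [Pretriangulated (DerivedCat k H B C)]
    (hF : ∀ {V : ModuleCat.{u} H} (hV : PreservesClass k V C),
      IsExactFunctor (derivedTensor k H hΛ C hV))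
    (hF' : ∀ M : C.FullSubcategory, IsExactFunctor (derivedTensorRight k H hΛ C M)) :
    ∃ ψ, IsTensorAction k C (toStable (finDim k H)) (toDerived k H B C) ψ :=
  exists_biadditive_of_isExactFunctor (toStable (finDim k H)) (toDerived k H B C)
    (fun V => hF (preservesClass_of_finDim k C V.property)) hF'
    fun _ M => ⟨(toDerivedCompDerivedTensorIso k H hΛ C _).app M⟩

end Triangulation

end DerivedCategory

end Hopfological

end

theorem mainTheorem3 (k H B : Type u) [Field k] [Ring H] [HopfAlgebra k H] [FiniteDimensional k H]
    [Ring B] [Algebra k B] [RightModuleAlgebra k H B] :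
    (∃ Λ : H, IsLeftIntegral k Λ) ∧
    ∀ (Λ : H) (hΛ : IsLeftIntegral k Λ),
    -- the stable category of finite-dimensional `H`-modules is triangulated ...
    ∃ (_ : Preadditive (StableCat (finDim k H)))
      (_ : HasZeroObject (StableCat (finDim k H)))
      (_ : HasShift (StableCat (finDim k H)) ℤ)
      (_ : ∀ n : ℤ, (shiftFunctor (StableCat (finDim k H)) n).Additive)
      (_ : Pretriangulated (StableCat (finDim k H))),
      IsStandardTriangulation k (finDim k H) hΛ (toStable (finDim k H)) ∧
    -- ... and its Grothendieck group is a ring under the tensor product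
    ∃ R : Ring (GrothendieckGroup (StableCat (finDim k H))),
      R.toAddCommGroup = instAddCommGroupGrothendieckGroup (StableCat (finDim k H)) ∧
      (1 = cls ((toStable (finDim k H)).obj ⟨trivialModule k H, finDim_trivialModule k H⟩)) ∧
      (∀ V W : (finDim k H).FullSubcategory,
        cls ((toStable (finDim k H)).obj V) * cls ((toStable (finDim k H)).obj W) =
          cls ((toStable (finDim k H)).obj
            ((tensorOn k (finDim k H)
              (preservesClass_of_finDim k (finDim k H) V.property)).obj W))) ∧
    -- for every admissible class of `H # B`-modules (e.g. all modules),
    ∀ (C : ObjectProperty (ModuleCat.{u} (SmashProduct k H B))) [IsAdmissible k H C],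
    -- the derived category is triangulated,
    ∃ (_ : Preadditive (DerivedCat k H B C))
      (_ : HasZeroObject (DerivedCat k H B C))
      (_ : HasShift (DerivedCat k H B C) ℤ)
      (_ : ∀ n : ℤ, (shiftFunctor (DerivedCat k H B C) n).Additive)
      (_ : Pretriangulated (DerivedCat k H B C)),
      IsStandardTriangulation k C hΛ (toDerived k H B C) ∧
      -- tensoring with an `H`-module induces an exact functor on it,
      (∀ (V : ModuleCat.{u} H) (hV : PreservesClass k V C),
        ∃ F : DerivedCat k H B C ⥤ DerivedCat k H B C,
          Nonempty (toDerived k H B C ⋙ F ≅ tensorOn k C hV ⋙ toDerived k H B C) ∧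
          F.Additive ∧ ∃ _ : F.CommShift ℤ, F.IsTriangulated) ∧
      -- and its Grothendieck group is a module over that of the stable category
      ∃ _ : Module (GrothendieckGroup (StableCat (finDim k H)))
          (GrothendieckGroup (DerivedCat k H B C)),
        ∀ (V : (finDim k H).FullSubcategory) (M : C.FullSubcategory),
          cls ((toStable (finDim k H)).obj V) • cls ((toDerived k H B C).obj M) =
            cls ((toDerived k H B C).obj
              ((tensorOn k C (preservesClass_of_finDim k C V.property)).obj M)) := by
  refine ⟨exists_isLeftIntegral k H, fun Λ hΛ => ?_⟩
  obtain ⟨_, _, _, _, _, h₀⟩ :=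
    exists_isTriangulation_quotient k hΛ (finDim k H) (stableRel_iff k hΛ (finDim k H))
  obtain ⟨φ, hφ⟩ := exists_isTensorAction_toStable k hΛ h₀
  refine ⟨_, _, _, _, _, (isStandardTriangulation_iff k hΛ _ _).2 h₀,
    ringOfBiadditive (hφ.assoc hφ) hφ.unit_left hφ.unit_right, rfl, rfl, hφ, fun C _ => ?_⟩
  obtain ⟨_, _, _, _, _, h, exact_tensor, exact_tensorRight⟩ :=
    exists_isTriangulation_toDerived hΛ C h₀
  obtain ⟨ψ, hψ⟩ := exists_isTensorAction_toDerived hΛ C exact_tensor exact_tensorRight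
  exact ⟨_, _, _, _, _, (isStandardTriangulation_iff k hΛ _ _).2 h,
    fun V hV => ⟨derivedTensor k H hΛ C hV, ⟨toDerivedCompDerivedTensorIso k H hΛ C hV⟩,
      (exact_tensor hV).additive, exact_tensor hV⟩,
    moduleOfBiadditive ψ (hψ.assoc hφ) hψ.unit_left, hψ⟩
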